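/- **Setting.** Let $N\ge 1$; $n\times p$ matrices carry the Frobenius inner product. Node $i\in\{1,\dots,N\}$ has a data distribution $\mathcal D_i$ and the objective $f_i(X)=\mathbb E_{\xi\sim\mathcal D_i}F(X;\xi)$; put $f=\frac1N\sum_i f_i$. For $0<\epsilon<3/4$ let $\mathrm{St}^\epsilon=\{X\in\mathbb R^{n\times p}:\|X^\top X-I_p\|_F\le\epsilon\}$, $\mathcal N(X)=\frac14\|X^\top X-I_p\|_F^2$, $\mathrm{grad}f(X)=\mathrm{skew}(\nabla f(X)X^\top)X$ and, for $\lambda>0$, $\tilde\Lambda(X;g)=\mathrm{skew}(gX^\top)X+\lambda X(X^\top X-I_p)$. Assume: $\|\nabla F(X;\xi)\|_F\le L'$ for $X\in\mathrm{St}^\epsilon$ and ($\mathcal D_i$-almost) every sample; each $f_i$ is differentiable, $\nabla f_i$ is $L_i$-Lipschitz and $\nabla f$ is $L$-Lipschitz on $\mathrm{St}^\epsilon$; $f$ is bounded below on $\mathrm{St}^\epsilon$; for $X\in\mathrm{St}^\epsilon$, $\nabla F(X;\xi)$, $\xi\sim\mathcal D_i$, has mean $\nabla f_i(X)$ and variance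 at most $\sigma^2$, $\sigma>0$. Let $\mathcal C$ be a random compressor with $\mathbb E\|\mathcal C(X)-X\|_F^2\le(1-\alpha)\|X\|_F^2$ for all $X$, where $0<\alpha<1$. Put $\tilde L=(\frac1N\sum_iL_i^2)^{1/2}$, $\hat L=\max\{L,L'\}$, $\theta=1-\sqrt{1-\alpha}$, $\beta=(1-\alpha)/\theta$, and let $\mu\ge\frac{2}{3-4\epsilon}\big(L(1-\epsilon)+3\sqrt{1+\epsilon}\,L'+2\hat L^2\frac{1+\epsilon}{\lambda}\big)$. Let $m(X)=f(X)-\frac12\langle\mathrm{sym}(X^\top\nabla f(X)),X^\top X-I_p\rangle+\mu\mathcal N(X)$, let $m^*=\inf_{\mathrm{St}^\epsilon}m$, and let $L_m$ be a Lipschitz constant of $\nabla m$ on $\mathrm{St}^\epsilon$ ($m$ being differentiable there). The constants $L,L',\tilde L,L_m$ are positive. **Algorithm (EF-Landing).** Start from a deterministic $X^0\in\mathrm{St}^\epsilon$, $v_i^0=\nabla F(X^0;\xi_i^0)$, $g_i^0=\mathcal C(v_i^0)$, $g^0=\frac1N\sum_ig_i^0$. With step size $\gamma>0$ and momentum $\eta\in(0,1]$,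 for $k\ge0$: $\tilde g^k=\min\{1,L'/\|g^k\|_F\}g^k$, $X^{k+1}=X^k-\gamma\tilde\Lambda(X^k;\tilde g^k)$, $v_i^{k+1}=(1-\eta)v_i^k+\eta\nabla F(X^{k+1};\xi_i^{k+1})$, $c_i^k=\mathcal C(v_i^{k+1}-g_i^k)$, $g_i^{k+1}=g_i^k+c_i^k$, $g^{k+1}=g^k+\frac1N\sum_ic_i^k$. In each round the samples $\xi_i^k\sim\mathcal D_i$ are independent across nodes and of the past, and the randomness of each compressor is independent of the past and of the current samples. **Parameters.** Let $\ell=\lambda^2$ if $\lambda\ge\frac12$ or $\mu\ge\lambda(1+\epsilon)$, and $\ell=\lambda$ otherwise. Let $\gamma_s=\min\Big\{\frac{\lambda(1-\epsilon)\epsilon}{(1+\epsilon)^2L'^2+\lambda^2(1+\epsilon)\epsilon^2},\sqrt{\frac{\epsilon}{2(1+\epsilon)^2L'^2}},\frac1{2\lambda}\Big\}$, $$\gamma(\eta)=\min\Big\{\gamma_s,\ \tfrac1{6\tilde L}\sqrt{\tfrac{\theta}{4\beta}},\ \tfrac{\eta}{12L},\ \tfrac1{6L_m},\ \tfrac1{12\tilde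 L}\sqrt{\tfrac{\mu\theta}{2\ell(1+\epsilon)\beta}},\ \tfrac{\eta}{12L}\sqrt{\tfrac{\mu}{2\ell(1+\epsilon)}},\ \tfrac{\mu}{12\ell(1+\epsilon)L_m}\Big\},$$ $$\mathcal L^0(\eta)=\mathbb E\Big[m(X^0)-m^*+\tfrac{2\gamma(\eta)}{\theta}\tilde G^0+\tfrac{4\gamma(\eta)\eta\beta}{\theta}\tilde P^0+\tfrac{2\gamma(\eta)}{\eta}P^0\Big],$$ where $\tilde G^0=\frac1N\sum_i\|g_i^0-v_i^0\|_F^2$, $\tilde P^0=\frac1N\sum_i\|v_i^0-\nabla f_i(X^0)\|_F^2$, $P^0=\|\frac1N\sum_iv_i^0-\nabla f(X^0)\|_F^2$. Let $C_1=\frac1{\gamma_s}+6L_m+\frac{12\ell(1+\epsilon)L_m}{\mu}+12\tilde L\sqrt{\frac\beta\theta}+12\tilde L\sqrt{\frac{2\ell(1+\epsilon)\beta}{\mu\theta}}$, $C_2=12L+12L\sqrt{\frac{2\ell(1+\epsilon)}{\mu}}$ and, for $M,K,\mathcal L\ge0$, $$R(M,K,\mathcal L)=\frac{C_1\mathcal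 L}{K}+4\Big(\frac{2\sigma^2C_2\mathcal L}{MK}\Big)^{\frac12}+4\Big(\frac{2\sigma^2(1-\alpha)}{\theta}\Big)^{\frac13}\Big(\frac{C_2\mathcal L}{K}\Big)^{\frac23}+4\Big(\frac{4\beta\sigma^2}{\theta}\Big)^{\frac14}\Big(\frac{C_2\mathcal L}{K}\Big)^{\frac34}.$$ **Theorem.** Let $K\ge1$ and let $\eta\in(0,1]$ satisfy, with $\mathcal L^0=\mathcal L^0(\eta)$, $$\eta=\min\Big\{\Big(\frac{C_2N\mathcal L^0}{2\sigma^2K}\Big)^{\frac12},\Big(\frac{\theta C_2\mathcal L^0}{2(1-\alpha)\sigma^2K}\Big)^{\frac13},\Big(\frac{\theta C_2\mathcal L^0}{4\beta\sigma^2K}\Big)^{\frac14}\Big\}.$$ Then EF-Landing with momentum $\eta$ and step size $\gamma(\eta)$ satisfies (all expectations being finite) $$\frac1K\sum_{k=0}^{K-1}\mathbb E\|\mathrm{grad}f(X^k)\|_F^2\le4R(N,K,\mathcal L^0),\qquad\frac1K\sum_{k=0}^{K-1}\mathbb E[\mathcal N(X^k)]\le\frac2{\lambda\mu}R(N,K,\mathcal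 L^0).$$ Moreover $R(N,K,\mathcal L^0)$ is of order $1/\sqrt{NK}$: if $K\ge N^3$, then $R(N,K,\mathcal L^0)\le R(1,1,\bar{\mathcal L})/\sqrt{NK}$ with $\bar{\mathcal L}=\mathbb E\big[m(X^0)-m^*+\frac{2\gamma_s}{\theta}\tilde G^0+\frac{4\gamma_s\beta}{\theta}\tilde P^0+\frac1{6L}P^0\big]$, which does not depend on $K$ and $\eta$. Finally, if $m(X^0)>m^*$, then for all sufficiently large $K$ there is $\eta\in(0,1)$ satisfying the displayed equation. -/

import Mathlib

open MeasureTheory ProbabilityTheory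

noncomputable section

namespace EFLanding

/-! Matrices with the Frobenius inner product. -/

/-- Real `n × p` matrices, as a Euclidean space: the norm is the Frobenius norm and the inner
product is `⟪X, Y⟫ = tr (Xᵀ Y)`. -/
abbrev Mat (n p : ℕ) : Type := EuclideanSpace ℝ (Fin n × Fin p)

/-- The matrix with the entries of `X`. -/
def toMatrix {n p : ℕ} (X : Mat n p) : Matrix (Fin n) (Fin p) ℝ := Matrix.of fun i j => X (i, j)

/-- The element of the Euclidean space with the entries of the matrix `A`. -/
def ofMatrix {n p : ℕ} (A : Matrix (Fin n) (Fin p) ℝ) : Mat n p :=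
  WithLp.toLp 2 fun ij : Fin n × Fin p => A ij.1 ij.2

/-- Symmetric part of a square matrix. -/
def symPart {n : ℕ} (M : Matrix (Fin n) (Fin n) ℝ) : Matrix (Fin n) (Fin n) ℝ :=
  (1 / 2 : ℝ) • (M + M.transpose)

/-- Skew-symmetric part of a square matrix. -/
def skewPart {n : ℕ} (M : Matrix (Fin n) (Fin n) ℝ) : Matrix (Fin n) (Fin n) ℝ :=
  (1 / 2 : ℝ) • (M - M.transpose)

/-! The Stiefel constraint and the landing direction. -/

/-- `Xᵀ X - I`. -/
def defect {n p : ℕ} (X : Mat n p) : Mat p p :=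
  ofMatrix ((toMatrix X).transpose * toMatrix X - 1)

/-- The safe region `‖Xᵀ X - I‖_F ≤ ε` around the Stiefel manifold. -/
def safeRegion (n p : ℕ) (ε : ℝ) : Set (Mat n p) := {X | ‖defect X‖ ≤ ε}

/-- The penalty `𝒩(X) = ‖Xᵀ X - I‖_F² / 4`. -/
def penalty {n p : ℕ} (X : Mat n p) : ℝ := (1 / 4) * ‖defect X‖ ^ 2

/-- `∇𝒩(X) = X (Xᵀ X - I)`. -/
def penaltyGrad {n p : ℕ} (X : Mat n p) : Mat n p :=
  ofMatrix (toMatrix X * ((toMatrix X).transpose * toMatrix X - 1))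

/-- `skew(g Xᵀ) X`; for `g = ∇f(X)` this is `grad f(X)`. -/
def skewGrad {n p : ℕ} (g X : Mat n p) : Mat n p :=
  ofMatrix (skewPart (toMatrix g * (toMatrix X).transpose) * toMatrix X)

/-- `grad f(X) = skew(∇f(X) Xᵀ) X`. -/
def riemGrad {n p : ℕ} (f : Mat n p → ℝ) (X : Mat n p) : Mat n p := skewGrad (gradient f X) X

/-- The landing direction `skew(g Xᵀ) X + λ X (Xᵀ X - I)`. -/
def landingDir {n p : ℕ} (lam : ℝ) (X g : Mat n p) : Mat n p :=
  skewGrad g X + lam • penaltyGrad X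

/-- Clipping at level `B`: `min {1, B / ‖g‖} g`. -/
def clip {n p : ℕ} (B : ℝ) (g : Mat n p) : Mat n p := min 1 (B / ‖g‖) • g

/-! The merit function. -/

/-- `h(X) = ⟪sym(Xᵀ ∇f(X)), Xᵀ X - I⟫ / 2`. -/
def meritCorrection {n p : ℕ} (f : Mat n p → ℝ) (X : Mat n p) : ℝ :=
  (1 / 2) *
    inner ℝ (ofMatrix (symPart ((toMatrix X).transpose * toMatrix (gradient f X)))) (defect X)

/-- `m(X) = f(X) - h(X) + μ 𝒩(X)`. -/
def merit {n p : ℕ} (f : Mat n p → ℝ) (mu : ℝ) (X : Mat n p) : ℝ :=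
  f X - meritCorrection f X + mu * penalty X

/-- `m*`, the infimum of the merit function over the safe region. -/
def meritInf {n p : ℕ} (f : Mat n p → ℝ) (mu ε : ℝ) : ℝ := sInf (merit f mu '' safeRegion n p ε)

/-! The distributed stochastic problem. -/

/-- A sample loss `F(X; ξ)` and the local data distributions of the `N` nodes. -/
structure Problem (N n p : ℕ) (Ξ : Type*) [MeasurableSpace Ξ] where
  /-- the sample loss -/
  F : Mat n p → Ξ → ℝ
  /-- the local distributions -/
  D : Fin N → Measure Ξ

section Problem

variable {N n p : ℕ} {Ξ : Type*} [MeasurableSpace Ξ]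

/-- The local objective `f_i(X) = 𝔼_{ξ ∼ D_i} F(X; ξ)`. -/
def Problem.local (pb : Problem N n p Ξ) (i : Fin N) (X : Mat n p) : ℝ := ∫ z, pb.F X z ∂pb.D i

/-- The objective `f = (1/N) ∑ f_i`. -/
def Problem.obj (pb : Problem N n p Ξ) (X : Mat n p) : ℝ := (1 / (N : ℝ)) * ∑ i, pb.local i X

/-- The stochastic gradient `∇F(X; ξ)` (with respect to `X`). -/
def Problem.sgrad (pb : Problem N n p Ξ) (X : Mat n p) (z : Ξ) : Mat n p :=
  gradient (fun Y => pb.F Y z) X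

/-- The problem makes sense: the `D_i` are probability measures, the expectations defining the
`f_i` exist, `F(·; ξ)` is differentiable on the safe region for almost every sample, and the
stochastic gradient is measurable. -/
structure Problem.WellPosed (pb : Problem N n p Ξ) (ε : ℝ) : Prop where
  prob : ∀ i, IsProbabilityMeasure (pb.D i)
  integrable : ∀ i X, Integrable (pb.F X) (pb.D i)
  differentiable : ∀ i, ∀ X ∈ safeRegion n p ε, ∀ᵐ z ∂pb.D i,
    DifferentiableAt ℝ (fun Y => pb.F Y z) X
  measurable : Measurable fun q : Mat n p × Ξ => pb.sgrad q.1 q.2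

/-- Global gradient bound on the safe region. -/
def Problem.GradientBound (pb : Problem N n p Ξ) (ε B : ℝ) : Prop :=
  ∀ i, ∀ X ∈ safeRegion n p ε, ∀ᵐ z ∂pb.D i, ‖pb.sgrad X z‖ ≤ B

/-- Lipschitz smoothness: every `f_i` is differentiable and `∇f_i` is `L_i`-Lipschitz on the safe
region. -/
def Problem.Smooth (pb : Problem N n p Ξ) (ε : ℝ) (Lnode : Fin N → ℝ) : Prop :=
  ∀ i, Differentiable ℝ (pb.local i) ∧
    ∀ X ∈ safeRegion n p ε, ∀ Y ∈ safeRegion n p ε,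
      ‖gradient (pb.local i) X - gradient (pb.local i) Y‖ ≤ Lnode i * ‖X - Y‖

/-- The objective is bounded below on the safe region. -/
def Problem.LowerBounded (pb : Problem N n p Ξ) (ε : ℝ) : Prop :=
  BddBelow (pb.obj '' safeRegion n p ε)

/-- Unbiased stochastic gradients with variance at most `σ²`. -/
def Problem.BoundedVariance (pb : Problem N n p Ξ) (ε σ : ℝ) : Prop :=
  ∀ i, ∀ X ∈ safeRegion n p ε,
    ∫ z, (pb.sgrad X z - gradient (pb.local i) X) ∂pb.D i = 0 ∧
    ∫⁻ z, ‖pb.sgrad X z - gradient (pb.local i) X‖ₑ ^ 2 ∂pb.D i ≤ ENNReal.ofReal (σ ^ 2)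

end Problem

/-- `∇φ` is `M`-Lipschitz on the set `s` (and `φ` is differentiable at every point of `s`). -/
def SmoothOn {n p : ℕ} (φ : Mat n p → ℝ) (M : ℝ) (s : Set (Mat n p)) : Prop :=
  (∀ X ∈ s, DifferentiableAt ℝ φ X) ∧
    ∀ X ∈ s, ∀ Y ∈ s, ‖gradient φ X - gradient φ Y‖ ≤ M * ‖X - Y‖

/-! Compressors and the sampling model. -/

/-- The random map `C`, with random seed of law `ν`, is a contractive compressor:
`𝔼 ‖C(X) - X‖² ≤ (1 - α) ‖X‖²` for every `X`. -/
structure Contractive {n p : ℕ} {S : Type*} [MeasurableSpace S] (C : S → Mat n p → Mat n p)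
    (ν : Measure S) (α : ℝ) : Prop where
  measurable : Measurable fun q : S × Mat n p => C q.1 q.2
  contract : ∀ X, ∫⁻ s, ‖C s X - X‖ₑ ^ 2 ∂ν ≤ ENNReal.ofReal ((1 - α) * ‖X‖ ^ 2)

/-- The randomness of the algorithm. `ξ k ω i` is the sample drawn by node `i` in round `k` and
`ζ k ω i` is the seed of the compressor of node `i` in round `k`. In each round the samples of
the nodes are independent, with the local distributions, and independent of everything drawn in
the earlier rounds; the seed of each compressor has law `ν` and is independent of everything drawn
in the earlier rounds and of the samples of the current round. -/
structure SamplingModel {N : ℕ} {Ξ S Ω : Type*} [MeasurableSpace Ξ] [MeasurableSpace S]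
    [MeasurableSpace Ω] (P : Measure Ω) (D : Fin N → Measure Ξ) (ν : Measure S)
    (ξ : ℕ → Ω → Fin N → Ξ) (ζ : ℕ → Ω → Fin N → S) : Prop where
  measurable_sample : ∀ k, Measurable (ξ k)
  measurable_seed : ∀ k, Measurable (ζ k)
  law_sample : ∀ k, P.map (ξ k) = Measure.pi D
  law_seed : ∀ k i, P.map (fun ω => ζ k ω i) = ν
  indep_sample : ∀ k, IndepFun (ξ k) (fun ω (l : Fin k) => (ξ l ω, ζ l ω)) P
  indep_seed : ∀ k i,
    IndepFun (fun ω => ζ k ω i) (fun ω => ((fun l : Fin k => (ξ l ω, ζ l ω)), ξ k ω)) P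

/-! The EF-Landing algorithm. -/

/-- State: the iterate, the momenta and compressed gradients of the nodes, and the compressed
gradient kept by the master. -/
structure State (N n p : ℕ) where
  /-- the iterate `X^k` -/
  X : Mat n p
  /-- the momenta `v_i^k` -/
  v : Fin N → Mat n p
  /-- the local compressed gradients `g_i^k` -/
  g : Fin N → Mat n p
  /-- the compressed gradient `g^k` of the master -/
  master : Mat n p

section Algorithm

variable {N n p : ℕ} {Ξ S : Type*}

/-- Initialization. -/
def init (G : Mat n p → Ξ → Mat n p) (C : S → Mat n p → Mat n p) (X₀ : Mat n p)
    (z : Fin N → Ξ) (s : Fin N → S) : State N n p where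
  X := X₀
  v := fun i => G X₀ (z i)
  g := fun i => C (s i) (G X₀ (z i))
  master := (1 / (N : ℝ)) • ∑ i, C (s i) (G X₀ (z i))

/-- The next iterate `X^{k+1} = X^k - γ Λ(X^k; clip g^k)`. -/
def State.nextX (st : State N n p) (B lam γ : ℝ) : Mat n p :=
  st.X - γ • landingDir lam st.X (clip B st.master)

/-- The next momentum `v_i^{k+1} = (1 - η) v_i^k + η ∇F(X^{k+1}; ξ_i^{k+1})`. -/
def State.nextV (st : State N n p) (G : Mat n p → Ξ → Mat n p) (B lam γ η : ℝ) (z : Fin N → Ξ)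
    (i : Fin N) : Mat n p :=
  (1 - η) • st.v i + η • G (st.nextX B lam γ) (z i)

/-- The message `c_i^k = C(v_i^{k+1} - g_i^k)`. -/
def State.message (st : State N n p) (G : Mat n p → Ξ → Mat n p) (C : S → Mat n p → Mat n p)
    (B lam γ η : ℝ) (z : Fin N → Ξ) (s : Fin N → S) (i : Fin N) : Mat n p :=
  C (s i) (st.nextV G B lam γ η z i - st.g i)

/-- One iteration. -/
def State.step (st : State N n p) (G : Mat n p → Ξ → Mat n p) (C : S → Mat n p → Mat n p)
    (B lam γ η : ℝ) (z : Fin N → Ξ) (s : Fin N → S) : State N n p where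
  X := st.nextX B lam γ
  v := st.nextV G B lam γ η z
  g := fun i => st.g i + st.message G C B lam γ η z s i
  master := st.master + (1 / (N : ℝ)) • ∑ i, st.message G C B lam γ η z s i

/-- The state after `k` iterations, with gradient oracle `G`, compressor `C`, clipping level `B`,
penalty parameter `lam`, step size `γ` and momentum `η`, for given samples `z` and seeds `s`. -/
def run (G : Mat n p → Ξ → Mat n p) (C : S → Mat n p → Mat n p) (B lam γ η : ℝ) (X₀ : Mat n p)
    (z : ℕ → Fin N → Ξ) (s : ℕ → Fin N → S) : ℕ → State N n p
  | 0 => init G C X₀ (z 0) (s 0)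
  | k + 1 => (run G C B lam γ η X₀ z s k).step G C B lam γ η (z (k + 1)) (s (k + 1))

end Algorithm

/-! Constants, step size, momentum and rate. -/

/-- The numerical constants of the problem and the algorithm. -/
structure Constants (N : ℕ) where
  /-- radius `ε` of the safe region -/
  eps : ℝ
  /-- penalty parameter `λ` -/
  lam : ℝ
  /-- weight `μ` of the penalty in the merit function -/
  mu : ℝ
  /-- contractive factor `α` of the compressor -/
  alpha : ℝ
  /-- standard deviation bound `σ` -/
  sigma : ℝ
  /-- smoothness constant `L` of the objective -/
  L : ℝ
  /-- gradient bound `L'` -/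
  Lgrad : ℝ
  /-- smoothness constant `L_m` of the merit function -/
  Lm : ℝ
  /-- smoothness constants `L_i` of the local objectives -/
  Lnode : Fin N → ℝ

namespace Constants

variable {N : ℕ} (c : Constants N)

/-- `L̃ = ((1/N) ∑ L_i²)^{1/2}`. -/
def Ltil : ℝ := Real.sqrt ((1 / (N : ℝ)) * ∑ i, c.Lnode i ^ 2)

/-- `θ = 1 - (1 - α)^{1/2}`. -/
def theta : ℝ := 1 - Real.sqrt (1 - c.alpha)

/-- `β = (1 - α) / (1 - (1 - α)^{1/2})`. -/
def beta : ℝ := (1 - c.alpha) / (1 - Real.sqrt (1 - c.alpha))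

/-- The lower bound required of `μ`. -/
def muLower : ℝ :=
  2 / (3 - 4 * c.eps) * (c.L * (1 - c.eps) + 3 * Real.sqrt (1 + c.eps) * c.Lgrad
    + 2 * (max c.L c.Lgrad) ^ 2 * (1 + c.eps) / c.lam)

/-- Ranges of the constants (stochastic case `σ > 0`, compressed case `α < 1`). -/
structure Valid : Prop where
  eps_pos : 0 < c.eps
  eps_lt : c.eps < 3 / 4
  lam_pos : 0 < c.lam
  mu_ge : c.muLower ≤ c.mu
  alpha_pos : 0 < c.alpha
  alpha_lt : c.alpha < 1
  sigma_pos : 0 < c.sigma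
  L_pos : 0 < c.L
  Lgrad_pos : 0 < c.Lgrad
  Lm_pos : 0 < c.Lm
  Ltil_pos : 0 < c.Ltil

/-- The quantity `ℓ` in the step size: `λ²`, except that it is `λ` if both `λ < 1/2` and
`μ < λ (1 + ε)`. -/
def ell : ℝ := if 1 / 2 ≤ c.lam ∨ c.lam * (1 + c.eps) ≤ c.mu then c.lam ^ 2 else c.lam

/-- The uniform safe step size `γ_s`. -/
def gammaSafe : ℝ :=
  min (c.lam * (1 - c.eps) * c.eps
      / ((1 + c.eps) ^ 2 * c.Lgrad ^ 2 + c.lam ^ 2 * (1 + c.eps) * c.eps ^ 2))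
    (min (Real.sqrt (c.eps / (2 * (1 + c.eps) ^ 2 * c.Lgrad ^ 2))) (1 / (2 * c.lam)))

/-- The step size for momentum `η`, with `c₁ = c₂ = 2`. -/
def stepSize (η : ℝ) : ℝ :=
  min c.gammaSafe <|
  min (1 / (6 * c.Ltil) * Real.sqrt (c.theta / (2 * 2 * c.beta))) <|
  min (η / (6 * c.L * Real.sqrt (2 * 2))) <|
  min (1 / (6 * c.Lm)) <|
  min (1 / (12 * c.Ltil) * Real.sqrt (c.mu * c.theta / (2 * c.ell * (1 + c.eps) * c.beta))) <|
  min (η / (12 * c.L) * Real.sqrt (c.mu / (2 * c.ell * (1 + c.eps))))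
    (c.mu / (12 * c.ell * (1 + c.eps) * c.Lm))

/-- `C₁^γ`. -/
def C1 : ℝ :=
  1 / c.gammaSafe + 6 * c.Lm + 12 * c.ell * (1 + c.eps) * c.Lm / c.mu
    + 12 * c.Ltil * Real.sqrt (c.beta / c.theta)
    + 12 * c.Ltil * Real.sqrt (2 * c.ell * (1 + c.eps) * c.beta / (c.mu * c.theta))

/-- `C₂^γ`. -/
def C2 : ℝ := 12 * c.L + 12 * c.L * Real.sqrt (2 * c.ell * (1 + c.eps) / c.mu)

/-- The value to which the momentum coefficient is set, for `K` iterations on `N` nodes and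
initial Lyapunov value `L₀`. -/
def momentum (K : ℕ) (L₀ : ℝ) : ℝ :=
  min ((c.C2 * N * L₀ / (2 * c.sigma ^ 2 * K)) ^ (1 / 2 : ℝ)) <|
  min ((c.theta * c.C2 * L₀ / (2 * (1 - c.alpha) * c.sigma ^ 2 * K)) ^ (1 / 3 : ℝ))
    ((c.theta * c.C2 * L₀ / (4 * c.beta * c.sigma ^ 2 * K)) ^ (1 / 4 : ℝ))

/-- The rate term, as a function of the number `M` of nodes, the number `K` of iterations and the
initial Lyapunov value `L₀`. -/
def rate (M K L₀ : ℝ) : ℝ :=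
  c.C1 * L₀ / K
    + 4 * (2 * c.sigma ^ 2 * c.C2 * L₀ / (M * K)) ^ (1 / 2 : ℝ)
    + 4 * (2 * c.sigma ^ 2 * (1 - c.alpha) / c.theta) ^ (1 / 3 : ℝ)
        * (c.C2 * L₀ / K) ^ (2 / 3 : ℝ)
    + 4 * (4 * c.beta * c.sigma ^ 2 / c.theta) ^ (1 / 4 : ℝ)
        * (c.C2 * L₀ / K) ^ (3 / 4 : ℝ)

end Constants

/-! The Lyapunov function. -/

section Lyapunov

variable {N n p : ℕ} {Ξ : Type*} [MeasurableSpace Ξ]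

/-- Averaged compression error `G̃ = (1/N) ∑ ‖g_i - v_i‖²`. -/
def State.compErr (st : State N n p) : ℝ := (1 / (N : ℝ)) * ∑ i, ‖st.g i - st.v i‖ ^ 2

/-- Averaged momentum error `P̃ = (1/N) ∑ ‖v_i - ∇f_i(X)‖²`. -/
def State.localMomErr (st : State N n p) (pb : Problem N n p Ξ) : ℝ :=
  (1 / (N : ℝ)) * ∑ i, ‖st.v i - gradient (pb.local i) st.X‖ ^ 2

/-- Momentum error of the average `P = ‖(1/N) ∑ v_i - ∇f(X)‖²`. -/
def State.momErr (st : State N n p) (pb : Problem N n p Ξ) : ℝ :=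
  ‖(1 / (N : ℝ)) • (∑ i, st.v i) - gradient pb.obj st.X‖ ^ 2

/-- `m(X) - m* + (c₁ γ / θ) G̃ + (2 c₁ γ η β / θ) P̃ + (c₂ γ / η) P` with `c₁ = c₂ = 2`. -/
def lyapunov (pb : Problem N n p Ξ) (c : Constants N) (γ η : ℝ) (st : State N n p) : ℝ :=
  merit pb.obj c.mu st.X - meritInf pb.obj c.mu c.eps
    + 2 * γ / c.theta * st.compErr
    + 2 * 2 * γ * η * c.beta / c.theta * st.localMomErr pb
    + 2 * γ / η * st.momErr pb

/-- A majorant of the Lyapunov function that involves neither the momentum coefficient nor the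
number of iterations: `m(X) - m* + (2 γ_s / θ) G̃ + (4 γ_s β / θ) P̃ + P / (6 L)`. -/
def lyapunovBound (pb : Problem N n p Ξ) (c : Constants N) (st : State N n p) : ℝ :=
  merit pb.obj c.mu st.X - meritInf pb.obj c.mu c.eps
    + 2 * c.gammaSafe / c.theta * st.compErr
    + 4 * c.gammaSafe * c.beta / c.theta * st.localMomErr pb
    + 1 / (6 * c.L) * st.momErr pb

end Lyapunov

end EFLanding

end

/-!
The clipped landing step moves `X` along `Λ = skew(g Xᵀ) X + λ X (Xᵀ X - I)`. To first order the
skew part does not change the Gram matrix `Xᵀ X`, and the second part contracts `Xᵀ X - I`; the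
second-order terms are dominated for step sizes up to `gammaSafe`, so no iterate (and no point of
the segment between two iterates) leaves the safe region: `sub_smul_landingDir_mem`. Since that
region is compact, the merit function and the gradients are bounded along the trajectory; the
momenta and compressed gradients are square integrable by induction (`memLp_v_g`).

The merit function `m` decreases along `Λ`. Its correction term is `⟪∇f, ∇𝒩⟫ / 2`, and `∇f` is
only Lipschitz, so the slope of `m` in the direction `Λ` is estimated on difference quotients
(`inner_gradient_merit_ge`). With the lower bound on `μ`, a scalar inequality
(`scalar_merit_bound`) turns this into `landing_slope`:
`‖grad f‖² / 4 + λ μ 𝒩 / 2 + κ ‖Λ‖² ≤ ⟪∇m, Λ⟫ + ‖g - ∇f‖²`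
for every weight `κ ≤ 1/8` with `8 (1 + ε) κ λ² ≤ λ μ`. The step size is such that
`κ = L_m γ / 2 + γ² driftWeight` is admissible. As the gradient of `m` is Lipschitz along the
segment, one iteration decreases `m` by the stationarity measure and by a multiple of
`‖X⁺ - X‖²`, up to the error of the gradient estimate (`merit_descent`). Clipping is a
projection onto a ball containing `∇f`, so it does not increase this error, which is split into a
compression error and a momentum error.

In mean square, fresh samples and fresh compressor seeds are independent of the past, so noise adds
its variance (`CentredNoise.step`) and compression contracts (`compress_step`). This yields
contracting recursions for the compression error, the nodewise momentum error and the averaged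
momentum error, driven by `‖X⁺ - X‖²` and by the variance (`compression_step`, `momentum_step`).
With the weights of the Lyapunov function the errors cancel, and the drift is absorbed by the decrease of
`m`, thanks to `η² + (1 - η)² ≤ 1` (`lyapunov_combination`). Telescoping bounds the averaged
stationarity by `ℒ⁰ / (γ K)` plus `noiseLevel`. Finally `1 / γ ≤ C₁ + C₂ / η`, and the minimum
defining `η` balances `C₂ ℒ⁰ / (K η)` against each of the three noise terms
(`le_rate_of_eq_momentum`). The momentum equation is solvable for large `K` by the intermediate
value theorem, since `ℒ⁰(η)` is continuous in `η` and lies between `m(X⁰) - m*` and `ℒ̄`.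
-/

noncomputable section

namespace EFLanding

/-! ### The Frobenius inner product -/

section Frobenius

variable {l m n p : ℕ}

@[simp] lemma ofMatrix_toMatrix (X : Mat n p) : ofMatrix (toMatrix X) = X := rfl

lemma ofMatrix_add (A B : Matrix (Fin n) (Fin p) ℝ) :
    ofMatrix (A + B) = ofMatrix A + ofMatrix B := rfl

lemma ofMatrix_sub (A B : Matrix (Fin n) (Fin p) ℝ) :
    ofMatrix (A - B) = ofMatrix A - ofMatrix B := rfl

lemma ofMatrix_neg (A : Matrix (Fin n) (Fin p) ℝ) : ofMatrix (-A) = -ofMatrix A := rfl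

lemma ofMatrix_smul (r : ℝ) (A : Matrix (Fin n) (Fin p) ℝ) :
    ofMatrix (r • A) = r • ofMatrix A := rfl

lemma toMatrix_sub (X Y : Mat n p) : toMatrix (X - Y) = toMatrix X - toMatrix Y := rfl

lemma toMatrix_smul (r : ℝ) (X : Mat n p) : toMatrix (r • X) = r • toMatrix X := rfl

lemma inner_ofMatrix (A B : Matrix (Fin n) (Fin p) ℝ) :
    inner ℝ (ofMatrix A) (ofMatrix B) = (A.transpose * B).trace := by
  simp only [PiLp.inner_apply, ofMatrix, Matrix.trace, Matrix.diag_apply, Matrix.mul_apply,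
    Matrix.transpose_apply, RCLike.inner_apply, conj_trivial]
  rw [Fintype.sum_prod_type, Finset.sum_comm]
  exact Finset.sum_congr rfl fun _ _ => Finset.sum_congr rfl fun _ _ => mul_comm _ _

lemma inner_ofMatrix_transpose (A B : Matrix (Fin n) (Fin p) ℝ) :
    inner ℝ (ofMatrix A.transpose) (ofMatrix B.transpose) = inner ℝ (ofMatrix A) (ofMatrix B) := by
  rw [inner_ofMatrix, inner_ofMatrix, ← Matrix.trace_transpose, Matrix.trace_mul_comm]
  simp [Matrix.transpose_mul]

lemma inner_ofMatrix_mul_left (A : Matrix (Fin l) (Fin m) ℝ) (B : Matrix (Fin m) (Fin n) ℝ)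
    (C : Matrix (Fin l) (Fin n) ℝ) :
    inner ℝ (ofMatrix (A * B)) (ofMatrix C)
      = inner ℝ (ofMatrix B) (ofMatrix (A.transpose * C)) := by
  rw [inner_ofMatrix, inner_ofMatrix, Matrix.transpose_mul, Matrix.mul_assoc]

lemma inner_ofMatrix_mul_right (A : Matrix (Fin l) (Fin m) ℝ) (B : Matrix (Fin m) (Fin n) ℝ)
    (C : Matrix (Fin l) (Fin n) ℝ) :
    inner ℝ (ofMatrix (A * B)) (ofMatrix C)
      = inner ℝ (ofMatrix A) (ofMatrix (C * B.transpose)) := by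
  rw [inner_ofMatrix, inner_ofMatrix, Matrix.transpose_mul, Matrix.mul_assoc,
    Matrix.trace_mul_comm, Matrix.mul_assoc]

lemma norm_ofMatrix_transpose (A : Matrix (Fin n) (Fin p) ℝ) :
    ‖ofMatrix A.transpose‖ = ‖ofMatrix A‖ := by
  have h := inner_ofMatrix_transpose A A
  rw [real_inner_self_eq_norm_sq, real_inner_self_eq_norm_sq] at h
  exact (sq_eq_sq₀ (norm_nonneg _) (norm_nonneg _)).1 h

section

attribute [local instance] Matrix.frobeniusNormedAddCommGroup

lemma norm_ofMatrix_eq_frobenius (A : Matrix (Fin n) (Fin p) ℝ) : ‖ofMatrix A‖ = ‖A‖ := by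
  rw [Matrix.frobenius_norm_def, EuclideanSpace.norm_eq, Real.sqrt_eq_rpow, Fintype.sum_prod_type]
  simp [ofMatrix]

/-- The Frobenius norm is submultiplicative. -/
lemma norm_ofMatrix_mul_le (A : Matrix (Fin l) (Fin m) ℝ) (B : Matrix (Fin m) (Fin n) ℝ) :
    ‖ofMatrix (A * B)‖ ≤ ‖ofMatrix A‖ * ‖ofMatrix B‖ := by
  simp only [norm_ofMatrix_eq_frobenius]
  exact Matrix.frobenius_norm_mul A B

end

lemma inner_skewPart (M : Matrix (Fin n) (Fin n) ℝ) {A : Matrix (Fin n) (Fin n) ℝ}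
    (hA : A.transpose = -A) :
    inner ℝ (ofMatrix (skewPart M)) (ofMatrix A) = inner ℝ (ofMatrix M) (ofMatrix A) := by
  have h := inner_ofMatrix_transpose M A
  rw [hA, ofMatrix_neg, inner_neg_right] at h
  rw [skewPart, ofMatrix_smul, ofMatrix_sub, inner_smul_left, inner_sub_left]
  simp only [conj_trivial]
  linarith

lemma skewPart_transpose (M : Matrix (Fin n) (Fin n) ℝ) :
    (skewPart M).transpose = -skewPart M := by
  rw [skewPart, Matrix.transpose_smul, Matrix.transpose_sub, Matrix.transpose_transpose,
    ← smul_neg, neg_sub]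

lemma skewPart_sub (M M' : Matrix (Fin n) (Fin n) ℝ) :
    skewPart (M - M') = skewPart M - skewPart M' := by
  simp only [skewPart, Matrix.transpose_sub, ← smul_sub]
  congr 1; abel

lemma norm_skewPart_le (M : Matrix (Fin n) (Fin n) ℝ) :
    ‖ofMatrix (skewPart M)‖ ≤ ‖ofMatrix M‖ := by
  rw [skewPart, ofMatrix_smul, ofMatrix_sub, norm_smul]
  have := norm_sub_le (ofMatrix M) (ofMatrix M.transpose)
  rw [norm_ofMatrix_transpose] at this
  norm_num
  linarith

lemma inner_symPart (M : Matrix (Fin n) (Fin n) ℝ) {D : Matrix (Fin n) (Fin n) ℝ}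
    (hD : D.transpose = D) :
    inner ℝ (ofMatrix (symPart M)) (ofMatrix D) = inner ℝ (ofMatrix M) (ofMatrix D) := by
  have h := inner_ofMatrix_transpose M D
  rw [hD] at h
  rw [symPart, ofMatrix_smul, ofMatrix_add, inner_smul_left, inner_add_left]
  simp only [conj_trivial]
  linarith

end Frobenius

/-! ### Matrices near the Stiefel manifold -/

section NearStiefel

variable {m n p : ℕ}

/-- The Gram defect `xᵀ x - 1` of a matrix. -/
def gramDefect (x : Matrix (Fin n) (Fin p) ℝ) : Matrix (Fin p) (Fin p) ℝ := x.transpose * x - 1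

lemma gramDefect_transpose (x : Matrix (Fin n) (Fin p) ℝ) :
    (gramDefect x).transpose = gramDefect x := by
  simp [gramDefect, Matrix.transpose_sub, Matrix.transpose_mul]

lemma transpose_mul_self_eq (x : Matrix (Fin n) (Fin p) ℝ) :
    x.transpose * x = 1 + gramDefect x := by
  rw [gramDefect]; abel

lemma defect_eq (X : Mat n p) : defect X = ofMatrix (gramDefect (toMatrix X)) := rfl

lemma penaltyGrad_eq (X : Mat n p) :
    penaltyGrad X = ofMatrix (toMatrix X * gramDefect (toMatrix X)) := rfl

/-- Multiplication by a matrix with small Gram defect almost preserves the norm. -/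
lemma norm_mul_sq_eq (x : Matrix (Fin n) (Fin p) ℝ) (M : Matrix (Fin p) (Fin m) ℝ) :
    ‖ofMatrix (x * M)‖ ^ 2
      = ‖ofMatrix M‖ ^ 2 + inner ℝ (ofMatrix M) (ofMatrix (gramDefect x * M)) := by
  rw [← real_inner_self_eq_norm_sq, ← real_inner_self_eq_norm_sq, inner_ofMatrix_mul_left,
    ← Matrix.mul_assoc, transpose_mul_self_eq, Matrix.add_mul, Matrix.one_mul, ofMatrix_add,
    inner_add_right]

lemma abs_inner_gramDefect_mul_le {x : Matrix (Fin n) (Fin p) ℝ} {ε : ℝ}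
    (hx : ‖ofMatrix (gramDefect x)‖ ≤ ε) (M : Matrix (Fin p) (Fin m) ℝ) :
    |inner ℝ (ofMatrix M) (ofMatrix (gramDefect x * M))| ≤ ε * ‖ofMatrix M‖ ^ 2 := by
  calc |inner ℝ (ofMatrix M) (ofMatrix (gramDefect x * M))|
      ≤ ‖ofMatrix M‖ * ‖ofMatrix (gramDefect x * M)‖ := abs_real_inner_le_norm _ _
    _ ≤ ‖ofMatrix M‖ * (‖ofMatrix (gramDefect x)‖ * ‖ofMatrix M‖) := by
        gcongr; exact norm_ofMatrix_mul_le _ _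
    _ ≤ ‖ofMatrix M‖ * (ε * ‖ofMatrix M‖) := by gcongr
    _ = ε * ‖ofMatrix M‖ ^ 2 := by ring

lemma norm_mul_sq_le {x : Matrix (Fin n) (Fin p) ℝ} {ε : ℝ}
    (hx : ‖ofMatrix (gramDefect x)‖ ≤ ε) (M : Matrix (Fin p) (Fin m) ℝ) :
    ‖ofMatrix (x * M)‖ ^ 2 ≤ (1 + ε) * ‖ofMatrix M‖ ^ 2 := by
  have := (abs_le.1 (abs_inner_gramDefect_mul_le hx M)).2
  rw [norm_mul_sq_eq]; linarith

lemma le_norm_mul_sq {x : Matrix (Fin n) (Fin p) ℝ} {ε : ℝ}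
    (hx : ‖ofMatrix (gramDefect x)‖ ≤ ε) (M : Matrix (Fin p) (Fin m) ℝ) :
    (1 - ε) * ‖ofMatrix M‖ ^ 2 ≤ ‖ofMatrix (x * M)‖ ^ 2 := by
  have := (abs_le.1 (abs_inner_gramDefect_mul_le hx M)).1
  rw [norm_mul_sq_eq]; linarith

lemma norm_mul_transpose_sq_le {x : Matrix (Fin n) (Fin p) ℝ} {ε : ℝ}
    (hx : ‖ofMatrix (gramDefect x)‖ ≤ ε) (M : Matrix (Fin m) (Fin p) ℝ) :
    ‖ofMatrix (M * x.transpose)‖ ^ 2 ≤ (1 + ε) * ‖ofMatrix M‖ ^ 2 := by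
  rw [← norm_ofMatrix_transpose, ← norm_ofMatrix_transpose M, Matrix.transpose_mul,
    Matrix.transpose_transpose]
  exact norm_mul_sq_le hx _

/-- Right multiplication by `x` is bounded by the norm of its adjoint, right multiplication by
`xᵀ`. -/
lemma norm_mul_right_sq_le {x : Matrix (Fin n) (Fin p) ℝ} {ε : ℝ}
    (hx : ‖ofMatrix (gramDefect x)‖ ≤ ε) (A : Matrix (Fin m) (Fin n) ℝ) :
    ‖ofMatrix (A * x)‖ ^ 2 ≤ (1 + ε) * ‖ofMatrix A‖ ^ 2 := by
  have hε : 0 ≤ ε := (norm_nonneg _).trans hx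
  have h1 : ‖ofMatrix (A * x)‖ ^ 2 ≤ ‖ofMatrix A‖ * ‖ofMatrix (A * x * x.transpose)‖ := by
    rw [← real_inner_self_eq_norm_sq, inner_ofMatrix_mul_right]
    exact real_inner_le_norm _ _
  have h2 := norm_mul_transpose_sq_le hx (A * x)
  rcases (norm_nonneg (ofMatrix (A * x))).eq_or_lt with h0 | h0
  · rw [← h0, zero_pow two_ne_zero]; positivity
  have h3 : (‖ofMatrix (A * x)‖ ^ 2) ^ 2
      ≤ ‖ofMatrix A‖ ^ 2 * ((1 + ε) * ‖ofMatrix (A * x)‖ ^ 2) := by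
    calc (‖ofMatrix (A * x)‖ ^ 2) ^ 2
        ≤ (‖ofMatrix A‖ * ‖ofMatrix (A * x * x.transpose)‖) ^ 2 := by gcongr
      _ = ‖ofMatrix A‖ ^ 2 * ‖ofMatrix (A * x * x.transpose)‖ ^ 2 := by ring
      _ ≤ _ := by gcongr
  have h4 : 0 < ‖ofMatrix (A * x)‖ ^ 2 := by positivity
  refine le_of_mul_le_mul_right ?_ h4
  nlinarith

end NearStiefel

section LandingDirection

variable {n p : ℕ} {ε lam : ℝ}

lemma mem_safeRegion_iff {X : Mat n p} :
    X ∈ safeRegion n p ε ↔ ‖ofMatrix (gramDefect (toMatrix X))‖ ≤ ε := Iff.rfl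

lemma norm_skewGrad_le {X : Mat n p} (hX : X ∈ safeRegion n p ε) (g : Mat n p) :
    ‖skewGrad g X‖ ^ 2 ≤ (1 + ε) ^ 2 * ‖g‖ ^ 2 := by
  rw [mem_safeRegion_iff] at hX
  have hε : 0 ≤ ε := (norm_nonneg _).trans hX
  calc ‖skewGrad g X‖ ^ 2
      ≤ (1 + ε) * ‖ofMatrix (skewPart (toMatrix g * (toMatrix X).transpose))‖ ^ 2 :=
        norm_mul_right_sq_le hX _
    _ ≤ (1 + ε) * ‖ofMatrix (toMatrix g * (toMatrix X).transpose)‖ ^ 2 := by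
        gcongr; exact norm_skewPart_le _
    _ ≤ (1 + ε) * ((1 + ε) * ‖ofMatrix (toMatrix g)‖ ^ 2) := by
        gcongr; exact norm_mul_transpose_sq_le hX _
    _ = _ := by rw [ofMatrix_toMatrix]; ring

lemma inner_skew_mul_mul_sym {A : Matrix (Fin n) (Fin n) ℝ} (hA : A.transpose = -A)
    (x : Matrix (Fin n) (Fin p) ℝ) {D : Matrix (Fin p) (Fin p) ℝ} (hD : D.transpose = D) :
    inner ℝ (ofMatrix (A * x)) (ofMatrix (x * D)) = 0 := by
  have h1 : inner ℝ (ofMatrix (A * x)) (ofMatrix (x * D))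
      = inner ℝ (ofMatrix A) (ofMatrix (x * D * x.transpose)) := inner_ofMatrix_mul_right _ _ _
  have h2 := inner_ofMatrix_transpose A (x * D * x.transpose)
  rw [hA, Matrix.transpose_mul, Matrix.transpose_mul, hD, Matrix.transpose_transpose,
    ← Matrix.mul_assoc, ofMatrix_neg, inner_neg_left] at h2
  rw [h1]; linarith

/-- The two parts of the landing direction are orthogonal. -/
lemma norm_landingDir_sq (X g : Mat n p) :
    ‖landingDir lam X g‖ ^ 2 = ‖skewGrad g X‖ ^ 2 + lam ^ 2 * ‖penaltyGrad X‖ ^ 2 := by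
  have h : inner ℝ (skewGrad g X) (penaltyGrad X) = 0 :=
    inner_skew_mul_mul_sym (skewPart_transpose _) _ (gramDefect_transpose _)
  rw [landingDir, norm_add_sq_real, inner_smul_right, h, norm_smul, mul_pow, Real.norm_eq_abs,
    sq_abs]
  ring

/-- The Gram matrix is stationary along `A x` with `A` skew, so only the penalty part of the
landing direction changes it to first order. -/
lemma gram_derivative {A : Matrix (Fin n) (Fin n) ℝ} (hA : A.transpose = -A)
    (x : Matrix (Fin n) (Fin p) ℝ) :
    (A * x + lam • (x * gramDefect x)).transpose * x
      + x.transpose * (A * x + lam • (x * gramDefect x))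
      = (2 * lam) • (gramDefect x + gramDefect x * gramDefect x) := by
  have e : x.transpose * (x * gramDefect x) = gramDefect x + gramDefect x * gramDefect x := by
    rw [← Matrix.mul_assoc, transpose_mul_self_eq, Matrix.add_mul, Matrix.one_mul]
  have e' : gramDefect x * x.transpose * x = gramDefect x + gramDefect x * gramDefect x := by
    rw [Matrix.mul_assoc, transpose_mul_self_eq, Matrix.mul_add, Matrix.mul_one]
  rw [Matrix.transpose_add, Matrix.transpose_mul, hA, Matrix.transpose_smul,
    Matrix.transpose_mul, gramDefect_transpose, Matrix.add_mul, Matrix.mul_add, Matrix.smul_mul,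
    Matrix.mul_smul, e, e', Matrix.mul_neg, Matrix.neg_mul, Matrix.mul_assoc, two_mul, add_smul]
  abel

lemma gramDefect_sub_smul (x v : Matrix (Fin n) (Fin p) ℝ) (t : ℝ) :
    gramDefect (x - t • v)
      = gramDefect x - t • (v.transpose * x + x.transpose * v) + t ^ 2 • (v.transpose * v) := by
  simp only [gramDefect, Matrix.transpose_sub, Matrix.transpose_smul, Matrix.sub_mul,
    Matrix.mul_sub, Matrix.smul_mul, Matrix.mul_smul, smul_add, smul_sub, pow_two, mul_smul]
  abel

/-- A landing step with a short step size stays in the safe region. -/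
lemma sub_smul_landingDir_mem {B γ : ℝ} (hε1 : ε < 1) (hlam : 0 < lam)
    {X g : Mat n p} (hX : X ∈ safeRegion n p ε) (hg : ‖g‖ ≤ B) (hγ0 : 0 ≤ γ)
    (hγ1 : γ * ((1 + ε) ^ 2 * B ^ 2 + lam ^ 2 * (1 + ε) * ε ^ 2) ≤ lam * (1 - ε) * ε)
    (hγ2 : γ * lam ≤ 1 / 2) :
    X - γ • landingDir lam X g ∈ safeRegion n p ε := by
  have hX' := hX
  rw [mem_safeRegion_iff] at hX ⊢
  have hε : 0 ≤ ε := (norm_nonneg _).trans hX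
  set x := toMatrix X with hx
  set D := gramDefect x with hD
  set V := landingDir lam X g with hV
  have hVm : toMatrix V = skewPart (toMatrix g * x.transpose) * x + lam • (x * D) := rfl
  have key : gramDefect (toMatrix (X - γ • V))
      = (1 - 2 * (γ * lam)) • D - (2 * (γ * lam)) • (D * D)
        + γ ^ 2 • ((toMatrix V).transpose * toMatrix V) := by
    rw [toMatrix_sub, toMatrix_smul, gramDefect_sub_smul, ← hx, hVm,
      gram_derivative (skewPart_transpose _), ← hD, sub_smul, smul_smul, smul_add, one_smul]
    have : γ * (2 * lam) = 2 * (γ * lam) := by ring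
    rw [this]; abel
  have hVn : ‖V‖ ^ 2 ≤ (1 + ε) ^ 2 * B ^ 2 + lam ^ 2 * (1 + ε) * ε ^ 2 := by
    rw [hV, norm_landingDir_sq]
    have h1 := norm_skewGrad_le hX' g
    have h2 : ‖penaltyGrad X‖ ^ 2 ≤ (1 + ε) * ‖ofMatrix D‖ ^ 2 := norm_mul_sq_le hX _
    have h3 : (1 + ε) ^ 2 * ‖g‖ ^ 2 ≤ (1 + ε) ^ 2 * B ^ 2 := by gcongr
    have h4 : (1 + ε) * ‖ofMatrix D‖ ^ 2 ≤ (1 + ε) * ε ^ 2 := by gcongr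
    have h5 := mul_le_mul_of_nonneg_left (h2.trans h4) (sq_nonneg lam)
    linarith
  have hs0 : 0 ≤ γ * lam := by positivity
  have hVV : ‖ofMatrix ((toMatrix V).transpose * toMatrix V)‖ ≤ ‖V‖ ^ 2 := by
    refine (norm_ofMatrix_mul_le _ _).trans ?_
    rw [norm_ofMatrix_transpose, ofMatrix_toMatrix, sq]
  have hDD : ‖ofMatrix (D * D)‖ ≤ ε * ε := by
    refine (norm_ofMatrix_mul_le _ _).trans ?_
    gcongr
  rw [key, ofMatrix_add, ofMatrix_sub, ofMatrix_smul, ofMatrix_smul, ofMatrix_smul]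
  calc _ ≤ ‖(1 - 2 * (γ * lam)) • ofMatrix D‖ + ‖(2 * (γ * lam)) • ofMatrix (D * D)‖
        + ‖γ ^ 2 • ofMatrix ((toMatrix V).transpose * toMatrix V)‖ :=
        (norm_add_le _ _).trans (add_le_add_left (norm_sub_le _ _) _)
    _ = (1 - 2 * (γ * lam)) * ‖ofMatrix D‖ + (2 * (γ * lam)) * ‖ofMatrix (D * D)‖
        + γ ^ 2 * ‖ofMatrix ((toMatrix V).transpose * toMatrix V)‖ := by
        rw [norm_smul, norm_smul, norm_smul, Real.norm_of_nonneg (by linarith),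
          Real.norm_of_nonneg (by positivity), Real.norm_of_nonneg (by positivity)]
    _ ≤ (1 - 2 * (γ * lam)) * ε + (2 * (γ * lam)) * (ε * ε)
        + γ ^ 2 * ((1 + ε) ^ 2 * B ^ 2 + lam ^ 2 * (1 + ε) * ε ^ 2) := by
        have : 0 ≤ 1 - 2 * (γ * lam) := by linarith
        gcongr
        exact hVV.trans hVn
    _ ≤ ε := by
        have h := mul_le_mul_of_nonneg_left hγ1 hγ0
        have h' : 0 ≤ γ * (lam * (1 - ε) * ε) :=
          mul_nonneg hγ0 (mul_nonneg (mul_nonneg hlam.le (by linarith)) hε)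
        nlinarith

end LandingDirection

/-! ### The merit function -/

section Merit

variable {n p : ℕ} {ε lam : ℝ}

/-- The correction term of the merit function is `⟪∇f(X), ∇𝒩(X)⟫ / 2`. -/
lemma meritCorrection_eq (f : Mat n p → ℝ) (X : Mat n p) :
    meritCorrection f X = 1 / 2 * inner ℝ (gradient f X) (penaltyGrad X) := by
  rw [meritCorrection, defect_eq, inner_symPart _ (gramDefect_transpose _),
    inner_ofMatrix_mul_left, Matrix.transpose_transpose, ofMatrix_toMatrix, penaltyGrad_eq]

/-- The derivative at `0` of `∇𝒩` along the line `t ↦ X - t V`. -/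
lemma hasDerivAt_penaltyGrad_line (X V : Mat n p) :
    HasDerivAt (fun t : ℝ => penaltyGrad (X - t • V))
      (-ofMatrix (toMatrix V * gramDefect (toMatrix X) + toMatrix X
        * ((toMatrix V).transpose * toMatrix X + (toMatrix X).transpose * toMatrix V))) 0 := by
  set x := toMatrix X with hx
  set v := toMatrix V with hv
  set E := v.transpose * x + x.transpose * v with hE
  have h : (fun t : ℝ => penaltyGrad (X - t • V)) = fun t : ℝ =>
      ofMatrix (x * gramDefect x) - t • ofMatrix (v * gramDefect x + x * E)
        + t ^ 2 • ofMatrix (v * E + x * (v.transpose * v))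
        - t ^ 3 • ofMatrix (v * (v.transpose * v)) := by
    funext t
    rw [penaltyGrad_eq, toMatrix_sub, toMatrix_smul, gramDefect_sub_smul, ← hx, ← hv, ← hE]
    simp only [← ofMatrix_smul, ← ofMatrix_sub, ← ofMatrix_add]
    congr 1
    simp only [Matrix.mul_add, Matrix.mul_sub, Matrix.sub_mul, Matrix.smul_mul, Matrix.mul_smul,
      smul_add, smul_sub, pow_succ, pow_zero, one_mul, mul_smul]
    abel
  rw [h]
  have h1 := (hasDerivAt_id (0 : ℝ)).smul_const (ofMatrix (v * gramDefect x + x * E))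
  have h2 := (hasDerivAt_pow 2 (0 : ℝ)).smul_const (ofMatrix (v * E + x * (v.transpose * v)))
  have h3 := (hasDerivAt_pow 3 (0 : ℝ)).smul_const (ofMatrix (v * (v.transpose * v)))
  refine HasDerivAt.congr_deriv
    (((h1.const_sub (ofMatrix (x * gramDefect x))).add h2).sub h3) ?_
  simp

lemma hasDerivAt_penalty_line (X V : Mat n p) :
    HasDerivAt (fun t : ℝ => penalty (X - t • V))
      (-(1 / 2 * inner ℝ (ofMatrix (gramDefect (toMatrix X)))
        (ofMatrix ((toMatrix V).transpose * toMatrix X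
          + (toMatrix X).transpose * toMatrix V)))) 0 := by
  set x := toMatrix X with hx
  set v := toMatrix V with hv
  set E := v.transpose * x + x.transpose * v with hE
  have h : (fun t : ℝ => penalty (X - t • V)) = fun t : ℝ =>
      1 / 4 * ‖ofMatrix (gramDefect x) - t • ofMatrix E
        + t ^ 2 • ofMatrix (v.transpose * v)‖ ^ 2 := by
    funext t
    rw [penalty, defect_eq, toMatrix_sub, toMatrix_smul, gramDefect_sub_smul, ← hx, ← hv, ← hE,
      ofMatrix_add, ofMatrix_sub, ofMatrix_smul, ofMatrix_smul]
  rw [h]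
  have h1 := (hasDerivAt_id (0 : ℝ)).smul_const (ofMatrix E)
  have h2 := (hasDerivAt_pow 2 (0 : ℝ)).smul_const (ofMatrix (v.transpose * v))
  have h3 := (((h1.const_sub (ofMatrix (gramDefect x))).add h2).norm_sq).const_mul (1 / 4 : ℝ)
  refine HasDerivAt.congr_deriv h3 ?_
  simp
  ring

lemma hasDerivAt_line {φ : Mat n p → ℝ} {X V : Mat n p} {t : ℝ}
    (h : DifferentiableAt ℝ φ (X - t • V)) :
    HasDerivAt (fun s : ℝ => φ (X - s • V)) (-inner ℝ (gradient φ (X - t • V)) V) t := by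
  have h1 : HasDerivAt (fun s : ℝ => X - s • V) (-((1 : ℝ) • V)) t :=
    ((hasDerivAt_id t).smul_const V).const_sub X
  have h2 := h.hasGradientAt.hasFDerivAt.comp_hasDerivAt t h1
  refine HasDerivAt.congr_deriv h2 ?_
  simp

/-- Lower bound for the derivative of the merit function in a direction `V` along which the set
`s` can be left only after a positive time. The gradient of `f` is merely Lipschitz, so the
variation of `∇f` in the correction term is estimated on difference quotients. -/
lemma inner_gradient_merit_ge {f : Mat n p → ℝ} {mu L : ℝ} {s : Set (Mat n p)} {X V : Mat n p}
    (hf : SmoothOn f L s) (hm : DifferentiableAt ℝ (merit f mu) X) {t₀ : ℝ} (ht₀ : 0 < t₀)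
    (hs : ∀ t, 0 ≤ t → t ≤ t₀ → X - t • V ∈ s) :
    inner ℝ (gradient f X) V
      - 1 / 2 * inner ℝ (gradient f X)
        (ofMatrix (toMatrix V * gramDefect (toMatrix X) + toMatrix X
        * ((toMatrix V).transpose * toMatrix X + (toMatrix X).transpose * toMatrix V)))
      + mu * (1 / 2 * inner ℝ (ofMatrix (gramDefect (toMatrix X)))
        (ofMatrix ((toMatrix V).transpose * toMatrix X
          + (toMatrix X).transpose * toMatrix V)))
      - 1 / 2 * L * ‖V‖ * ‖penaltyGrad X‖ ≤ inner ℝ (gradient (merit f mu) X) V := by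
  have hXs : X ∈ s := by simpa using hs 0 le_rfl ht₀.le
  set W := ofMatrix (toMatrix V * gramDefect (toMatrix X) + toMatrix X
        * ((toMatrix V).transpose * toMatrix X + (toMatrix X).transpose * toMatrix V)) with hW
  set T := (1 / 2 : ℝ) * inner ℝ (ofMatrix (gramDefect (toMatrix X)))
        (ofMatrix ((toMatrix V).transpose * toMatrix X
          + (toMatrix X).transpose * toMatrix V)) with hT
  set Φ : ℝ → ℝ := fun t => merit f mu (X - t • V) - f (X - t • V)
    + 1 / 2 * inner ℝ (gradient f X) (penaltyGrad (X - t • V)) - mu * penalty (X - t • V) with hΦ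
  have hX0 : X - (0 : ℝ) • V = X := by simp
  have hpg := hasDerivAt_penaltyGrad_line X V
  have hd : HasDerivAt Φ (-inner ℝ (gradient (merit f mu) X) V + inner ℝ (gradient f X) V
      - 1 / 2 * inner ℝ (gradient f X) W + mu * T) 0 := by
    have h1 : HasDerivAt (fun t : ℝ => merit f mu (X - t • V)) _ 0 :=
      hasDerivAt_line (by rw [hX0]; exact hm)
    have h2 : HasDerivAt (fun t : ℝ => f (X - t • V)) _ 0 :=
      hasDerivAt_line (by rw [hX0]; exact hf.1 X hXs)
    have h3 := ((hasDerivAt_const (0 : ℝ) (gradient f X)).inner ℝ hpg).const_mul (1 / 2 : ℝ)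
    have h4 := (hasDerivAt_penalty_line X V).const_mul mu
    rw [hX0] at h1 h2
    refine HasDerivAt.congr_deriv (((h1.sub h2).add h3).sub h4) ?_
    rw [← hW, ← hT, inner_neg_right, inner_zero_left]
    ring
  have hΦ0 : ∀ t, Φ t
      = -(1 / 2 * inner ℝ (gradient f (X - t • V) - gradient f X) (penaltyGrad (X - t • V))) := by
    intro t
    simp only [hΦ, merit, meritCorrection_eq, inner_sub_left]
    ring
  have hle : ∀ t, 0 < t → t ≤ t₀ →
      slope Φ 0 t ≤ 1 / 2 * L * ‖V‖ * ‖penaltyGrad (X - t • V)‖ := by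
    intro t ht0 ht
    have h0 : Φ 0 = 0 := by rw [hΦ0, hX0]; simp
    rw [slope_def_field, h0, sub_zero, sub_zero, div_le_iff₀ ht0, hΦ0]
    have h1 := hf.2 _ (hs t ht0.le ht) _ hXs
    have h2 : ‖X - t • V - X‖ = t * ‖V‖ := by
      rw [show X - t • V - X = -(t • V) by abel, norm_neg, norm_smul, Real.norm_of_nonneg ht0.le]
    rw [h2] at h1
    have h3 := (abs_le.1 (abs_real_inner_le_norm (gradient f (X - t • V) - gradient f X)
      (penaltyGrad (X - t • V)))).1
    have h4 := mul_le_mul_of_nonneg_right h1 (norm_nonneg (penaltyGrad (X - t • V)))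
    linarith
  have hlim1 : Filter.Tendsto (slope Φ 0) (nhdsWithin 0 (Set.Ioi 0)) (nhds _) :=
    (hasDerivAt_iff_tendsto_slope.1 hd).mono_left
      (nhdsWithin_mono _ fun t (ht : 0 < t) => ne_of_gt ht)
  have hlim2 : Filter.Tendsto (fun t : ℝ => 1 / 2 * L * ‖V‖ * ‖penaltyGrad (X - t • V)‖)
      (nhdsWithin 0 (Set.Ioi 0)) (nhds (1 / 2 * L * ‖V‖ * ‖penaltyGrad X‖)) := by
    have h := (hpg.continuousAt.norm.const_mul (1 / 2 * L * ‖V‖)).tendsto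
    simp only [hX0] at h
    exact h.mono_left nhdsWithin_le_nhds
  have := le_of_tendsto_of_tendsto hlim1 hlim2 (by
    filter_upwards [Ioc_mem_nhdsGT ht₀] with t ht
    exact hle t ht.1 ht.2)
  linarith

/-- Descent along a segment contained in the set where the gradient is Lipschitz. -/
lemma SmoothOn.le_of_segment {φ : Mat n p → ℝ} {M : ℝ} {s : Set (Mat n p)} (h : SmoothOn φ M s)
    {X V : Mat n p} {γ : ℝ} (hγ : 0 ≤ γ) (hs : ∀ t, 0 ≤ t → t ≤ γ → X - t • V ∈ s) :
    φ (X - γ • V) ≤ φ X - γ * inner ℝ (gradient φ X) V + M * γ ^ 2 / 2 * ‖V‖ ^ 2 := by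
  have hXs : X ∈ s := by simpa using hs 0 le_rfl hγ
  set ψ : ℝ → ℝ := fun t => φ (X - t • V) + t * inner ℝ (gradient φ X) V
    - M * t ^ 2 / 2 * ‖V‖ ^ 2 with hψ
  have hd : ∀ t, 0 ≤ t → t ≤ γ → HasDerivAt ψ (-inner ℝ (gradient φ (X - t • V)) V
      + inner ℝ (gradient φ X) V - M * t * ‖V‖ ^ 2) t := by
    intro t ht0 ht
    have h1 := hasDerivAt_line (h.1 _ (hs t ht0 ht))
    have h2 := (hasDerivAt_id t).mul_const (inner ℝ (gradient φ X) V)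
    have h3 := (((hasDerivAt_pow 2 t).const_mul M).div_const 2).mul_const (‖V‖ ^ 2)
    refine HasDerivAt.congr_deriv ((h1.add h2).sub h3) ?_
    push_cast
    ring
  have hanti : AntitoneOn ψ (Set.Icc 0 γ) := by
    refine antitoneOn_of_deriv_nonpos (convex_Icc _ _)
      (fun t ht => (hd t ht.1 ht.2).continuousAt.continuousWithinAt) ?_ ?_
    · intro t ht
      rw [interior_Icc] at ht
      exact (hd t ht.1.le ht.2.le).differentiableAt.differentiableWithinAt
    · intro t ht
      rw [interior_Icc] at ht
      rw [(hd t ht.1.le ht.2.le).deriv]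
      have h1 := h.2 _ (hs t ht.1.le ht.2.le) _ hXs
      have h2 : ‖X - t • V - X‖ = t * ‖V‖ := by
        rw [show X - t • V - X = -(t • V) by abel, norm_neg, norm_smul,
          Real.norm_of_nonneg ht.1.le]
      rw [h2] at h1
      have h3 := (abs_le.1 (abs_real_inner_le_norm (gradient φ (X - t • V) - gradient φ X) V)).1
      have h4 := mul_le_mul_of_nonneg_right h1 (norm_nonneg V)
      rw [inner_sub_left] at h3
      nlinarith
  have h1 := hanti (Set.left_mem_Icc.2 hγ) (Set.right_mem_Icc.2 hγ) hγ
  simp only [hψ, zero_smul, sub_zero, zero_mul, add_zero, ne_eq, OfNat.ofNat_ne_zero,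
    not_false_eq_true, zero_pow, mul_zero, zero_div] at h1
  linarith

lemma continuous_defect : Continuous fun X : Mat n p => defect X := by
  unfold defect ofMatrix toMatrix
  refine (PiLp.continuous_toLp 2 _).comp (continuous_pi fun ij => ?_)
  simp only [Matrix.sub_apply, Matrix.mul_apply, Matrix.transpose_apply, Matrix.of_apply]
  fun_prop

lemma isCompact_safeRegion : IsCompact (safeRegion n p ε) := by
  refine Metric.isCompact_of_isClosed_isBounded
    (isClosed_le continuous_defect.norm continuous_const) ?_
  refine (Metric.isBounded_iff_subset_closedBall (0 : Mat n p)).2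
    ⟨Real.sqrt ((1 + ε) * ‖ofMatrix (1 : Matrix (Fin p) (Fin p) ℝ)‖ ^ 2), fun X hX => ?_⟩
  rw [mem_closedBall_zero_iff]
  refine Real.le_sqrt_of_sq_le ?_
  have := norm_mul_sq_le (mem_safeRegion_iff.1 hX) (1 : Matrix (Fin p) (Fin p) ℝ)
  rwa [Matrix.mul_one, ofMatrix_toMatrix] at this

lemma SmoothOn.continuousOn {φ : Mat n p → ℝ} {M : ℝ} {s : Set (Mat n p)} (h : SmoothOn φ M s) :
    ContinuousOn φ s := fun X hX => (h.1 X hX).continuousAt.continuousWithinAt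

lemma meritInf_le {f : Mat n p → ℝ} {mu Lm : ℝ}
    (h : SmoothOn (merit f mu) Lm (safeRegion n p ε)) {X : Mat n p}
    (hX : X ∈ safeRegion n p ε) : meritInf f mu ε ≤ merit f mu X :=
  csInf_le (isCompact_safeRegion.bddBelow_image h.continuousOn) ⟨X, hX, rfl⟩

end Merit

/-! ### The merit function along the landing direction -/

section LandingMerit

variable {n p : ℕ} {ε lam : ℝ}

/-- Young's inequality for the cross term between the skew part and the penalty part. -/
lemma young_cross (M a d : ℝ) {r : ℝ} (hε : 0 < ε) (hε' : ε < 3 / 4) (hr : r ^ 2 = 1 + ε) :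
    M * r * (a * d) ≤ (3 - ε) / (8 * (1 + ε)) * a ^ 2
      + M ^ 2 * ((1 + ε) + ε / (3 - 4 * ε)) * d ^ 2 := by
  have h1ε : 0 < 1 + ε := by linarith
  have hδ : 0 < 3 - 4 * ε := by linarith
  have hs : 0 < (3 - ε) / (8 * (1 + ε)) := div_pos (by linarith) (by linarith)
  have hprod : 1 + ε ≤ 4 * ((3 - ε) / (8 * (1 + ε))) * ((1 + ε) + ε / (3 - 4 * ε)) := by
    have e : 4 * ((3 - ε) / (8 * (1 + ε))) * ((1 + ε) + ε / (3 - 4 * ε))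
        = ((3 - ε) * ((1 + ε) * (3 - 4 * ε) + ε)) / (2 * (1 + ε) * (3 - 4 * ε)) := by
      field_simp; ring
    rw [e, le_div_iff₀ (by positivity)]
    -- the difference of the two sides is a cubic that is at least `1/2` for `ε ≥ 0`
    have h1 : (3 - ε) * ((1 + ε) * (3 - 4 * ε) + ε) - (1 + ε) * (2 * (1 + ε) * (3 - 4 * ε))
        = (2 * ε - 1) ^ 2 * (3 * ε + 5 / 2) + 1 / 2 := by ring
    have h2 : 0 ≤ (2 * ε - 1) ^ 2 * (3 * ε + 5 / 2) := by positivity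
    linarith
  generalize (3 - ε) / (8 * (1 + ε)) = s at hs hprod ⊢
  generalize (1 + ε) + ε / (3 - 4 * ε) = q at hprod ⊢
  have h1 : (M * r * d) ^ 2 ≤ 4 * s * q * (M * d) ^ 2 := by
    have : (M * r * d) ^ 2 = (1 + ε) * (M * d) ^ 2 := by rw [← hr]; ring
    rw [this]
    exact mul_le_mul_of_nonneg_right hprod (sq_nonneg _)
  refine le_of_mul_le_mul_left ?_ (by linarith : 0 < 4 * s)
  have h2 := sq_nonneg (2 * s * a - M * r * d)
  linarith [h1, h2]

/-- Scalar core of the lower bound for `⟪∇m, Λ⟫`, with `a = ‖A X‖`, `nA = ‖A‖`, `b = ‖B X‖`,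
`nB = ‖B‖`, `d = ‖Xᵀ X - I‖`, `w = ‖X (Xᵀ X - I)‖`, `r = √(1 + ε)` for the skew parts `A` and `B`
of the clipped direction and of the gradient. The quantity `w²` has to be kept both in `λ μ w²` and
in `κ λ² w²`: estimating the two separately (by `(1 - ε) d²` from below and `(1 + ε) d²` from
above) loses too much when `ε` is close to `3/4`. -/
lemma scalar_merit_bound {L B M mu κ a nA b nB d w r : ℝ} (hε : 0 < ε) (hε' : ε < 3 / 4)
    (hlam : 0 < lam) (hL : 0 ≤ L) (hB : 0 ≤ B) (hLM : L ≤ M) (hBM : B ≤ M)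
    (hr0 : 0 ≤ r) (hr : r ^ 2 = 1 + ε)
    (hmu : L * (1 - ε) + 3 * r * B + 2 * M ^ 2 * (1 + ε) / lam ≤ mu * ((3 - 4 * ε) / 2))
    (hκ1 : κ ≤ 1 / 8) (hκ2 : 8 * (1 + ε) * (κ * lam ^ 2) ≤ lam * mu)
    (ha : 0 ≤ a) (hd : 0 ≤ d) (hw : 0 ≤ w)
    (hA : a ^ 2 ≤ (1 + ε) * nA ^ 2) (hBX : b ^ 2 ≤ (1 + ε) * nB ^ 2)
    (hw1 : (1 - ε) * d ^ 2 ≤ w ^ 2) (hw2 : w ≤ r * d) :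
    1 / 4 * b ^ 2 + lam * mu / 8 * d ^ 2 + κ * (a ^ 2 + lam ^ 2 * w ^ 2)
      ≤ 1 / 2 * nA ^ 2 + 1 / 2 * nB ^ 2 - 3 / 2 * lam * (B * (r * d ^ 2)) - 1 / 2 * (B * (a * d))
        - 1 / 2 * L * (a + lam * w) * w + mu * lam * w ^ 2 := by
  have hM : 0 ≤ M := hL.trans hLM
  have hr1 : 1 ≤ r := by nlinarith
  have h1ε : 0 < 1 + ε := by linarith
  have hδ : 0 < 3 - 4 * ε := by linarith
  -- the hypothesis on `μ`, multiplied by `λ / 2`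
  have hmu' : 1 / 2 * lam * L * (1 - ε) + 3 / 2 * lam * r * B + M ^ 2 * (1 + ε)
      ≤ lam * mu * ((3 - 4 * ε) / 4) := by
    have h := mul_le_mul_of_nonneg_left hmu (by positivity : 0 ≤ lam / 2)
    have e : lam / 2 * (L * (1 - ε) + 3 * r * B + 2 * M ^ 2 * (1 + ε) / lam)
        = 1 / 2 * lam * L * (1 - ε) + 3 / 2 * lam * r * B + M ^ 2 * (1 + ε) := by
      field_simp
    rw [e] at h; linarith
  have hlm : 0 ≤ lam * mu := by
    have h0 : 0 ≤ lam * mu * ((3 - 4 * ε) / 4) := by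
      refine le_trans ?_ hmu'
      have : 0 ≤ 1 - ε := by linarith
      positivity
    exact nonneg_of_mul_nonneg_left h0 (by linarith)
  have hmuM : M ^ 2 * (1 + ε) * 4 / (3 - 4 * ε) ≤ lam * mu := by
    rw [div_le_iff₀ hδ]
    have h1 : 0 ≤ 1 / 2 * lam * L * (1 - ε) := by
      have : 0 ≤ 1 - ε := by linarith
      positivity
    have h2 : 0 ≤ 3 / 2 * lam * r * B := by positivity
    linarith
  -- the coefficient of `w²` is nonnegative
  have hcoef : 0 ≤ lam * mu - 1 / 2 * L * lam - lam * mu / (8 * (1 + ε)) := by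
    have h1 : lam * mu / (8 * (1 + ε)) ≤ lam * mu / 8 :=
      div_le_div_of_nonneg_left hlm (by norm_num) (by linarith)
    have h2 : 1 / 2 * lam * L * (1 - ε) ≤ lam * mu * (3 / 4 * (1 - ε)) := by
      have h3 : 0 ≤ 3 / 2 * lam * r * B := by positivity
      have h4 : 0 ≤ M ^ 2 * (1 + ε) := by positivity
      have h5 : lam * mu * ((3 - 4 * ε) / 4) ≤ lam * mu * (3 / 4 * (1 - ε)) := by
        gcongr; linarith
      linarith
    have h3 : 1 / 2 * lam * L ≤ lam * mu * (3 / 4) := by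
      refine le_of_mul_le_mul_right ?_ (by linarith : 0 < 1 - ε)
      linarith
    linarith
  have hκw : κ * lam ^ 2 * w ^ 2 ≤ lam * mu / (8 * (1 + ε)) * w ^ 2 := by
    refine mul_le_mul_of_nonneg_right ?_ (sq_nonneg w)
    rw [le_div_iff₀ (by positivity)]; linarith
  have hw3 := mul_le_mul_of_nonneg_left hw1 hcoef
  -- the cross terms
  have hcross : 1 / 2 * (B * (a * d)) + 1 / 2 * L * a * w ≤ M * r * (a * d) := by
    have had : 0 ≤ a * d := mul_nonneg ha hd
    have h1 : B * (a * d) ≤ M * (a * d) := mul_le_mul_of_nonneg_right hBM had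
    have h2 : L * a * w ≤ M * a * (r * d) := by gcongr
    have h3 : M * (a * d) * 1 ≤ M * (a * d) * r := mul_le_mul_of_nonneg_left hr1 (by positivity)
    linarith
  have hyoung := young_cross M a d hε hε' hr
  have hA' : 1 / 2 * (a ^ 2 / (1 + ε)) ≤ 1 / 2 * nA ^ 2 := by
    have : a ^ 2 / (1 + ε) ≤ nA ^ 2 := by rw [div_le_iff₀ h1ε]; linarith
    linarith
  have hB' : 1 / 4 * b ^ 2 ≤ 1 / 2 * nB ^ 2 := by
    have h1 : (1 + ε) * nB ^ 2 ≤ 2 * nB ^ 2 := by gcongr; linarith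
    linarith
  have hAκ : κ * a ^ 2 + (3 - ε) / (8 * (1 + ε)) * a ^ 2 ≤ 1 / 2 * (a ^ 2 / (1 + ε)) := by
    have h1 : κ * a ^ 2 ≤ 1 / 8 * a ^ 2 := mul_le_mul_of_nonneg_right hκ1 (sq_nonneg a)
    have e : 1 / 8 * a ^ 2 + (3 - ε) / (8 * (1 + ε)) * a ^ 2 = 1 / 2 * (a ^ 2 / (1 + ε)) := by
      field_simp; ring
    linarith
  have hd2 : 0 ≤ d ^ 2 := sq_nonneg d
  have hDfin : lam * mu / 8 + M ^ 2 * ((1 + ε) + ε / (3 - 4 * ε))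
      ≤ (lam * mu - 1 / 2 * L * lam - lam * mu / (8 * (1 + ε))) * (1 - ε)
        - 3 / 2 * lam * (B * r) := by
    have e1 : lam * mu / (8 * (1 + ε)) * (1 - ε)
        = lam * mu / 8 - lam * mu * ε / (4 * (1 + ε)) := by
      field_simp; ring
    have e2 : M ^ 2 * (ε / (3 - 4 * ε)) ≤ lam * mu * ε / (4 * (1 + ε)) := by
      have h := mul_le_mul_of_nonneg_right hmuM (by positivity : 0 ≤ ε / (4 * (1 + ε)))
      have e3 : M ^ 2 * (1 + ε) * 4 / (3 - 4 * ε) * (ε / (4 * (1 + ε)))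
          = M ^ 2 * (ε / (3 - 4 * ε)) := by
        field_simp
      rw [e3] at h
      rwa [mul_div_assoc]
    linarith
  have hDd := mul_le_mul_of_nonneg_right hDfin hd2
  linarith

/-- Lower bound for the slope of the merit function along the landing direction with an inexact
gradient `g`. -/
lemma landing_slope {f : Mat n p → ℝ} {mu L B κ γ₀ : ℝ} (hε : 0 < ε) (hε' : ε < 3 / 4)
    (hlam : 0 < lam) (hL : 0 ≤ L) (hB : 0 ≤ B)
    (hf : SmoothOn f L (safeRegion n p ε))
    {X : Mat n p} (hX : X ∈ safeRegion n p ε) (hm : DifferentiableAt ℝ (merit f mu) X)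
    (hfB : ‖gradient f X‖ ≤ B)
    (hmu : L * (1 - ε) + 3 * Real.sqrt (1 + ε) * B + 2 * (max L B) ^ 2 * (1 + ε) / lam
      ≤ mu * ((3 - 4 * ε) / 2))
    (hκ1 : κ ≤ 1 / 8) (hκ2 : 8 * (1 + ε) * (κ * lam ^ 2) ≤ lam * mu) (g : Mat n p)
    (hγ₀ : 0 < γ₀) (hs : ∀ t, 0 ≤ t → t ≤ γ₀ → X - t • landingDir lam X g ∈ safeRegion n p ε) :
    1 / 4 * ‖riemGrad f X‖ ^ 2 + lam * mu / 2 * penalty X + κ * ‖landingDir lam X g‖ ^ 2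
      ≤ inner ℝ (gradient (merit f mu) X) (landingDir lam X g) + ‖g - gradient f X‖ ^ 2 := by
  have hX' := mem_safeRegion_iff.1 hX
  set G := gradient f X with hG
  have hslope := inner_gradient_merit_ge hf hm hγ₀ hs
  rw [← hG] at hslope
  set x := toMatrix X with hx
  set D := gramDefect x with hD
  set V := landingDir lam X g with hV
  set A := skewPart (toMatrix g * x.transpose) with hA
  set Bs := skewPart (toMatrix G * x.transpose) with hBs
  have hDT : D.transpose = D := gramDefect_transpose x
  have hAT : A.transpose = -A := skewPart_transpose _
  have hVm : toMatrix V = A * x + lam • (x * D) := rfl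
  have hVV : V = ofMatrix (A * x) + lam • ofMatrix (x * D) := rfl
  have hrg : riemGrad f X = ofMatrix (Bs * x) := rfl
  have hpg : penaltyGrad X = ofMatrix (x * D) := rfl
  have hskew : skewGrad g X = ofMatrix (A * x) := rfl
  have hpen : penalty X = 1 / 4 * ‖ofMatrix D‖ ^ 2 := rfl
  rw [hVm, gram_derivative hAT, ← hD] at hslope
  -- the pairing of `∇f` with the direction
  have i1 : inner ℝ G V
      = inner ℝ (ofMatrix Bs) (ofMatrix A) + lam * inner ℝ G (ofMatrix (x * D)) := by
    rw [hVV, inner_add_right, inner_smul_right]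
    congr 1
    rw [hBs, inner_skewPart _ hAT, inner_ofMatrix_mul_right, Matrix.transpose_transpose,
      ofMatrix_toMatrix]
  have i2 : ofMatrix ((A * x + lam • (x * D)) * D + x * ((2 * lam) • (D + D * D)))
      = ofMatrix (A * x * D) + (2 * lam) • ofMatrix (x * D)
        + (3 * lam) • ofMatrix (x * (D * D)) := by
    simp only [← ofMatrix_smul, ← ofMatrix_add]
    congr 1
    rw [Matrix.add_mul, Matrix.smul_mul, Matrix.mul_smul, Matrix.mul_add, Matrix.mul_assoc x D D,
      smul_add, show (3 * lam) = lam + 2 * lam by ring, add_smul lam]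
    abel
  have i3 : inner ℝ (ofMatrix D) (ofMatrix ((2 * lam) • (D + D * D)))
      = 2 * lam * ‖ofMatrix (x * D)‖ ^ 2 := by
    rw [ofMatrix_smul, inner_smul_right, ← real_inner_self_eq_norm_sq, inner_ofMatrix_mul_left,
      ← Matrix.mul_assoc, transpose_mul_self_eq, Matrix.add_mul, Matrix.one_mul]
  rw [i1, i2, i3, inner_add_right, inner_add_right, inner_smul_right, inner_smul_right] at hslope
  -- polarization in the skew parts
  have hAB : ‖ofMatrix Bs - ofMatrix A‖ ^ 2 ≤ (1 + ε) * ‖g - G‖ ^ 2 := by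
    rw [← ofMatrix_sub, hBs, hA, ← skewPart_sub, ← Matrix.sub_mul, norm_sub_rev g G]
    refine le_trans ?_ (norm_mul_transpose_sq_le hX' (toMatrix G - toMatrix g))
    exact pow_le_pow_left₀ (norm_nonneg _) (norm_skewPart_le _) 2
  have hpol : 1 / 2 * ‖ofMatrix A‖ ^ 2 + 1 / 2 * ‖ofMatrix Bs‖ ^ 2
      ≤ inner ℝ (ofMatrix Bs) (ofMatrix A) + ‖g - G‖ ^ 2 := by
    rw [norm_sub_sq_real] at hAB
    have h1 : (1 + ε) * ‖g - G‖ ^ 2 ≤ 2 * ‖g - G‖ ^ 2 := by gcongr; linarith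
    linarith
  -- the error terms
  have hr : Real.sqrt (1 + ε) ^ 2 = 1 + ε := Real.sq_sqrt (by linarith)
  have hr0 := Real.sqrt_nonneg (1 + ε)
  set r := Real.sqrt (1 + ε) with hrdef
  have hxM : ∀ M : Matrix (Fin p) (Fin p) ℝ, ‖ofMatrix (x * M)‖ ≤ r * ‖ofMatrix M‖ := by
    intro M
    refine le_of_sq_le_sq ?_ (by positivity)
    rw [mul_pow, hr]
    exact norm_mul_sq_le hX' M
  have e1 : inner ℝ G (ofMatrix (x * (D * D))) ≤ B * (r * ‖ofMatrix D‖ ^ 2) := by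
    refine (real_inner_le_norm _ _).trans ?_
    refine mul_le_mul hfB ((hxM _).trans ?_) (norm_nonneg _) hB
    rw [sq]
    gcongr
    exact norm_ofMatrix_mul_le _ _
  have e2 : inner ℝ G (ofMatrix (A * x * D)) ≤ B * (‖ofMatrix (A * x)‖ * ‖ofMatrix D‖) :=
    (real_inner_le_norm _ _).trans
      (mul_le_mul hfB (norm_ofMatrix_mul_le _ _) (norm_nonneg _) hB)
  have e3 : ‖V‖ ≤ ‖ofMatrix (A * x)‖ + lam * ‖ofMatrix (x * D)‖ := by
    rw [hVV]
    refine (norm_add_le _ _).trans ?_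
    rw [norm_smul, Real.norm_of_nonneg hlam.le]
  have e4 : 1 / 2 * L * ‖V‖ * ‖penaltyGrad X‖ ≤ 1 / 2 * L * (‖ofMatrix (A * x)‖
      + lam * ‖ofMatrix (x * D)‖) * ‖ofMatrix (x * D)‖ := by
    rw [hpg]; gcongr
  have hcore := scalar_merit_bound (κ := κ) hε hε' hlam hL hB (le_max_left L B) (le_max_right L B)
    hr0 hr hmu hκ1 hκ2 (norm_nonneg (ofMatrix (A * x))) (norm_nonneg (ofMatrix D))
    (norm_nonneg (ofMatrix (x * D))) (norm_mul_right_sq_le hX' A) (norm_mul_right_sq_le hX' Bs)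
    (le_norm_mul_sq hX' D) (hxM D)
  rw [hrg, hpen, hV, norm_landingDir_sq, hskew, hpg, ← hV]
  have e1' := mul_le_mul_of_nonneg_left e1 hlam.le
  linarith

end LandingMerit

/-! ### Mean-square estimates with fresh randomness -/

section MeanSquare

variable {Ω : Type*} [MeasurableSpace Ω] {P : Measure Ω}

/-- A bound between lower Lebesgue integrals of nonnegative functions yields integrability. -/
lemma integrable_and_integral_le {f g : Ω → ℝ} (hf : AEStronglyMeasurable f P) (hf0 : ∀ ω, 0 ≤ f ω)
    (hg : Integrable g P) (hg0 : ∀ ω, 0 ≤ g ω)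
    (h : ∫⁻ ω, ENNReal.ofReal (f ω) ∂P ≤ ∫⁻ ω, ENNReal.ofReal (g ω) ∂P) :
    Integrable f P ∧ ∫ ω, f ω ∂P ≤ ∫ ω, g ω ∂P := by
  rw [← ofReal_integral_eq_lintegral_ofReal hg (ae_of_all _ hg0)] at h
  have hfi : Integrable f P := by
    refine ⟨hf, ?_⟩
    rw [hasFiniteIntegral_iff_ofReal (ae_of_all _ hf0)]
    exact h.trans_lt ENNReal.ofReal_lt_top
  refine ⟨hfi, ?_⟩
  rw [← ofReal_integral_eq_lintegral_ofReal hfi (ae_of_all _ hf0)] at h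
  exact (ENNReal.ofReal_le_ofReal_iff (integral_nonneg hg0)).1 h

/-- Integrating out a variable that is independent of the rest. -/
lemma lintegral_comp_of_indepFun [IsProbabilityMeasure P] {α β : Type*} [MeasurableSpace α]
    [MeasurableSpace β] {U : Ω → α} {W : Ω → β} (hU : Measurable U) (hW : Measurable W)
    (h : IndepFun W U P) {Φ : α × β → ENNReal} (hΦ : Measurable Φ) :
    ∫⁻ ω, Φ (U ω, W ω) ∂P = ∫⁻ ω, ∫⁻ b, Φ (U ω, b) ∂(P.map W) ∂P := by
  have : IsProbabilityMeasure (P.map W) := Measure.isProbabilityMeasure_map hW.aemeasurable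
  have hmap := (indepFun_iff_map_prod_eq_prod_map_map hU.aemeasurable hW.aemeasurable).1 h.symm
  rw [← lintegral_map hΦ (hU.prodMk hW), hmap, lintegral_prod _ hΦ.aemeasurable,
    lintegral_map hΦ.lintegral_prod_right' hU]

section Normed

variable {E : Type*} [NormedAddCommGroup E]

lemma sq_ofReal_norm (x : E) : ENNReal.ofReal (‖x‖ ^ 2) = ‖x‖ₑ ^ 2 := by
  rw [ENNReal.ofReal_pow (norm_nonneg _), ofReal_norm]

lemma integrable_norm_sq {f : Ω → E} (hf : MemLp f 2 P) : Integrable (fun ω => ‖f ω‖ ^ 2) P :=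
  (memLp_two_iff_integrable_sq_norm hf.1).1 hf

lemma memLp_two_of_lintegral_le [IsProbabilityMeasure P] {h : Ω → E}
    (hm : AEStronglyMeasurable h P) {τ : ℝ} (hτ : 0 ≤ τ)
    (hle : ∫⁻ ω, ‖h ω‖ₑ ^ 2 ∂P ≤ ENNReal.ofReal τ) :
    MemLp h 2 P ∧ ∫ ω, ‖h ω‖ ^ 2 ∂P ≤ τ := by
  have := integrable_and_integral_le (f := fun ω => ‖h ω‖ ^ 2) (g := fun _ => τ) (P := P)
    (hm.norm.pow 2) (fun _ => by positivity) (integrable_const _) (fun _ => hτ)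
    (by simpa [sq_ofReal_norm] using hle)
  exact ⟨(memLp_two_iff_integrable_sq_norm hm).2 this.1, by simpa using this.2⟩

end Normed

variable {E : Type*} [NormedAddCommGroup E] [InnerProductSpace ℝ E]

/-- Weighted Young inequality in the form used for contracting recursions. -/
lemma sq_mul_norm_add_sq_le (a b : E) {ρ : ℝ} (h0 : 0 ≤ ρ) (h1 : ρ < 1) :
    ρ ^ 2 * ‖a + b‖ ^ 2 ≤ ρ * ‖a‖ ^ 2 + ρ ^ 2 / (1 - ρ) * ‖b‖ ^ 2 := by
  have h2 : 0 < 1 - ρ := by linarith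
  have key : ρ * ‖a‖ ^ 2 + ρ ^ 2 / (1 - ρ) * ‖b‖ ^ 2 - ρ ^ 2 * ‖a + b‖ ^ 2
      = ρ / (1 - ρ) * ‖(1 - ρ) • a - ρ • b‖ ^ 2 := by
    rw [norm_add_sq_real, norm_sub_sq_real, norm_smul, norm_smul, inner_smul_left,
      inner_smul_right, Real.norm_of_nonneg h0, Real.norm_of_nonneg h2.le]
    simp only [conj_trivial]
    field_simp
    ring
  have : 0 ≤ ρ / (1 - ρ) * ‖(1 - ρ) • a - ρ • b‖ ^ 2 := by positivity
  linarith

lemma norm_add_sq_le_two (a b : E) : ‖a + b‖ ^ 2 ≤ 2 * ‖a‖ ^ 2 + 2 * ‖b‖ ^ 2 := by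
  have := parallelogram_law_with_norm ℝ a b
  nlinarith [sq_nonneg ‖a - b‖]

variable [CompleteSpace E]

/-- Adding centred noise to a fixed vector increases the mean square by the mean square of the
noise. -/
lemma lintegral_add_noise [IsProbabilityMeasure P] {h : Ω → E} (hh : MemLp h 2 P)
    (h0 : ∫ ω, h ω ∂P = 0) {τ : ℝ} (hτ : ∫ ω, ‖h ω‖ ^ 2 ∂P ≤ τ) (a : E) (η : ℝ) :
    ∫⁻ ω, ENNReal.ofReal (‖a + η • h ω‖ ^ 2) ∂P ≤ ENNReal.ofReal (‖a‖ ^ 2 + η ^ 2 * τ) := by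
  have hi : Integrable h P := hh.integrable (by norm_num)
  have hsq : Integrable (fun ω => ‖h ω‖ ^ 2) P := integrable_norm_sq hh
  have hin : Integrable (fun ω => inner ℝ a (h ω)) P := hi.const_inner a
  have hexp : ∀ ω, ‖a + η • h ω‖ ^ 2
      = ‖a‖ ^ 2 + 2 * η * inner ℝ a (h ω) + η ^ 2 * ‖h ω‖ ^ 2 := by
    intro ω
    rw [norm_add_sq_real, inner_smul_right, norm_smul, mul_pow, Real.norm_eq_abs, sq_abs]
    ring
  have hI : Integrable (fun ω => ‖a‖ ^ 2 + 2 * η * inner ℝ a (h ω)) P :=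
    (integrable_const _).add (hin.const_mul _)
  rw [← ofReal_integral_eq_lintegral_ofReal _ (ae_of_all _ fun ω => by positivity)]
  · refine ENNReal.ofReal_le_ofReal ?_
    simp only [hexp]
    rw [integral_add hI (hsq.const_mul _), integral_add (integrable_const _) (hin.const_mul _),
      integral_const_mul, integral_const_mul, integral_inner hi, h0, inner_zero_right]
    simp only [integral_const, probReal_univ, one_smul, mul_zero, add_zero]
    have := mul_le_mul_of_nonneg_left hτ (sq_nonneg η)
    linarith
  · simp only [hexp]
    exact hI.add (hsq.const_mul _)

/-- Averages of independent centred noises: the variance is divided by the number of terms. -/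
lemma integral_norm_sq_average_le {N : ℕ} (hN : 0 < N) {Ξ : Type*} [MeasurableSpace Ξ]
    [MeasurableSpace E] [BorelSpace E] [SecondCountableTopology E]
    {D : Fin N → Measure Ξ} [∀ i, IsProbabilityMeasure (D i)] {h : Fin N → Ξ → E} {τ : ℝ}
    (hh : ∀ i, MemLp (h i) 2 (D i)) (h0 : ∀ i, ∫ z, h i z ∂D i = 0)
    (hτ : ∀ i, ∫ z, ‖h i z‖ ^ 2 ∂D i ≤ τ) :
    MemLp (fun z : Fin N → Ξ => (1 / (N : ℝ)) • ∑ i, h i (z i)) 2 (Measure.pi D) ∧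
      ∫ z, (1 / (N : ℝ)) • ∑ i, h i (z i) ∂Measure.pi D = 0 ∧
      ∫ z, ‖(1 / (N : ℝ)) • ∑ i, h i (z i)‖ ^ 2 ∂Measure.pi D ≤ τ / N := by
  have hev : ∀ i, (Measure.pi D).map (fun z : Fin N → Ξ => z i) = D i := fun i =>
    (measurePreserving_eval D i).map_eq
  have hL : ∀ i, MemLp (fun z : Fin N → Ξ => h i (z i)) 2 (Measure.pi D) := fun i =>
    (hh i).comp_measurePreserving (measurePreserving_eval D i)
  have hint : ∀ i, Integrable (fun z : Fin N → Ξ => h i (z i)) (Measure.pi D) := fun i =>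
    (hL i).integrable (by norm_num)
  have hzero : ∀ i, ∫ z : Fin N → Ξ, h i (z i) ∂Measure.pi D = 0 := by
    intro i
    rw [← integral_map (φ := fun z : Fin N → Ξ => z i) (measurable_pi_apply i).aemeasurable, hev,
      h0]
    rw [hev]; exact (hh i).1
  have hsq : ∀ i, ∫ z : Fin N → Ξ, ‖h i (z i)‖ ^ 2 ∂Measure.pi D ≤ τ := by
    intro i
    rw [← integral_map (φ := fun z : Fin N → Ξ => z i) (f := fun y => ‖h i y‖ ^ 2)
      (measurable_pi_apply i).aemeasurable, hev]
    · exact hτ i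
    · rw [hev]; exact (hh i).1.norm.pow 2
  -- distinct coordinates of the product are independent, so the cross terms vanish
  have hcross : ∀ i j, i ≠ j →
      ∫ z : Fin N → Ξ, inner ℝ (h i (z i)) (h j (z j)) ∂Measure.pi D = 0 := by
    intro i j hij
    have hind : IndepFun (fun z : Fin N → Ξ => h i (z i)) (fun z => h j (z j)) (Measure.pi D) :=
      (iIndepFun_pi fun i => (hh i).1.aemeasurable).indepFun hij
    have := hind.integral_bilin (hint i) (hint j) (innerSL ℝ)
    rw [hzero i, map_zero] at this
    exact this
  have hinner : ∀ i j, Integrable (fun z : Fin N → Ξ => inner ℝ (h i (z i)) (h j (z j)))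
      (Measure.pi D) := by
    intro i j
    refine Integrable.mono' ((integrable_norm_sq (hL i)).add (integrable_norm_sq (hL j)))
      ((hL i).1.inner (hL j).1) (ae_of_all _ fun z => ?_)
    rw [Real.norm_eq_abs]
    refine (abs_real_inner_le_norm _ _).trans ?_
    simp only [Pi.add_apply]
    nlinarith [sq_nonneg (‖h i (z i)‖ - ‖h j (z j)‖), sq_nonneg ‖h i (z i)‖,
      sq_nonneg ‖h j (z j)‖]
  have hsum : MemLp (fun z : Fin N → Ξ => ∑ i, h i (z i)) 2 (Measure.pi D) :=
    memLp_finsetSum _ fun i _ => hL i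
  refine ⟨hsum.const_smul _, ?_, ?_⟩
  · rw [integral_smul, integral_finsetSum _ fun i _ => hint i]
    simp [hzero]
  · have hN' : (0 : ℝ) < N := by exact_mod_cast hN
    have e : ∀ z : Fin N → Ξ, ‖(1 / (N : ℝ)) • ∑ i, h i (z i)‖ ^ 2
        = (1 / (N : ℝ)) ^ 2 * ∑ i, ∑ j, inner ℝ (h i (z i)) (h j (z j)) := by
      intro z
      rw [norm_smul, mul_pow, Real.norm_eq_abs, sq_abs, ← real_inner_self_eq_norm_sq, sum_inner]
      simp only [inner_sum]
    simp only [e]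
    rw [integral_const_mul, integral_finsetSum _ fun i _ => integrable_finsetSum _ fun j _ =>
      hinner i j]
    have e2 : ∀ i, ∫ z : Fin N → Ξ, ∑ j, inner ℝ (h i (z i)) (h j (z j)) ∂Measure.pi D ≤ τ := by
      intro i
      rw [integral_finsetSum _ fun j _ => hinner i j, Finset.sum_eq_single i
        (fun j _ hj => hcross i j hj.symm) (by simp)]
      simpa only [real_inner_self_eq_norm_sq] using hsq i
    calc _ ≤ (1 / (N : ℝ)) ^ 2 * ∑ _i : Fin N, τ := by
          gcongr with i _; exact e2 i
      _ = τ / N := by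
          rw [Finset.sum_const, Finset.card_univ, Fintype.card_fin, nsmul_eq_mul]
          field_simp

/-- A family of centred square-integrable noises `h x`, for `x` in `s`, with mean square at most
`τ`. -/
structure CentredNoise {α β : Type*} [MeasurableSpace α] [MeasurableSpace β] [MeasurableSpace E]
    (h : α × β → E) (κ : Measure β) (s : Set α) (τ : ℝ) : Prop where
  measurable : Measurable h
  memLp : ∀ x ∈ s, MemLp (fun b => h (x, b)) 2 κ
  mean : ∀ x ∈ s, ∫ b, h (x, b) ∂κ = 0
  sq_le : ∀ x ∈ s, ∫ b, ‖h (x, b)‖ ^ 2 ∂κ ≤ τ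

/-- Fresh noise adds at most `η² τ` to the mean square of a vector determined by the past. -/
lemma CentredNoise.step [IsProbabilityMeasure P] {α β : Type*} [MeasurableSpace α]
    [MeasurableSpace β] [MeasurableSpace E] [BorelSpace E] [SecondCountableTopology E]
    {h : α × β → E} {s : Set α} {τ : ℝ} {W : Ω → β} (hh : CentredNoise h (P.map W) s τ)
    (hτ : 0 ≤ τ) (hW : Measurable W) {x : Ω → α} {a : Ω → E} (hx : Measurable x)
    (hxs : ∀ ω, x ω ∈ s) (ha : Measurable a) (ha2 : MemLp a 2 P)
    (hind : IndepFun W (fun ω => (x ω, a ω)) P) (η : ℝ) :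
    MemLp (fun ω => a ω + η • h (x ω, W ω)) 2 P ∧
      ∫ ω, ‖a ω + η • h (x ω, W ω)‖ ^ 2 ∂P ≤ ∫ ω, ‖a ω‖ ^ 2 ∂P + η ^ 2 * τ := by
  have : IsProbabilityMeasure (P.map W) := Measure.isProbabilityMeasure_map hW.aemeasurable
  have hhm := hh.measurable
  have hm : Measurable fun ω => a ω + η • h (x ω, W ω) :=
    ha.add ((hhm.comp (hx.prodMk hW)).const_smul η)
  have hsq := integrable_norm_sq ha2
  have key := integrable_and_integral_le (P := P) (f := fun ω => ‖a ω + η • h (x ω, W ω)‖ ^ 2)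
    (g := fun ω => ‖a ω‖ ^ 2 + η ^ 2 * τ) (hm.norm.pow_const 2).aestronglyMeasurable
    (fun _ => by positivity) (hsq.add (integrable_const _)) (fun _ => by positivity) (by
      rw [lintegral_comp_of_indepFun (P := P) (U := fun ω => (x ω, a ω)) (W := W)
        (Φ := fun q => ENNReal.ofReal (‖q.1.2 + η • h (q.1.1, q.2)‖ ^ 2)) (hx.prodMk ha) hW hind
        (by fun_prop)]
      refine lintegral_mono fun ω => ?_
      exact lintegral_add_noise (hh.memLp _ (hxs ω)) (hh.mean _ (hxs ω)) (hh.sq_le _ (hxs ω)) _ _)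
  refine ⟨(memLp_two_iff_integrable_sq_norm hm.aestronglyMeasurable).2 key.1, ?_⟩
  refine key.2.trans (le_of_eq ?_)
  rw [integral_add hsq (integrable_const _)]
  simp

end MeanSquare

/-! ### The trajectory as a random process -/

section Measurability

variable {N n p : ℕ} {Ξ S : Type*}

lemma continuous_toMatrix_apply (i : Fin n) (j : Fin p) :
    Continuous fun X : Mat n p => toMatrix X i j := by
  unfold toMatrix
  simp only [Matrix.of_apply]
  fun_prop

lemma continuous_ofMatrix_of {α : Type*} [TopologicalSpace α]
    {A : α → Matrix (Fin n) (Fin p) ℝ} (h : ∀ i j, Continuous fun a => A a i j) :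
    Continuous fun a => ofMatrix (A a) :=
  (PiLp.continuous_toLp 2 _).comp (continuous_pi fun ij => h ij.1 ij.2)

lemma continuous_penaltyGrad : Continuous fun X : Mat n p => penaltyGrad X := by
  refine continuous_ofMatrix_of fun i j => ?_
  simp only [Matrix.mul_apply, Matrix.sub_apply, Matrix.transpose_apply]
  have := fun (i : Fin n) (j : Fin p) => continuous_toMatrix_apply i j
  fun_prop

lemma continuous_skewGrad : Continuous fun q : Mat n p × Mat n p => skewGrad q.1 q.2 := by
  refine continuous_ofMatrix_of fun i j => ?_
  simp only [skewPart, Matrix.mul_apply, Matrix.smul_apply, Matrix.sub_apply,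
    Matrix.transpose_apply, smul_eq_mul]
  have h1 := fun (i : Fin n) (j : Fin p) =>
    (continuous_toMatrix_apply i j).comp (continuous_fst (X := Mat n p) (Y := Mat n p))
  have h2 := fun (i : Fin n) (j : Fin p) =>
    (continuous_toMatrix_apply i j).comp (continuous_snd (X := Mat n p) (Y := Mat n p))
  simp only [Function.comp_def] at h1 h2
  fun_prop

lemma measurable_landingDir (lam : ℝ) :
    Measurable fun q : Mat n p × Mat n p => landingDir lam q.1 q.2 := by
  unfold landingDir
  exact ((continuous_skewGrad.comp continuous_swap).add
    ((continuous_penaltyGrad.comp continuous_fst).const_smul lam)).measurable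

lemma measurable_clip (B : ℝ) : Measurable fun g : Mat n p => clip B g := by
  unfold clip
  fun_prop

lemma measurable_gradient (f : Mat n p → ℝ) : Measurable (gradient f) :=
  (LinearIsometryEquiv.continuous _).measurable.comp (measurable_fderiv ℝ f)

/-- The components of a state, as an element of a measurable space. -/
def State.data (st : State N n p) :
    Mat n p × (Fin N → Mat n p) × (Fin N → Mat n p) × Mat n p :=
  (st.X, st.v, st.g, st.master)

lemma measurable_average {A : Type*} [MeasurableSpace A] {f : Fin N → A → Mat n p}
    (h : ∀ i, Measurable (f i)) : Measurable fun a => (1 / (N : ℝ)) • ∑ i, f i a := by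
  have : Measurable fun a => ∑ i, f i a := Finset.measurable_fun_sum _ fun i _ => h i
  fun_prop

section

variable {A : Type*} [MeasurableSpace A] {st : A → State N n p}

lemma measurable_nextX (h : Measurable fun a => (st a).data) (B lam γ : ℝ) :
    Measurable fun a => (st a).nextX B lam γ := by
  have hX : Measurable fun a => (st a).X := h.fst
  have hm : Measurable fun a => (st a).master := h.snd.snd.snd
  exact hX.sub (((measurable_landingDir lam).comp
    (hX.prodMk ((measurable_clip B).comp hm))).const_smul γ)

variable [MeasurableSpace Ξ] [MeasurableSpace S] {G : Mat n p → Ξ → Mat n p}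
  {C : S → Mat n p → Mat n p}

lemma measurable_nextV (hG : Measurable fun q : Mat n p × Ξ => G q.1 q.2)
    (h : Measurable fun a => (st a).data) {z : A → Fin N → Ξ} (hz : Measurable z)
    (B lam γ η : ℝ) (i : Fin N) : Measurable fun a => (st a).nextV G B lam γ η (z a) i := by
  have hv : Measurable fun a => (st a).v i := (measurable_pi_apply i).comp h.snd.fst
  have hg : Measurable fun a => G ((st a).nextX B lam γ) (z a i) :=
    hG.comp ((measurable_nextX h B lam γ).prodMk ((measurable_pi_apply i).comp hz))
  exact (hv.const_smul (1 - η)).add (hg.const_smul η)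

lemma measurable_step (hG : Measurable fun q : Mat n p × Ξ => G q.1 q.2)
    (hC : Measurable fun q : S × Mat n p => C q.1 q.2)
    (h : Measurable fun a => (st a).data) {z : A → Fin N → Ξ} (hz : Measurable z)
    {s : A → Fin N → S} (hs : Measurable s) (B lam γ η : ℝ) :
    Measurable fun a => ((st a).step G C B lam γ η (z a) (s a)).data := by
  have hg : ∀ i, Measurable fun a => (st a).g i := fun i =>
    (measurable_pi_apply i).comp h.snd.snd.fst
  have hmsg : ∀ i, Measurable fun a => (st a).message G C B lam γ η (z a) (s a) i := fun i =>
    hC.comp (((measurable_pi_apply i).comp hs).prodMk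
      ((measurable_nextV hG h hz B lam γ η i).sub (hg i)))
  refine (measurable_nextX h B lam γ).prodMk (Measurable.prodMk ?_ (Measurable.prodMk ?_ ?_))
  · exact measurable_pi_lambda _ fun i => measurable_nextV hG h hz B lam γ η i
  · exact measurable_pi_lambda _ fun i => (hg i).add (hmsg i)
  · exact h.snd.snd.snd.add (measurable_average hmsg)

lemma measurable_run (hG : Measurable fun q : Mat n p × Ξ => G q.1 q.2)
    (hC : Measurable fun q : S × Mat n p => C q.1 q.2) {z : ℕ → A → Fin N → Ξ}
    (hz : ∀ l, Measurable (z l)) {s : ℕ → A → Fin N → S} (hs : ∀ l, Measurable (s l))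
    (B lam γ η : ℝ) (X₀ : Mat n p) (k : ℕ) :
    Measurable fun a =>
      (run G C B lam γ η X₀ (fun l => z l a) (fun l => s l a) k).data := by
  induction k with
  | zero =>
    have hv : ∀ i, Measurable fun a => G X₀ (z 0 a i) := fun i =>
      hG.comp (measurable_const.prodMk ((measurable_pi_apply i).comp (hz 0)))
    have hg : ∀ i, Measurable fun a => C (s 0 a i) (G X₀ (z 0 a i)) := fun i =>
      hC.comp (((measurable_pi_apply i).comp (hs 0)).prodMk (hv i))
    exact measurable_const.prodMk ((measurable_pi_lambda _ hv).prodMk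
      ((measurable_pi_lambda _ hg).prodMk (measurable_average hg)))
  | succ k ih => exact measurable_step hG hC ih (hz _) (hs _) _ _ _ _

end

lemma run_congr (G : Mat n p → Ξ → Mat n p) (C : S → Mat n p → Mat n p) (B lam γ η : ℝ)
    (X₀ : Mat n p) {z z' : ℕ → Fin N → Ξ} {s s' : ℕ → Fin N → S} (k : ℕ)
    (h : ∀ l ≤ k, z l = z' l ∧ s l = s' l) :
    run G C B lam γ η X₀ z s k = run G C B lam γ η X₀ z' s' k := by
  induction k with
  | zero => simp only [run, (h 0 le_rfl).1, (h 0 le_rfl).2]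
  | succ k ih =>
    simp only [run, ih fun l hl => h l (hl.trans k.le_succ), (h (k + 1) le_rfl).1,
      (h (k + 1) le_rfl).2]

end Measurability

section Trajectory

variable {N n p : ℕ} {Ξ S Ω : Type*} [MeasurableSpace Ξ] [MeasurableSpace S] [MeasurableSpace Ω]

/-- The standing assumptions on the problem, the compressor, the sampling and the starting
point. -/
structure Setting (P : Measure Ω) (pb : Problem N n p Ξ) (c : Constants N) (ν : Measure S)
    (C : S → Mat n p → Mat n p) (ξ : ℕ → Ω → Fin N → Ξ) (ζ : ℕ → Ω → Fin N → S)
    (X₀ : Mat n p) : Prop where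
  nodes_pos : 0 < N
  valid : c.Valid
  wellPosed : pb.WellPosed c.eps
  gradientBound : pb.GradientBound c.eps c.Lgrad
  smooth : pb.Smooth c.eps c.Lnode
  smoothOn_obj : SmoothOn pb.obj c.L (safeRegion n p c.eps)
  smoothOn_merit : SmoothOn (merit pb.obj c.mu) c.Lm (safeRegion n p c.eps)
  boundedVariance : pb.BoundedVariance c.eps c.sigma
  contractive : Contractive C ν c.alpha
  sampling : SamplingModel P pb.D ν ξ ζ
  start_mem : X₀ ∈ safeRegion n p c.eps

/-- The random state after `k` iterations with step size `γ` and momentum `η`. -/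
def traj (pb : Problem N n p Ξ) (c : Constants N) (C : S → Mat n p → Mat n p)
    (ξ : ℕ → Ω → Fin N → Ξ) (ζ : ℕ → Ω → Fin N → S) (X₀ : Mat n p) (γ η : ℝ) (k : ℕ) (ω : Ω) :
    State N n p :=
  run pb.sgrad C c.Lgrad c.lam γ η X₀ (fun l => ξ l ω) (fun l => ζ l ω) k

variable {P : Measure Ω} {pb : Problem N n p Ξ} {c : Constants N} {ν : Measure S}
  {C : S → Mat n p → Mat n p} {ξ : ℕ → Ω → Fin N → Ξ} {ζ : ℕ → Ω → Fin N → S} {X₀ : Mat n p}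

lemma norm_clip_le {B : ℝ} (hB : 0 ≤ B) (g : Mat n p) : ‖clip B g‖ ≤ B := by
  rw [clip, norm_smul, Real.norm_of_nonneg (le_min zero_le_one (by positivity))]
  rcases (norm_nonneg g).eq_or_lt with h | h
  · rw [← h]; simpa using hB
  · calc _ ≤ B / ‖g‖ * ‖g‖ := by gcongr; exact min_le_right _ _
      _ = B := by field_simp

namespace Setting

lemma measurable_data (H : Setting P pb c ν C ξ ζ X₀) (γ η : ℝ) (k : ℕ) :
    Measurable fun ω => (traj pb c C ξ ζ X₀ γ η k ω).data :=
  measurable_run H.wellPosed.measurable H.contractive.measurable H.sampling.measurable_sample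
    H.sampling.measurable_seed _ _ _ _ _ _

/-- The state after `k` iterations is a function of the randomness of the rounds `0, …, k`. -/
lemma exists_factor (H : Setting P pb c ν C ξ ζ X₀) (γ η : ℝ) (k : ℕ) :
    ∃ Ψ : (Fin (k + 1) → (Fin N → Ξ) × (Fin N → S)) →
        Mat n p × (Fin N → Mat n p) × (Fin N → Mat n p) × Mat n p,
      Measurable Ψ ∧ ∀ ω, (traj pb c C ξ ζ X₀ γ η k ω).data
        = Ψ fun l : Fin (k + 1) => (ξ l ω, ζ l ω) := by
  -- rounds after `k` are irrelevant, and are replaced by round `k`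
  have hlt : ∀ l, min l k < k + 1 := fun l => by omega
  refine ⟨fun w => (run pb.sgrad C c.Lgrad c.lam γ η X₀ (fun l => (w ⟨min l k, hlt l⟩).1)
    (fun l => (w ⟨min l k, hlt l⟩).2) k).data, ?_, fun ω => ?_⟩
  · exact measurable_run
      (z := fun l (w : Fin (k + 1) → (Fin N → Ξ) × (Fin N → S)) => (w ⟨min l k, hlt l⟩).1)
      (s := fun l (w : Fin (k + 1) → (Fin N → Ξ) × (Fin N → S)) => (w ⟨min l k, hlt l⟩).2)
      H.wellPosed.measurable H.contractive.measurable
      (fun l => (measurable_pi_apply _).fst) (fun l => (measurable_pi_apply _).snd) _ _ _ _ _ _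
  · congr 1
    refine run_congr _ _ _ _ _ _ _ _ fun l hl => ?_
    simp [min_eq_left hl]

lemma indep_sample (H : Setting P pb c ν C ξ ζ X₀) (γ η : ℝ) (k : ℕ) :
    IndepFun (ξ (k + 1)) (fun ω => (traj pb c C ξ ζ X₀ γ η k ω).data) P := by
  obtain ⟨Ψ, hΨ, h⟩ := H.exists_factor γ η k
  simp only [h]
  exact (H.sampling.indep_sample (k + 1)).comp measurable_id hΨ

lemma indep_seed (H : Setting P pb c ν C ξ ζ X₀) (γ η : ℝ) (k : ℕ) (i : Fin N) :
    IndepFun (fun ω => ζ (k + 1) ω i)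
      (fun ω => ((traj pb c C ξ ζ X₀ γ η k ω).data, ξ (k + 1) ω)) P := by
  obtain ⟨Ψ, hΨ, h⟩ := H.exists_factor γ η k
  simp only [h]
  exact (H.sampling.indep_seed (k + 1) i).comp measurable_id
    ((hΨ.comp measurable_fst).prodMk measurable_snd)

/-- A step of size at most `gammaSafe` along the landing direction, with a clipped gradient, stays
in the safe region. -/
lemma landing_mem (H : Setting P pb c ν C ξ ζ X₀) {γ : ℝ} (hγ0 : 0 ≤ γ) (hγ : γ ≤ c.gammaSafe)
    {X g : Mat n p} (hX : X ∈ safeRegion n p c.eps) (hg : ‖g‖ ≤ c.Lgrad) :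
    X - γ • landingDir c.lam X g ∈ safeRegion n p c.eps := by
  have hc := H.valid
  have h1 := hc.eps_pos
  have h2 := hc.eps_lt
  have h3 := hc.lam_pos
  have h4 := hc.Lgrad_pos
  refine sub_smul_landingDir_mem (by linarith) h3 hX hg hγ0 ?_ ?_
  · rw [← le_div_iff₀ (by positivity)]
    exact hγ.trans (min_le_left _ _)
  · have : γ ≤ 1 / (2 * c.lam) := hγ.trans ((min_le_right _ _).trans (min_le_right _ _))
    rw [le_div_iff₀ (by positivity)] at this
    linarith

lemma X_mem (H : Setting P pb c ν C ξ ζ X₀) {γ : ℝ} (hγ0 : 0 ≤ γ) (hγ : γ ≤ c.gammaSafe)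
    (η : ℝ) (k : ℕ) (ω : Ω) : (traj pb c C ξ ζ X₀ γ η k ω).X ∈ safeRegion n p c.eps := by
  induction k with
  | zero => exact H.start_mem
  | succ k ih => exact H.landing_mem hγ0 hγ ih (norm_clip_le H.valid.Lgrad_pos.le _)

/-! ### Stochastic gradients as centred noise -/

lemma gradient_obj (H : Setting P pb c ν C ξ ζ X₀) (X : Mat n p) :
    gradient pb.obj X = (1 / (N : ℝ)) • ∑ i, gradient (pb.local i) X := by
  refine HasGradientAt.gradient ?_
  rw [hasGradientAt_iff_hasFDerivAt, map_smul, map_sum]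
  have h : HasFDerivAt (fun Y => ∑ i, pb.local i Y)
      (∑ i, (InnerProductSpace.toDual ℝ (Mat n p)) (gradient (pb.local i) X)) X :=
    HasFDerivAt.fun_sum fun i _ => ((H.smooth i).1 X).hasGradientAt.hasFDerivAt
  exact h.const_mul _

lemma node_noise (H : Setting P pb c ν C ξ ζ X₀) (i : Fin N) {X : Mat n p}
    (hX : X ∈ safeRegion n p c.eps) :
    MemLp (fun z => pb.sgrad X z - gradient (pb.local i) X) 2 (pb.D i) ∧
      ∫ z, ‖pb.sgrad X z - gradient (pb.local i) X‖ ^ 2 ∂pb.D i ≤ c.sigma ^ 2 := by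
  have := H.wellPosed.prob i
  refine memLp_two_of_lintegral_le ?_ (sq_nonneg _) (H.boundedVariance i X hX).2
  exact ((H.wellPosed.measurable.comp (measurable_const.prodMk measurable_id)).sub_const
    _).aestronglyMeasurable

/-- The sample gradients are bounded almost surely, and `∇f_i` is their mean. -/
lemma norm_gradient_local_le (H : Setting P pb c ν C ξ ζ X₀) (i : Fin N) {X : Mat n p}
    (hX : X ∈ safeRegion n p c.eps) : ‖gradient (pb.local i) X‖ ≤ c.Lgrad := by
  have := H.wellPosed.prob i
  have h1 : Integrable (fun z => pb.sgrad X z - gradient (pb.local i) X) (pb.D i) :=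
    (H.node_noise i hX).1.integrable (by norm_num)
  have h2 : Integrable (fun z => pb.sgrad X z) (pb.D i) := by
    exact (h1.add (integrable_const (gradient (pb.local i) X))).congr
      (ae_of_all _ fun z => sub_add_cancel _ _)
  have h3 := (H.boundedVariance i X hX).1
  rw [integral_sub h2 (integrable_const _), integral_const, probReal_univ, one_smul,
    sub_eq_zero] at h3
  rw [← h3]
  simpa using norm_integral_le_of_norm_le_const (H.gradientBound i X hX)

lemma norm_gradient_obj_le (H : Setting P pb c ν C ξ ζ X₀) {X : Mat n p}
    (hX : X ∈ safeRegion n p c.eps) : ‖gradient pb.obj X‖ ≤ c.Lgrad := by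
  have hN : (0 : ℝ) < N := by exact_mod_cast H.nodes_pos
  rw [H.gradient_obj, norm_smul, Real.norm_of_nonneg (by positivity)]
  calc 1 / (N : ℝ) * ‖∑ i, gradient (pb.local i) X‖
      ≤ 1 / (N : ℝ) * ∑ _i : Fin N, c.Lgrad := by
        gcongr
        exact norm_sum_le_of_le _ fun i _ => H.norm_gradient_local_le i hX
    _ = c.Lgrad := by
        rw [Finset.sum_const, Finset.card_univ, Fintype.card_fin, nsmul_eq_mul]
        field_simp

lemma centredNoise_node (H : Setting P pb c ν C ξ ζ X₀) (k : ℕ) (i : Fin N) :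
    CentredNoise (fun q : Mat n p × (Fin N → Ξ) =>
      pb.sgrad q.1 (q.2 i) - gradient (pb.local i) q.1) (P.map (ξ k)) (safeRegion n p c.eps)
      (c.sigma ^ 2) := by
  have := H.wellPosed.prob
  have hmp := measurePreserving_eval pb.D i
  have hmm : Measurable fun q : Mat n p × (Fin N → Ξ) =>
      pb.sgrad q.1 (q.2 i) - gradient (pb.local i) q.1 :=
    (H.wellPosed.measurable.comp (measurable_fst.prodMk
      ((measurable_pi_apply i).comp measurable_snd))).sub
      ((measurable_gradient _).comp measurable_fst)
  rw [H.sampling.law_sample k]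
  refine ⟨hmm, fun X hX => (H.node_noise i hX).1.comp_measurePreserving hmp, fun X hX => ?_,
    fun X hX => ?_⟩
  · rw [← integral_map (φ := fun z : Fin N → Ξ => z i)
      (f := fun y => pb.sgrad X y - gradient (pb.local i) X) (measurable_pi_apply i).aemeasurable]
    · rw [hmp.map_eq]; exact (H.boundedVariance i X hX).1
    · rw [hmp.map_eq]; exact (H.node_noise i hX).1.1
  · rw [← integral_map (φ := fun z : Fin N → Ξ => z i)
      (f := fun y => ‖pb.sgrad X y - gradient (pb.local i) X‖ ^ 2)
      (measurable_pi_apply i).aemeasurable]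
    · rw [hmp.map_eq]; exact (H.node_noise i hX).2
    · rw [hmp.map_eq]; exact (H.node_noise i hX).1.1.norm.pow 2

lemma centredNoise_average (H : Setting P pb c ν C ξ ζ X₀) (k : ℕ) :
    CentredNoise (fun q : Mat n p × (Fin N → Ξ) =>
      (1 / (N : ℝ)) • ∑ i, (pb.sgrad q.1 (q.2 i) - gradient (pb.local i) q.1)) (P.map (ξ k))
      (safeRegion n p c.eps) (c.sigma ^ 2 / N) := by
  have := H.wellPosed.prob
  have hav := fun X hX => integral_norm_sq_average_le H.nodes_pos (D := pb.D)
    (h := fun i z => pb.sgrad X z - gradient (pb.local i) X) (fun i => (H.node_noise i hX).1)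
    (fun i => (H.boundedVariance i X hX).1) (fun i => (H.node_noise i hX).2)
  have hmm : Measurable fun q : Mat n p × (Fin N → Ξ) =>
      (1 / (N : ℝ)) • ∑ i, (pb.sgrad q.1 (q.2 i) - gradient (pb.local i) q.1) :=
    measurable_average fun i => (H.centredNoise_node k i).measurable
  rw [H.sampling.law_sample k]
  exact ⟨hmm, fun X hX => (hav X hX).1, fun X hX => (hav X hX).2.1, fun X hX => (hav X hX).2.2⟩

end Setting

end Trajectory

/-! ### Recursions for the compression and momentum errors -/

section Successor

variable {N n p : ℕ} {Ξ S Ω : Type*} [MeasurableSpace Ξ] {pb : Problem N n p Ξ} {c : Constants N}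
  {C : S → Mat n p → Mat n p} {ξ : ℕ → Ω → Fin N → Ξ} {ζ : ℕ → Ω → Fin N → S} {X₀ : Mat n p}
  {γ : ℝ}

lemma v_succ (k : ℕ) (i : Fin N) (η : ℝ) (ω : Ω) :
    (traj pb c C ξ ζ X₀ γ η (k + 1) ω).v i
      = (1 - η) • (traj pb c C ξ ζ X₀ γ η k ω).v i
        + η • pb.sgrad (traj pb c C ξ ζ X₀ γ η (k + 1) ω).X (ξ (k + 1) ω i) := rfl

lemma g_succ (k : ℕ) (i : Fin N) (η : ℝ) (ω : Ω) :
    (traj pb c C ξ ζ X₀ γ η (k + 1) ω).g i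
      = (traj pb c C ξ ζ X₀ γ η k ω).g i + C (ζ (k + 1) ω i)
        ((traj pb c C ξ ζ X₀ γ η (k + 1) ω).v i - (traj pb c C ξ ζ X₀ γ η k ω).g i) := rfl

end Successor

section Recursions

variable {N n p : ℕ} {Ξ S Ω : Type*} [MeasurableSpace Ξ] [MeasurableSpace S] [MeasurableSpace Ω]
  {P : Measure Ω} {pb : Problem N n p Ξ} {c : Constants N} {ν : Measure S}
  {C : S → Mat n p → Mat n p} {ξ : ℕ → Ω → Fin N → Ξ} {ζ : ℕ → Ω → Fin N → S} {X₀ : Mat n p}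

/-- The state with given components. -/
def State.ofData (d : Mat n p × (Fin N → Mat n p) × (Fin N → Mat n p) × Mat n p) : State N n p :=
  ⟨d.1, d.2.1, d.2.2.1, d.2.2.2⟩

lemma measurable_nextX_ofData (B lam γ : ℝ) :
    Measurable fun d : Mat n p × (Fin N → Mat n p) × (Fin N → Mat n p) × Mat n p =>
      (State.ofData d).nextX B lam γ :=
  measurable_nextX (st := State.ofData) measurable_id _ _ _

lemma memLp_two_of_bounded [IsProbabilityMeasure P] {f : Ω → Mat n p} (hf : Measurable f) {M : ℝ}
    (h : ∀ ω, ‖f ω‖ ≤ M) : MemLp f 2 P :=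
  MemLp.of_bound hf.aestronglyMeasurable M (ae_of_all _ h)

lemma theta_eq (c : Constants N) : 1 - c.theta = Real.sqrt (1 - c.alpha) := by
  rw [Constants.theta]; ring

lemma beta_eq (hc : c.Valid) :
    c.beta = Real.sqrt (1 - c.alpha) ^ 2 / (1 - Real.sqrt (1 - c.alpha)) := by
  rw [Constants.beta, Real.sq_sqrt (by linarith [hc.alpha_lt])]

lemma sqrt_alpha_lt_one (hc : c.Valid) : Real.sqrt (1 - c.alpha) < 1 := by
  rw [Real.sqrt_lt' one_pos]
  linarith [hc.alpha_pos]

lemma theta_pos (hc : c.Valid) : 0 < c.theta := by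
  rw [Constants.theta]; linarith [sqrt_alpha_lt_one hc]

lemma beta_pos (hc : c.Valid) : 0 < c.beta :=
  div_pos (by linarith [hc.alpha_lt]) (theta_pos hc)

lemma exists_norm_le (ε : ℝ) : ∃ M, ∀ X ∈ safeRegion n p ε, ‖X‖ ≤ M := by
  obtain ⟨M, hM⟩ := (isCompact_safeRegion (n := n) (p := p) (ε := ε)).isBounded.exists_norm_le
  exact ⟨M, hM⟩

namespace Setting

variable {γ : ℝ}

lemma measurable_X (H : Setting P pb c ν C ξ ζ X₀) (γ η : ℝ) (k : ℕ) :
    Measurable fun ω => (traj pb c C ξ ζ X₀ γ η k ω).X := (H.measurable_data γ η k).fst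

lemma measurable_v (H : Setting P pb c ν C ξ ζ X₀) (γ η : ℝ) (k : ℕ) (i : Fin N) :
    Measurable fun ω => (traj pb c C ξ ζ X₀ γ η k ω).v i :=
  (measurable_pi_apply i).comp (H.measurable_data γ η k).snd.fst

lemma measurable_g (H : Setting P pb c ν C ξ ζ X₀) (γ η : ℝ) (k : ℕ) (i : Fin N) :
    Measurable fun ω => (traj pb c C ξ ζ X₀ γ η k ω).g i :=
  (measurable_pi_apply i).comp (H.measurable_data γ η k).snd.snd.fst

/-- The seed of a compressor is independent of the vector that it compresses. -/
lemma indep_seed_message (H : Setting P pb c ν C ξ ζ X₀) (η : ℝ) (k : ℕ) (i : Fin N) :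
    IndepFun (fun ω => ζ (k + 1) ω i) (fun ω => (traj pb c C ξ ζ X₀ γ η (k + 1) ω).v i
      - (traj pb c C ξ ζ X₀ γ η k ω).g i) P := by
  have hst : Measurable fun q : (Mat n p × (Fin N → Mat n p) × (Fin N → Mat n p) × Mat n p)
      × (Fin N → Ξ) => (State.ofData q.1).data := measurable_fst
  exact (H.indep_seed γ η k i).comp measurable_id
    ((measurable_nextV H.wellPosed.measurable hst measurable_snd c.Lgrad c.lam γ η i).sub
      ((measurable_pi_apply i).comp measurable_fst.snd.snd.fst))

variable [IsProbabilityMeasure P]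

lemma memLp_X (H : Setting P pb c ν C ξ ζ X₀) (hγ0 : 0 ≤ γ) (hγ : γ ≤ c.gammaSafe) (η : ℝ)
    (k : ℕ) : MemLp (fun ω => (traj pb c C ξ ζ X₀ γ η k ω).X) 2 P := by
  obtain ⟨M, hM⟩ := exists_norm_le (n := n) (p := p) c.eps
  exact memLp_two_of_bounded (H.measurable_X γ η k) fun ω => hM _ (H.X_mem hγ0 hγ η k ω)

lemma memLp_gradient_local (H : Setting P pb c ν C ξ ζ X₀) (hγ0 : 0 ≤ γ) (hγ : γ ≤ c.gammaSafe)
    (η : ℝ) (k : ℕ) (i : Fin N) :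
    MemLp (fun ω => gradient (pb.local i) (traj pb c C ξ ζ X₀ γ η k ω).X) 2 P :=
  memLp_two_of_bounded ((measurable_gradient _).comp (H.measurable_X γ η k)) fun ω =>
    H.norm_gradient_local_le i (H.X_mem hγ0 hγ η k ω)

lemma memLp_gradient_obj (H : Setting P pb c ν C ξ ζ X₀) (hγ0 : 0 ≤ γ) (hγ : γ ≤ c.gammaSafe)
    (η : ℝ) (k : ℕ) :
    MemLp (fun ω => gradient pb.obj (traj pb c C ξ ζ X₀ γ η k ω).X) 2 P :=
  memLp_two_of_bounded ((measurable_gradient _).comp (H.measurable_X γ η k)) fun ω =>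
    H.norm_gradient_obj_le (H.X_mem hγ0 hγ η k ω)

/-- Compressing a vector that is independent of the seed of the compressor. -/
lemma compress_step (H : Setting P pb c ν C ξ ζ X₀) {W : Ω → S} (hW : Measurable W)
    (hlaw : P.map W = ν) {u : Ω → Mat n p} (hu : Measurable u) (hu2 : MemLp u 2 P)
    (hind : IndepFun W u P) :
    MemLp (fun ω => C (W ω) (u ω) - u ω) 2 P ∧
      ∫ ω, ‖C (W ω) (u ω) - u ω‖ ^ 2 ∂P ≤ (1 - c.alpha) * ∫ ω, ‖u ω‖ ^ 2 ∂P := by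
  have hCm := H.contractive.measurable
  have hα : 0 ≤ 1 - c.alpha := by linarith [H.valid.alpha_lt]
  have hm : Measurable fun ω => C (W ω) (u ω) - u ω := (hCm.comp (hW.prodMk hu)).sub hu
  have hm2 : Measurable fun q : Mat n p × S => C q.2 q.1 - q.1 :=
    (hCm.comp measurable_swap).sub measurable_fst
  have key := integrable_and_integral_le (P := P) (f := fun ω => ‖C (W ω) (u ω) - u ω‖ ^ 2)
    (g := fun ω => (1 - c.alpha) * ‖u ω‖ ^ 2) (hm.norm.pow_const 2).aestronglyMeasurable
    (fun _ => by positivity) ((integrable_norm_sq hu2).const_mul _) (fun _ => by positivity) (by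
      rw [lintegral_comp_of_indepFun (P := P) (U := u) (W := W)
        (Φ := fun q => ENNReal.ofReal (‖C q.2 q.1 - q.1‖ ^ 2)) hu hW hind
        (hm2.norm.pow_const 2).ennreal_ofReal, hlaw]
      refine lintegral_mono fun ω => ?_
      simpa only [sq_ofReal_norm] using H.contractive.contract (u ω))
  rw [integral_const_mul] at key
  exact ⟨(memLp_two_iff_integrable_sq_norm hm.aestronglyMeasurable).2 key.1, key.2⟩

/-- One round of fresh samples, for noise `h` at the new iterate added to a function `φ` of the
current state. -/
lemma sample_step (H : Setting P pb c ν C ξ ζ X₀) (hγ0 : 0 ≤ γ) (hγ : γ ≤ c.gammaSafe) (η : ℝ)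
    (k : ℕ) {h : Mat n p × (Fin N → Ξ) → Mat n p} {τ : ℝ}
    (hh : CentredNoise h (P.map (ξ (k + 1))) (safeRegion n p c.eps) τ) (hτ : 0 ≤ τ)
    {φ : Mat n p × (Fin N → Mat n p) × (Fin N → Mat n p) × Mat n p → Mat n p}
    (hφ : Measurable φ)
    (hφ2 : MemLp (fun ω => φ (traj pb c C ξ ζ X₀ γ η k ω).data) 2 P) :
    MemLp (fun ω => φ (traj pb c C ξ ζ X₀ γ η k ω).data
        + η • h ((traj pb c C ξ ζ X₀ γ η (k + 1) ω).X, ξ (k + 1) ω)) 2 P ∧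
      ∫ ω, ‖φ (traj pb c C ξ ζ X₀ γ η k ω).data
        + η • h ((traj pb c C ξ ζ X₀ γ η (k + 1) ω).X, ξ (k + 1) ω)‖ ^ 2 ∂P
        ≤ ∫ ω, ‖φ (traj pb c C ξ ζ X₀ γ η k ω).data‖ ^ 2 ∂P + η ^ 2 * τ :=
  hh.step hτ (H.sampling.measurable_sample _) (H.measurable_X γ η (k + 1))
    (H.X_mem hγ0 hγ η (k + 1)) (hφ.comp (H.measurable_data γ η k)) hφ2
    ((H.indep_sample γ η k).comp measurable_id
      ((measurable_nextX_ofData c.Lgrad c.lam γ).prodMk hφ)) η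

/-- The momenta and the compressed gradients are square integrable. -/
lemma memLp_v_g (H : Setting P pb c ν C ξ ζ X₀) (hγ0 : 0 ≤ γ) (hγ : γ ≤ c.gammaSafe) (η : ℝ)
    (k : ℕ) (i : Fin N) : MemLp (fun ω => (traj pb c C ξ ζ X₀ γ η k ω).v i) 2 P ∧
      MemLp (fun ω => (traj pb c C ξ ζ X₀ γ η k ω).g i) 2 P := by
  have hσ := sq_nonneg c.sigma
  have hζm : ∀ k, Measurable fun ω => ζ k ω i := fun k =>
    (measurable_pi_apply i).comp (H.sampling.measurable_seed k)
  induction k with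
  | zero =>
    have hv : MemLp (fun ω => (traj pb c C ξ ζ X₀ γ η 0 ω).v i) 2 P := by
      have := ((H.centredNoise_node 0 i).step hσ (H.sampling.measurable_sample 0)
        (x := fun _ => X₀) (a := fun _ => gradient (pb.local i) X₀) measurable_const
        (fun _ => H.start_mem) measurable_const (memLp_const _)
        (indepFun_const_right _ _) 1).1
      refine (memLp_congr_ae (ae_of_all _ fun ω => ?_)).1 this
      simp only [one_smul, add_sub_cancel]
      rfl
    refine ⟨hv, ?_⟩
    have hind : IndepFun (fun ω => ζ 0 ω i) (fun ω => (traj pb c C ξ ζ X₀ γ η 0 ω).v i) P := by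
      have hm : Measurable fun q : (Fin 0 → (Fin N → Ξ) × (Fin N → S)) × (Fin N → Ξ) =>
          pb.sgrad X₀ (q.2 i) := H.wellPosed.measurable.comp
        (measurable_const.prodMk ((measurable_pi_apply i).comp measurable_snd))
      exact (H.sampling.indep_seed 0 i).comp measurable_id hm
    have := hv.add (H.compress_step (hζm 0) (H.sampling.law_seed 0 i) (H.measurable_v γ η 0 i) hv
      hind).1
    refine (memLp_congr_ae (ae_of_all _ fun ω => ?_)).1 this
    simp only [Pi.add_apply, add_sub_cancel]
    rfl
  | succ k ih =>
    have hv : MemLp (fun ω => (traj pb c C ξ ζ X₀ γ η (k + 1) ω).v i) 2 P := by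
      have := (H.sample_step hγ0 hγ η k (H.centredNoise_node (k + 1) i) hσ
        (φ := fun d => (1 - η) • d.2.1 i
          + η • gradient (pb.local i) ((State.ofData d).nextX c.Lgrad c.lam γ))
        ((((measurable_pi_apply i).comp measurable_snd.fst).const_smul (1 - η)).add
          (((measurable_gradient _).comp (measurable_nextX_ofData _ _ _)).const_smul η))
        ((ih.1.const_smul (1 - η)).add
          ((H.memLp_gradient_local hγ0 hγ η (k + 1) i).const_smul η))).1
      refine (memLp_congr_ae (ae_of_all _ fun ω => ?_)).1 this
      rw [v_succ, smul_sub]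
      exact add_add_sub_cancel _ _ _
    refine ⟨hv, ?_⟩
    have hu2 := hv.sub ih.2
    have hind : IndepFun (fun ω => ζ (k + 1) ω i)
        (fun ω => (traj pb c C ξ ζ X₀ γ η (k + 1) ω).v i
          - (traj pb c C ξ ζ X₀ γ η k ω).g i) P :=
      H.indep_seed_message η k i
    have := hv.add (H.compress_step (hζm (k + 1)) (H.sampling.law_seed (k + 1) i)
      ((H.measurable_v γ η (k + 1) i).sub (H.measurable_g γ η k i)) hu2 hind).1
    refine (memLp_congr_ae (ae_of_all _ fun ω => ?_)).1 this
    rw [g_succ]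
    simp only [Pi.add_apply, Pi.sub_apply]
    abel

/-- Recursion for a momentum error, for a momentum `φ` that averages noisy values of a Lipschitz
field `d`. -/
lemma momentum_step (H : Setting P pb c ν C ξ ζ X₀) (hγ0 : 0 ≤ γ) (hγ : γ ≤ c.gammaSafe) {η : ℝ}
    (hη0 : 0 < η) (hη1 : η ≤ 1)
    (k : ℕ) {h : Mat n p × (Fin N → Ξ) → Mat n p} {τ : ℝ}
    (hh : CentredNoise h (P.map (ξ (k + 1))) (safeRegion n p c.eps) τ) (hτ : 0 ≤ τ)
    {φ : Mat n p × (Fin N → Mat n p) × (Fin N → Mat n p) × Mat n p → Mat n p}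
    (hφ : Measurable φ)
    (hφ2 : MemLp (fun ω => φ (traj pb c C ξ ζ X₀ γ η k ω).data) 2 P)
    {d : Mat n p → Mat n p} {M : ℝ} (hd : Measurable d)
    (hd2 : ∀ k, MemLp (fun ω => d (traj pb c C ξ ζ X₀ γ η k ω).X) 2 P)
    (hM : ∀ X ∈ safeRegion n p c.eps, ∀ Y ∈ safeRegion n p c.eps, ‖d X - d Y‖ ≤ M * ‖X - Y‖) :
    ∫ ω, ‖(1 - η) • φ (traj pb c C ξ ζ X₀ γ η k ω).data
        + η • (d (traj pb c C ξ ζ X₀ γ η (k + 1) ω).X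
          + h ((traj pb c C ξ ζ X₀ γ η (k + 1) ω).X, ξ (k + 1) ω))
        - d (traj pb c C ξ ζ X₀ γ η (k + 1) ω).X‖ ^ 2 ∂P
      ≤ (1 - η) * ∫ ω, ‖φ (traj pb c C ξ ζ X₀ γ η k ω).data
          - d (traj pb c C ξ ζ X₀ γ η k ω).X‖ ^ 2 ∂P
        + (1 - η) ^ 2 / η * M ^ 2 * ∫ ω, ‖(traj pb c C ξ ζ X₀ γ η (k + 1) ω).X
          - (traj pb c C ξ ζ X₀ γ η k ω).X‖ ^ 2 ∂P
        + η ^ 2 * τ := by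
  have hstep := (H.sample_step hγ0 hγ η k hh hτ
    (φ := fun q => (1 - η) • (φ q - d ((State.ofData q).nextX c.Lgrad c.lam γ)))
    ((hφ.sub (hd.comp (measurable_nextX_ofData _ _ _))).const_smul (1 - η))
    ((hφ2.sub (hd2 (k + 1))).const_smul (1 - η))).2
  have e : ∀ a b x : Mat n p, (1 - η) • a + η • (b + x) - b = (1 - η) • (a - b) + η • x := by
    intro a b x; module
  simp only [e]
  refine hstep.trans (add_le_add_left ?_ _)
  have hi1 := (integrable_norm_sq (hφ2.sub (hd2 k))).const_mul (1 - η)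
  have hi2 := (integrable_norm_sq
    ((H.memLp_X hγ0 hγ η (k + 1)).sub (H.memLp_X hγ0 hγ η k))).const_mul ((1 - η) ^ 2 / η * M ^ 2)
  rw [← integral_const_mul, ← integral_const_mul]
  refine (integral_mono_of_nonneg (ae_of_all _ fun _ => by positivity) (hi1.add hi2)
    (ae_of_all _ fun ω => ?_)).trans (le_of_eq (integral_add hi1 hi2))
  have hX := H.X_mem hγ0 hγ η k ω
  have hX' := H.X_mem hγ0 hγ η (k + 1) ω
  set a := φ (traj pb c C ξ ζ X₀ γ η k ω).data
  set X := (traj pb c C ξ ζ X₀ γ η k ω).X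
  change ‖(1 - η) • (a - d (traj pb c C ξ ζ X₀ γ η (k + 1) ω).X)‖ ^ 2 ≤ (1 - η) * ‖a - d X‖ ^ 2
    + (1 - η) ^ 2 / η * M ^ 2 * ‖(traj pb c C ξ ζ X₀ γ η (k + 1) ω).X - X‖ ^ 2
  set Y := (traj pb c C ξ ζ X₀ γ η (k + 1) ω).X
  have h1 := sq_mul_norm_add_sq_le (a - d X) (d X - d Y) (by linarith : 0 ≤ 1 - η)
    (by linarith : 1 - η < 1)
  rw [sub_add_sub_cancel, sub_sub_cancel] at h1
  have h2 : ‖d X - d Y‖ ^ 2 ≤ M ^ 2 * ‖Y - X‖ ^ 2 := by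
    rw [← mul_pow, norm_sub_rev Y X]
    exact pow_le_pow_left₀ (norm_nonneg _) (hM X hX Y hX') 2
  rw [norm_smul, mul_pow, Real.norm_eq_abs, sq_abs]
  refine h1.trans (add_le_add_right ?_ _)
  rw [mul_assoc]
  gcongr

lemma momentum_node_step (H : Setting P pb c ν C ξ ζ X₀) (hγ0 : 0 ≤ γ) (hγ : γ ≤ c.gammaSafe)
    {η : ℝ} (hη0 : 0 < η) (hη1 : η ≤ 1) (k : ℕ) (i : Fin N) :
    ∫ ω, ‖(traj pb c C ξ ζ X₀ γ η (k + 1) ω).v i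
        - gradient (pb.local i) (traj pb c C ξ ζ X₀ γ η (k + 1) ω).X‖ ^ 2 ∂P
      ≤ (1 - η) * ∫ ω, ‖(traj pb c C ξ ζ X₀ γ η k ω).v i
          - gradient (pb.local i) (traj pb c C ξ ζ X₀ γ η k ω).X‖ ^ 2 ∂P
        + (1 - η) ^ 2 / η * c.Lnode i ^ 2 * ∫ ω, ‖(traj pb c C ξ ζ X₀ γ η (k + 1) ω).X
          - (traj pb c C ξ ζ X₀ γ η k ω).X‖ ^ 2 ∂P
        + η ^ 2 * c.sigma ^ 2 := by
  have h := H.momentum_step hγ0 hγ hη0 hη1 k (H.centredNoise_node (k + 1) i) (sq_nonneg c.sigma)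
    (φ := fun d => d.2.1 i) ((measurable_pi_apply i).comp measurable_snd.fst)
    (H.memLp_v_g hγ0 hγ η k i).1 (measurable_gradient (pb.local i))
    (fun k => H.memLp_gradient_local hγ0 hγ η k i) (H.smooth i).2
  simp only [add_sub_cancel] at h
  exact h

lemma memLp_average (H : Setting P pb c ν C ξ ζ X₀) (hγ0 : 0 ≤ γ) (hγ : γ ≤ c.gammaSafe) (η : ℝ)
    (k : ℕ) : MemLp (fun ω => (1 / (N : ℝ)) • ∑ i, (traj pb c C ξ ζ X₀ γ η k ω).v i) 2 P :=
  (memLp_finsetSum Finset.univ fun i _ => (H.memLp_v_g hγ0 hγ η k i).1).const_smul (1 / (N : ℝ))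

lemma momentum_average_step (H : Setting P pb c ν C ξ ζ X₀) (hγ0 : 0 ≤ γ) (hγ : γ ≤ c.gammaSafe)
    {η : ℝ} (hη0 : 0 < η) (hη1 : η ≤ 1) (k : ℕ) :
    ∫ ω, (traj pb c C ξ ζ X₀ γ η (k + 1) ω).momErr pb ∂P
      ≤ (1 - η) * ∫ ω, (traj pb c C ξ ζ X₀ γ η k ω).momErr pb ∂P
        + (1 - η) ^ 2 / η * c.L ^ 2 * ∫ ω, ‖(traj pb c C ξ ζ X₀ γ η (k + 1) ω).X
          - (traj pb c C ξ ζ X₀ γ η k ω).X‖ ^ 2 ∂P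
        + η ^ 2 * (c.sigma ^ 2 / N) := by
  have h := H.momentum_step hγ0 hγ hη0 hη1 k (H.centredNoise_average (k + 1))
    (by positivity)
    (φ := fun d => (1 / (N : ℝ)) • ∑ i, d.2.1 i)
    (measurable_average fun i => (measurable_pi_apply i).comp measurable_snd.fst)
    (H.memLp_average hγ0 hγ η k) (measurable_gradient pb.obj)
    (fun k => H.memLp_gradient_obj hγ0 hγ η k) H.smoothOn_obj.2
  refine le_trans (le_of_eq (integral_congr_ae (ae_of_all _ fun ω => ?_))) h
  simp only [State.momErr, v_succ]
  congr 2
  rw [H.gradient_obj, Finset.sum_add_distrib, Finset.sum_sub_distrib, ← Finset.smul_sum,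
    ← Finset.smul_sum]
  simp only [State.data]
  module

/-- Recursion for the compression error of a node. The compressor contracts `v⁺ - g`, which is split
into `v - g`, the momentum error, the drift of the gradient and the sampling noise. -/
lemma compression_step (H : Setting P pb c ν C ξ ζ X₀) (hγ0 : 0 ≤ γ) (hγ : γ ≤ c.gammaSafe)
    (η : ℝ) (k : ℕ) (i : Fin N) :
    ∫ ω, ‖(traj pb c C ξ ζ X₀ γ η (k + 1) ω).g i
        - (traj pb c C ξ ζ X₀ γ η (k + 1) ω).v i‖ ^ 2 ∂P
      ≤ (1 - c.theta) * ∫ ω, ‖(traj pb c C ξ ζ X₀ γ η k ω).g i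
          - (traj pb c C ξ ζ X₀ γ η k ω).v i‖ ^ 2 ∂P
        + 2 * c.beta * η ^ 2 * ∫ ω, ‖(traj pb c C ξ ζ X₀ γ η k ω).v i
          - gradient (pb.local i) (traj pb c C ξ ζ X₀ γ η k ω).X‖ ^ 2 ∂P
        + 2 * c.beta * η ^ 2 * c.Lnode i ^ 2 * ∫ ω, ‖(traj pb c C ξ ζ X₀ γ η (k + 1) ω).X
          - (traj pb c C ξ ζ X₀ γ η k ω).X‖ ^ 2 ∂P
        + (1 - c.alpha) * η ^ 2 * c.sigma ^ 2 := by
  have hα : 0 ≤ 1 - c.alpha := by linarith [H.valid.alpha_lt]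
  have hv := fun k => (H.memLp_v_g hγ0 hγ η k i).1
  have hg := fun k => (H.memLp_v_g hγ0 hγ η k i).2
  have hd := fun k => H.memLp_gradient_local hγ0 hγ η k i
  have hc := (H.compress_step ((measurable_pi_apply i).comp (H.sampling.measurable_seed (k + 1)))
    (H.sampling.law_seed (k + 1) i)
    ((H.measurable_v γ η (k + 1) i).sub (H.measurable_g γ η k i)) ((hv (k + 1)).sub (hg k))
    (H.indep_seed_message η k i)).2
  have e1 : ∀ ω, (traj pb c C ξ ζ X₀ γ η (k + 1) ω).g i
        - (traj pb c C ξ ζ X₀ γ η (k + 1) ω).v i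
      = C (ζ (k + 1) ω i) ((traj pb c C ξ ζ X₀ γ η (k + 1) ω).v i
          - (traj pb c C ξ ζ X₀ γ η k ω).g i)
        - ((traj pb c C ξ ζ X₀ γ η (k + 1) ω).v i - (traj pb c C ξ ζ X₀ γ η k ω).g i) := by
    intro ω; rw [g_succ]; abel
  simp only [e1]
  refine hc.trans ?_
  have hs := (H.sample_step hγ0 hγ η k (H.centredNoise_node (k + 1) i) (sq_nonneg c.sigma)
    (φ := fun q => (q.2.1 i - q.2.2.1 i)
      + η • (gradient (pb.local i) ((State.ofData q).nextX c.Lgrad c.lam γ) - q.2.1 i))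
    ((((measurable_pi_apply i).comp measurable_snd.fst).sub
      ((measurable_pi_apply i).comp measurable_snd.snd.fst)).add
        ((((measurable_gradient _).comp (measurable_nextX_ofData _ _ _)).sub
          ((measurable_pi_apply i).comp measurable_snd.fst)).const_smul η))
    (((hv k).sub (hg k)).add (((hd (k + 1)).sub (hv k)).const_smul η))).2
  have e2 : ∀ ω, (traj pb c C ξ ζ X₀ γ η (k + 1) ω).v i - (traj pb c C ξ ζ X₀ γ η k ω).g i
      = (traj pb c C ξ ζ X₀ γ η k ω).v i - (traj pb c C ξ ζ X₀ γ η k ω).g i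
        + η • (gradient (pb.local i) (traj pb c C ξ ζ X₀ γ η (k + 1) ω).X
          - (traj pb c C ξ ζ X₀ γ η k ω).v i)
        + η • (pb.sgrad (traj pb c C ξ ζ X₀ γ η (k + 1) ω).X (ξ (k + 1) ω i)
          - gradient (pb.local i) (traj pb c C ξ ζ X₀ γ η (k + 1) ω).X) := by
    intro ω; rw [v_succ]; module
  have hs' : ∫ ω, ‖(traj pb c C ξ ζ X₀ γ η (k + 1) ω).v i
      - (traj pb c C ξ ζ X₀ γ η k ω).g i‖ ^ 2 ∂P
      ≤ ∫ ω, ‖(traj pb c C ξ ζ X₀ γ η k ω).v i - (traj pb c C ξ ζ X₀ γ η k ω).g i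
        + η • (gradient (pb.local i) (traj pb c C ξ ζ X₀ γ η (k + 1) ω).X
          - (traj pb c C ξ ζ X₀ γ η k ω).v i)‖ ^ 2 ∂P + η ^ 2 * c.sigma ^ 2 := by
    simp only [e2]
    exact hs
  refine (mul_le_mul_of_nonneg_left hs' hα).trans ?_
  rw [mul_add, ← integral_const_mul]
  refine add_le_add ?_ (le_of_eq (by ring))
  have hi1 := (integrable_norm_sq ((hg k).sub (hv k))).const_mul (1 - c.theta)
  have hi2 := (integrable_norm_sq ((hv k).sub (hd k))).const_mul (2 * c.beta * η ^ 2)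
  have hi3 := (integrable_norm_sq ((H.memLp_X hγ0 hγ η (k + 1)).sub
    (H.memLp_X hγ0 hγ η k))).const_mul (2 * c.beta * η ^ 2 * c.Lnode i ^ 2)
  rw [← integral_const_mul, ← integral_const_mul, ← integral_const_mul]
  refine (integral_mono_of_nonneg (ae_of_all _ fun _ => by positivity) ((hi1.add hi2).add hi3)
    (ae_of_all _ fun ω => ?_)).trans
    (le_of_eq ((integral_add (hi1.add hi2) hi3).trans (congrArg₂ _ (integral_add hi1 hi2) rfl)))
  have hX := H.X_mem hγ0 hγ η k ω
  have hX' := H.X_mem hγ0 hγ η (k + 1) ω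
  simp only [Pi.add_apply, Pi.sub_apply]
  set v := (traj pb c C ξ ζ X₀ γ η k ω).v i
  set g := (traj pb c C ξ ζ X₀ γ η k ω).g i
  set X := (traj pb c C ξ ζ X₀ γ η k ω).X
  set Y := (traj pb c C ξ ζ X₀ γ η (k + 1) ω).X
  set G := gradient (pb.local i)
  have hb := beta_pos H.valid
  have h1 := sq_mul_norm_add_sq_le (v - g) (η • (G Y - v)) (Real.sqrt_nonneg (1 - c.alpha))
    (sqrt_alpha_lt_one H.valid)
  rw [← beta_eq H.valid, Real.sq_sqrt hα, ← theta_eq, norm_smul, mul_pow, Real.norm_eq_abs,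
    sq_abs, norm_sub_rev v g] at h1
  have h2 : ‖G Y - v‖ ^ 2 ≤ 2 * ‖v - G X‖ ^ 2 + 2 * (c.Lnode i ^ 2 * ‖Y - X‖ ^ 2) := by
    have h3 := norm_add_sq_le_two (G X - v) (G Y - G X)
    rw [show G X - v + (G Y - G X) = G Y - v by abel, norm_sub_rev (G X) v] at h3
    have h4 : ‖G Y - G X‖ ^ 2 ≤ c.Lnode i ^ 2 * ‖Y - X‖ ^ 2 := by
      rw [← mul_pow]
      exact pow_le_pow_left₀ (norm_nonneg _) ((H.smooth i).2 Y hX' X hX) 2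
    linarith
  have h5 := mul_le_mul_of_nonneg_left h2 (by positivity : 0 ≤ c.beta * η ^ 2)
  linarith

end Setting

end Recursions

/-! ### The step size conditions -/

section StepSize

variable {N : ℕ} {c : Constants N}

lemma muLower_pos (hc : c.Valid) : 0 < c.muLower := by
  have := hc.eps_pos; have := hc.eps_lt; have := hc.lam_pos; have := hc.L_pos
  have := hc.Lgrad_pos
  have h1 : 0 < 3 - 4 * c.eps := by linarith
  have h2 : 0 < 1 - c.eps := by linarith
  unfold Constants.muLower
  positivity

lemma mu_pos (hc : c.Valid) : 0 < c.mu := (muLower_pos hc).trans_le hc.mu_ge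

lemma ell_pos (hc : c.Valid) : 0 < c.ell := by
  have := hc.lam_pos
  unfold Constants.ell
  split_ifs <;> positivity

lemma gammaSafe_pos (hc : c.Valid) : 0 < c.gammaSafe := by
  have := hc.eps_pos; have := hc.eps_lt; have := hc.lam_pos; have := hc.Lgrad_pos
  have h2 : 0 < 1 - c.eps := by linarith
  unfold Constants.gammaSafe
  refine lt_min (by positivity) (lt_min ?_ (by positivity))
  exact Real.sqrt_pos.2 (by positivity)

lemma stepSize_pos (hc : c.Valid) {η : ℝ} (hη : 0 < η) : 0 < c.stepSize η := by
  have := hc.eps_pos; have := hc.L_pos; have := hc.Lm_pos; have := hc.Ltil_pos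
  have := theta_pos hc; have := beta_pos hc; have := mu_pos hc; have := ell_pos hc
  have h1 : 0 < Real.sqrt (c.theta / (2 * 2 * c.beta)) := Real.sqrt_pos.2 (by positivity)
  have h2 : 0 < Real.sqrt (c.mu * c.theta / (2 * c.ell * (1 + c.eps) * c.beta)) :=
    Real.sqrt_pos.2 (by positivity)
  have h3 : 0 < Real.sqrt (c.mu / (2 * c.ell * (1 + c.eps))) := Real.sqrt_pos.2 (by positivity)
  have h4 : 0 < Real.sqrt (2 * 2) := Real.sqrt_pos.2 (by norm_num)
  unfold Constants.stepSize
  refine lt_min (gammaSafe_pos hc) (lt_min ?_ (lt_min ?_ (lt_min ?_ (lt_min ?_ (lt_min ?_ ?_)))))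
    <;> positivity

lemma sqrt_two_mul_two : Real.sqrt (2 * 2) = 2 := Real.sqrt_mul_self zero_le_two

/-- The seven conditions combined in the step size. -/
lemma stepSize_le (c : Constants N) (η : ℝ) :
    c.stepSize η ≤ c.gammaSafe ∧
    c.stepSize η ≤ 1 / (6 * c.Ltil) * Real.sqrt (c.theta / (4 * c.beta)) ∧
    c.stepSize η ≤ η / (12 * c.L) ∧
    c.stepSize η ≤ 1 / (6 * c.Lm) ∧
    c.stepSize η
      ≤ 1 / (12 * c.Ltil) * Real.sqrt (c.mu * c.theta / (2 * c.ell * (1 + c.eps) * c.beta)) ∧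
    c.stepSize η ≤ η / (12 * c.L) * Real.sqrt (c.mu / (2 * c.ell * (1 + c.eps))) ∧
    c.stepSize η ≤ c.mu / (12 * c.ell * (1 + c.eps) * c.Lm) := by
  have h : c.stepSize η ≤ c.stepSize η := le_rfl
  conv at h => rhs; unfold Constants.stepSize
  simp only [le_min_iff, sqrt_two_mul_two] at h
  obtain ⟨h1, h2, h3, h4, h5, h6, h7⟩ := h
  refine ⟨h1, ?_, ?_, h4, h5, h6, h7⟩
  · norm_num at h2 ⊢; exact h2
  · refine h3.trans (le_of_eq ?_)
    ring

/-- The weight of `‖X⁺ - X‖²` produced by the error recursions in the Lyapunov function. -/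
def driftWeight (c : Constants N) (η : ℝ) : ℝ :=
  4 * c.beta * c.Ltil ^ 2 / c.theta + 2 * c.L ^ 2 / η ^ 2

lemma sq_le_of_le_mul_sqrt {x a b : ℝ} (hx : 0 ≤ x) (hb : 0 ≤ b) (h : x ≤ a * Real.sqrt b) :
    x ^ 2 ≤ a ^ 2 * b := by
  calc x ^ 2 ≤ (a * Real.sqrt b) ^ 2 := pow_le_pow_left₀ hx h 2
    _ = a ^ 2 * b := by rw [mul_pow, Real.sq_sqrt hb]

/-- The weight of `‖Λ‖²` in the descent inequality is at most `1/8`. -/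
lemma stepSize_weight_le (hc : c.Valid) {η : ℝ} (hη : 0 < η) :
    c.Lm * c.stepSize η / 2 + c.stepSize η ^ 2 * driftWeight c η ≤ 1 / 8 := by
  obtain ⟨-, h2, h3, h4, -, -, -⟩ := stepSize_le c η
  have hγ := stepSize_pos hc hη
  have := hc.L_pos; have := hc.Lm_pos; have := hc.Ltil_pos
  have := theta_pos hc; have := beta_pos hc
  have e2 := sq_le_of_le_mul_sqrt hγ.le (by positivity) h2
  have e3 := pow_le_pow_left₀ hγ.le h3 2
  have f2 := mul_le_mul_of_nonneg_right e2
    (by positivity : 0 ≤ 4 * c.beta * c.Ltil ^ 2 / c.theta)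
  have f3 := mul_le_mul_of_nonneg_right e3 (by positivity : 0 ≤ 2 * c.L ^ 2 / η ^ 2)
  have f4 := mul_le_mul_of_nonneg_left h4 (by positivity : 0 ≤ c.Lm / 2)
  have g2 : (1 / (6 * c.Ltil)) ^ 2 * (c.theta / (4 * c.beta))
      * (4 * c.beta * c.Ltil ^ 2 / c.theta) = 1 / 36 := by field_simp; norm_num
  have g3 : (η / (12 * c.L)) ^ 2 * (2 * c.L ^ 2 / η ^ 2) = 1 / 72 := by field_simp; norm_num
  have g4 : c.Lm / 2 * (1 / (6 * c.Lm)) = 1 / 12 := by field_simp; norm_num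
  rw [g2] at f2; rw [g3] at f3; rw [g4] at f4
  rw [driftWeight, mul_add]
  linarith

lemma stepSize_weight_ell_le (hc : c.Valid) {η : ℝ} (hη : 0 < η) :
    c.Lm * c.stepSize η / 2 + c.stepSize η ^ 2 * driftWeight c η
      ≤ c.mu / (16 * c.ell * (1 + c.eps)) := by
  obtain ⟨-, -, -, -, h5, h6, h7⟩ := stepSize_le c η
  have hγ := stepSize_pos hc hη
  have := hc.eps_pos; have := hc.L_pos; have := hc.Lm_pos; have := hc.Ltil_pos
  have := theta_pos hc; have := beta_pos hc; have := mu_pos hc; have := ell_pos hc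
  have e5 := sq_le_of_le_mul_sqrt hγ.le (by positivity) h5
  have e6 := sq_le_of_le_mul_sqrt hγ.le (by positivity) h6
  have f5 := mul_le_mul_of_nonneg_right e5
    (by positivity : 0 ≤ 4 * c.beta * c.Ltil ^ 2 / c.theta)
  have f6 := mul_le_mul_of_nonneg_right e6 (by positivity : 0 ≤ 2 * c.L ^ 2 / η ^ 2)
  have f7 := mul_le_mul_of_nonneg_left h7 (by positivity : 0 ≤ c.Lm / 2)
  set u := c.mu / (16 * c.ell * (1 + c.eps)) with hu
  have g5 : (1 / (12 * c.Ltil)) ^ 2 * (c.mu * c.theta / (2 * c.ell * (1 + c.eps) * c.beta))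
      * (4 * c.beta * c.Ltil ^ 2 / c.theta) = 2 / 9 * u := by
    rw [hu]; field_simp; norm_num
  have g6 : (η / (12 * c.L)) ^ 2 * (c.mu / (2 * c.ell * (1 + c.eps))) * (2 * c.L ^ 2 / η ^ 2)
      = 1 / 9 * u := by
    rw [hu]; field_simp; norm_num
  have g7 : c.Lm / 2 * (c.mu / (12 * c.ell * (1 + c.eps) * c.Lm)) = 2 / 3 * u := by
    rw [hu]; field_simp; norm_num
  rw [g5] at f5; rw [g6] at f6; rw [g7] at f7
  rw [driftWeight, mul_add]
  linarith

/-- Either bound on a weight `κ`, according to the case in the definition of `ℓ`, controls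
`κ λ²` by `λ μ`. -/
lemma weight_mul_lam_sq_le (hc : c.Valid) {κ : ℝ} (h1 : κ ≤ 1 / 8)
    (h2 : κ ≤ c.mu / (16 * c.ell * (1 + c.eps))) :
    8 * (1 + c.eps) * (κ * c.lam ^ 2) ≤ c.lam * c.mu := by
  have := hc.eps_pos; have hlam := hc.lam_pos; have hmu := mu_pos hc; have := ell_pos hc
  rw [le_div_iff₀ (by positivity)] at h2
  unfold Constants.ell at h2
  split_ifs at h2 with hif
  · rcases hif with hif | hif
    · have : c.mu * 1 ≤ c.mu * (2 * c.lam) := by gcongr; linarith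
      linarith
    · have h3 := mul_le_mul_of_nonneg_right h1 (by positivity : 0 ≤ 8 * (1 + c.eps) * c.lam ^ 2)
      have h4 := mul_le_mul_of_nonneg_left hif hlam.le
      nlinarith
  · have h3 := mul_le_mul_of_nonneg_right h2 hlam.le
    have : 0 < c.lam * c.mu := by positivity
    nlinarith

end StepSize

/-! ### Decrease of the Lyapunov function -/

section Descent

variable {N n p : ℕ} {Ξ S Ω : Type*} [MeasurableSpace Ξ]

/-- Clipping is the projection onto a ball, hence does not increase the distance to its points. -/
lemma norm_clip_sub_le {B : ℝ} (g : Mat n p) {y : Mat n p} (hy : ‖y‖ ≤ B) :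
    ‖clip B g - y‖ ≤ ‖g - y‖ := by
  have hB : 0 ≤ B := (norm_nonneg y).trans hy
  rcases le_or_gt ‖g‖ B with h | h
  · have : clip B g = g := by
      rcases (norm_nonneg g).eq_or_lt with h0 | h0
      · rw [norm_eq_zero.1 h0.symm, clip, smul_zero]
      · rw [clip, min_eq_left ((one_le_div h0).2 h), one_smul]
    rw [this]
  · have h0 : 0 < ‖g‖ := hB.trans_lt h
    have hs1 : B / ‖g‖ ≤ 1 := (div_le_one h0).2 h.le
    have hsB : B / ‖g‖ * ‖g‖ = B := by field_simp
    rw [clip, min_eq_right hs1]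
    set s := B / ‖g‖
    refine le_of_sq_le_sq ?_ (norm_nonneg _)
    rw [norm_sub_sq_real, norm_sub_sq_real, norm_smul, mul_pow, Real.norm_eq_abs, sq_abs,
      inner_smul_left, conj_trivial]
    have h1 : inner ℝ g y ≤ ‖g‖ * (s * ‖g‖) := by
      rw [hsB]
      exact (real_inner_le_norm _ _).trans (by gcongr)
    have h2 := mul_le_mul_of_nonneg_left h1 (by linarith : 0 ≤ 1 - s)
    have h3 : 0 ≤ (1 - s) ^ 2 * ‖g‖ ^ 2 := by positivity
    nlinarith

lemma norm_average_sq_le (hN : 0 < N) (x : Fin N → Mat n p) :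
    ‖(1 / (N : ℝ)) • ∑ i, x i‖ ^ 2 ≤ (1 / (N : ℝ)) * ∑ i, ‖x i‖ ^ 2 := by
  have hN' : (0 : ℝ) < N := by exact_mod_cast hN
  have h1 : ‖∑ i, x i‖ ^ 2 ≤ N * ∑ i, ‖x i‖ ^ 2 := by
    refine (pow_le_pow_left₀ (norm_nonneg _) (norm_sum_le _ _) 2).trans ?_
    simpa using sq_sum_le_card_mul_sum_sq (s := Finset.univ) (f := fun i => ‖x i‖)
  rw [norm_smul, mul_pow, Real.norm_of_nonneg (by positivity)]
  calc (1 / (N : ℝ)) ^ 2 * ‖∑ i, x i‖ ^ 2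
      ≤ (1 / (N : ℝ)) ^ 2 * (N * ∑ i, ‖x i‖ ^ 2) := by gcongr
    _ = _ := by field_simp

variable {pb : Problem N n p Ξ} {c : Constants N} {C : S → Mat n p → Mat n p}
  {ξ : ℕ → Ω → Fin N → Ξ} {ζ : ℕ → Ω → Fin N → S} {X₀ : Mat n p} {γ : ℝ}

/-- The master's estimate is the average of the compressed gradients of the nodes. -/
lemma master_eq (η : ℝ) (k : ℕ) (ω : Ω) :
    (traj pb c C ξ ζ X₀ γ η k ω).master
      = (1 / (N : ℝ)) • ∑ i, (traj pb c C ξ ζ X₀ γ η k ω).g i := by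
  induction k with
  | zero => rfl
  | succ k ih =>
    have h : (traj pb c C ξ ζ X₀ γ η (k + 1) ω).master
        = (traj pb c C ξ ζ X₀ γ η k ω).master + (1 / (N : ℝ)) • ∑ i, C (ζ (k + 1) ω i)
        ((traj pb c C ξ ζ X₀ γ η (k + 1) ω).v i - (traj pb c C ξ ζ X₀ γ η k ω).g i) := rfl
    simp only [h, ih, g_succ, Finset.sum_add_distrib, smul_add]

/-- The error of the master's gradient estimate is controlled by the compression error and the
momentum error. -/
lemma master_error_le (hN : 0 < N) (η : ℝ) (k : ℕ) (ω : Ω) :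
    ‖(traj pb c C ξ ζ X₀ γ η k ω).master
        - gradient pb.obj (traj pb c C ξ ζ X₀ γ η k ω).X‖ ^ 2
      ≤ 2 * (traj pb c C ξ ζ X₀ γ η k ω).compErr
        + 2 * (traj pb c C ξ ζ X₀ γ η k ω).momErr pb := by
  rw [master_eq]
  set st := traj pb c C ξ ζ X₀ γ η k ω
  have h1 := norm_average_sq_le hN fun i => st.g i - st.v i
  have h2 := norm_add_sq_le_two ((1 / (N : ℝ)) • ∑ i, (st.g i - st.v i))
    ((1 / (N : ℝ)) • (∑ i, st.v i) - gradient pb.obj st.X)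
  rw [Finset.sum_sub_distrib, smul_sub, sub_add_sub_cancel, ← smul_sub,
    ← Finset.sum_sub_distrib] at h2
  rw [State.compErr, State.momErr]
  linarith

namespace Setting

variable [MeasurableSpace S] [MeasurableSpace Ω] {P : Measure Ω} {ν : Measure S}

/-- Decrease of the merit function in one iteration, up to the errors of the gradient
estimate. -/
lemma merit_descent (H : Setting P pb c ν C ξ ζ X₀) {η : ℝ} (hη : 0 < η) (k : ℕ) (ω : Ω) :
    merit pb.obj c.mu (traj pb c C ξ ζ X₀ (c.stepSize η) η (k + 1) ω).X
      + c.stepSize η * (1 / 4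
        * ‖riemGrad pb.obj (traj pb c C ξ ζ X₀ (c.stepSize η) η k ω).X‖ ^ 2
        + c.lam * c.mu / 2 * penalty (traj pb c C ξ ζ X₀ (c.stepSize η) η k ω).X)
      + c.stepSize η * driftWeight c η * ‖(traj pb c C ξ ζ X₀ (c.stepSize η) η (k + 1) ω).X
          - (traj pb c C ξ ζ X₀ (c.stepSize η) η k ω).X‖ ^ 2
      ≤ merit pb.obj c.mu (traj pb c C ξ ζ X₀ (c.stepSize η) η k ω).X
        + c.stepSize η * (2 * (traj pb c C ξ ζ X₀ (c.stepSize η) η k ω).compErr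
          + 2 * (traj pb c C ξ ζ X₀ (c.stepSize η) η k ω).momErr pb) := by
  have hc := H.valid
  have hγ := stepSize_pos hc hη
  have hγs := (stepSize_le c η).1
  have hX := H.X_mem hγ.le hγs η k ω
  have herr := master_error_le (γ := c.stepSize η) (pb := pb) (c := c) (C := C) (ξ := ξ) (ζ := ζ)
    (X₀ := X₀) H.nodes_pos η k ω
  have hnext : (traj pb c C ξ ζ X₀ (c.stepSize η) η (k + 1) ω).X
      = (traj pb c C ξ ζ X₀ (c.stepSize η) η k ω).X - c.stepSize η • landingDir c.lam
        (traj pb c C ξ ζ X₀ (c.stepSize η) η k ω).X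
        (clip c.Lgrad (traj pb c C ξ ζ X₀ (c.stepSize η) η k ω).master) := rfl
  rw [hnext]
  set γ := c.stepSize η
  set st := traj pb c C ξ ζ X₀ γ η k ω
  set g := clip c.Lgrad st.master with hg
  set V := landingDir c.lam st.X g with hV
  have hs : ∀ t, 0 ≤ t → t ≤ γ → st.X - t • V ∈ safeRegion n p c.eps := fun t ht0 ht =>
    H.landing_mem ht0 (ht.trans hγs) hX (norm_clip_le hc.Lgrad_pos.le _)
  have hδ : 0 < 3 - 4 * c.eps := by linarith [hc.eps_lt]
  have hmu : c.L * (1 - c.eps) + 3 * Real.sqrt (1 + c.eps) * c.Lgrad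
      + 2 * (max c.L c.Lgrad) ^ 2 * (1 + c.eps) / c.lam ≤ c.mu * ((3 - 4 * c.eps) / 2) := by
    have h := hc.mu_ge
    rw [Constants.muLower, div_mul_eq_mul_div, div_le_iff₀ hδ] at h
    linarith
  have hκ1 := stepSize_weight_le hc hη
  have hslope := landing_slope hc.eps_pos hc.eps_lt hc.lam_pos hc.L_pos.le hc.Lgrad_pos.le
    H.smoothOn_obj hX (H.smoothOn_merit.1 _ hX) (H.norm_gradient_obj_le hX) hmu hκ1
    (weight_mul_lam_sq_le hc hκ1 (stepSize_weight_ell_le hc hη)) g hγ hs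
  have hdesc := H.smoothOn_merit.le_of_segment hγ.le hs
  have hclip : ‖g - gradient pb.obj st.X‖ ^ 2 ≤ ‖st.master - gradient pb.obj st.X‖ ^ 2 :=
    pow_le_pow_left₀ (norm_nonneg _) (norm_clip_sub_le _ (H.norm_gradient_obj_le hX)) 2
  have hslope' := mul_le_mul_of_nonneg_left (hslope.trans (add_le_add_right (hclip.trans herr) _))
    hγ.le
  have hn : ‖st.X - γ • V - st.X‖ ^ 2 = γ ^ 2 * ‖V‖ ^ 2 := by
    rw [show st.X - γ • V - st.X = -(γ • V) by abel, norm_neg, norm_smul, mul_pow,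
      Real.norm_eq_abs, sq_abs]
  rw [hn]
  linarith

end Setting

end Descent

/-! ### The Lyapunov function in expectation -/

section Expectation

variable {N n p : ℕ} {Ξ S Ω : Type*} [MeasurableSpace Ξ] [MeasurableSpace S] [MeasurableSpace Ω]
  {P : Measure Ω} {pb : Problem N n p Ξ} {c : Constants N} {ν : Measure S}
  {C : S → Mat n p → Mat n p} {ξ : ℕ → Ω → Fin N → Ξ} {ζ : ℕ → Ω → Fin N → S} {X₀ : Mat n p}
  {γ : ℝ}

lemma Ltil_sq (c : Constants N) : c.Ltil ^ 2 = (1 / (N : ℝ)) * ∑ i, c.Lnode i ^ 2 := by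
  rw [Constants.Ltil, Real.sq_sqrt]
  positivity

lemma measurable_penalty : Measurable fun X : Mat n p => penalty X := by
  unfold penalty
  have h : Measurable fun X : Mat n p => defect X := continuous_defect.measurable
  exact (h.norm.pow_const 2).const_mul _

lemma measurable_riemGrad (f : Mat n p → ℝ) : Measurable fun X => riemGrad f X := by
  have h1 : Measurable fun q : Mat n p × Mat n p => skewGrad q.1 q.2 :=
    continuous_skewGrad.measurable
  have h2 : Measurable fun X : Mat n p => (gradient f X, X) :=
    (measurable_gradient f).prodMk measurable_id
  have h3 := h1.comp h2
  simp only [Function.comp_def] at h3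
  simpa only [riemGrad] using h3

lemma penalty_nonneg (X : Mat n p) : 0 ≤ penalty X := by
  unfold penalty; positivity

lemma compErr_nonneg (st : State N n p) : 0 ≤ st.compErr := by
  unfold State.compErr; positivity

lemma localMomErr_nonneg (pb : Problem N n p Ξ) (st : State N n p) : 0 ≤ st.localMomErr pb := by
  unfold State.localMomErr; positivity

lemma momErr_nonneg (pb : Problem N n p Ξ) (st : State N n p) : 0 ≤ st.momErr pb := by
  unfold State.momErr; positivity

lemma average_le {x y z : Fin N → ℝ} (hN : 0 < N) {a b d e : ℝ} {w : Fin N → ℝ}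
    (h : ∀ i, x i ≤ a * y i + b * z i + d * w i + e) :
    (1 / (N : ℝ)) * ∑ i, x i ≤ a * ((1 / (N : ℝ)) * ∑ i, y i) + b * ((1 / (N : ℝ)) * ∑ i, z i)
      + d * ((1 / (N : ℝ)) * ∑ i, w i) + e := by
  have hN' : (0 : ℝ) < N := by exact_mod_cast hN
  have h1 := mul_le_mul_of_nonneg_left (Finset.sum_le_sum fun i (_ : i ∈ Finset.univ) => h i)
    (by positivity : 0 ≤ 1 / (N : ℝ))
  refine h1.trans (le_of_eq ?_)
  simp only [Finset.sum_add_distrib, ← Finset.mul_sum, Finset.sum_const, Finset.card_univ,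
    Fintype.card_fin, nsmul_eq_mul]
  field_simp

/-- The constant added to the Lyapunov function by the gradient noise in one iteration, divided by
the step size. -/
def noiseLevel (c : Constants N) (η : ℝ) : ℝ :=
  2 * η * c.sigma ^ 2 / N + 2 * (1 - c.alpha) * η ^ 2 * c.sigma ^ 2 / c.theta
    + 4 * c.beta * η ^ 3 * c.sigma ^ 2 / c.theta

/-- The weights of the compression and momentum errors in the Lyapunov function are such that the
errors cancel; the coefficient of `Δ = 𝔼 ‖X⁺ - X‖²` is at most `driftWeight` since
`η² + (1 - η)² ≤ 1`. -/
lemma lyapunov_combination (hc : c.Valid) (hN : 0 < N) {η γ : ℝ} (hη0 : 0 < η) (hη1 : η ≤ 1)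
    (hγ : 0 ≤ γ) {m m' G G' Q Q' R R' Δ s : ℝ} (hΔ : 0 ≤ Δ)
    (hG : G' ≤ (1 - c.theta) * G + 2 * c.beta * η ^ 2 * Q
      + 2 * c.beta * η ^ 2 * Δ * c.Ltil ^ 2 + (1 - c.alpha) * η ^ 2 * c.sigma ^ 2)
    (hPt : Q' ≤ (1 - η) * Q + (1 - η) ^ 2 / η * Δ * c.Ltil ^ 2 + η ^ 2 * c.sigma ^ 2)
    (hP : R' ≤ (1 - η) * R + (1 - η) ^ 2 / η * c.L ^ 2 * Δ + η ^ 2 * (c.sigma ^ 2 / N))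
    (hm : m' + γ * s + γ * driftWeight c η * Δ ≤ m + γ * (2 * G + 2 * R)) :
    m' + 2 * γ / c.theta * G' + 2 * 2 * γ * η * c.beta / c.theta * Q' + 2 * γ / η * R' + γ * s
      ≤ m + 2 * γ / c.theta * G + 2 * 2 * γ * η * c.beta / c.theta * Q + 2 * γ / η * R
        + γ * noiseLevel c η := by
  have hθ := theta_pos hc
  have hβ := beta_pos hc
  have hN' : (0 : ℝ) < N := by exact_mod_cast hN
  have w1 := mul_le_mul_of_nonneg_left hG (by positivity : 0 ≤ 2 * γ / c.theta)
  have w2 := mul_le_mul_of_nonneg_left hPt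
    (by positivity : 0 ≤ 2 * 2 * γ * η * c.beta / c.theta)
  have w3 := mul_le_mul_of_nonneg_left hP (by positivity : 0 ≤ 2 * γ / η)
  have e1 : 2 * γ / c.theta * ((1 - c.theta) * G + 2 * c.beta * η ^ 2 * Q
      + 2 * c.beta * η ^ 2 * Δ * c.Ltil ^ 2 + (1 - c.alpha) * η ^ 2 * c.sigma ^ 2)
      = 2 * γ / c.theta * G - 2 * γ * G + 2 * 2 * γ * η ^ 2 * c.beta / c.theta * Q
        + γ * η ^ 2 * Δ * (4 * c.beta * c.Ltil ^ 2 / c.theta)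
        + γ * (2 * (1 - c.alpha) * η ^ 2 * c.sigma ^ 2 / c.theta) := by
    field_simp
    ring
  have e2 : 2 * 2 * γ * η * c.beta / c.theta * ((1 - η) * Q
      + (1 - η) ^ 2 / η * Δ * c.Ltil ^ 2 + η ^ 2 * c.sigma ^ 2)
      = 2 * 2 * γ * η * c.beta / c.theta * Q - 2 * 2 * γ * η ^ 2 * c.beta / c.theta * Q
        + γ * (1 - η) ^ 2 * Δ * (4 * c.beta * c.Ltil ^ 2 / c.theta)
        + γ * (4 * c.beta * η ^ 3 * c.sigma ^ 2 / c.theta) := by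
    field_simp
    ring
  have e3 : 2 * γ / η * ((1 - η) * R + (1 - η) ^ 2 / η * c.L ^ 2 * Δ
      + η ^ 2 * (c.sigma ^ 2 / N))
      = 2 * γ / η * R - 2 * γ * R + γ * (1 - η) ^ 2 * Δ * (2 * c.L ^ 2 / η ^ 2)
        + γ * (2 * η * c.sigma ^ 2 / N) := by
    field_simp
  rw [e1] at w1; rw [e2] at w2; rw [e3] at w3
  have hdrift : γ * η ^ 2 * Δ * (4 * c.beta * c.Ltil ^ 2 / c.theta)
      + γ * (1 - η) ^ 2 * Δ * (4 * c.beta * c.Ltil ^ 2 / c.theta)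
      + γ * (1 - η) ^ 2 * Δ * (2 * c.L ^ 2 / η ^ 2) ≤ γ * driftWeight c η * Δ := by
    have a1 : η ^ 2 + (1 - η) ^ 2 ≤ 1 := by nlinarith
    have a2 : (1 - η) ^ 2 ≤ 1 := by nlinarith
    have b1 := mul_le_mul_of_nonneg_right a1
      (by positivity : 0 ≤ γ * Δ * (4 * c.beta * c.Ltil ^ 2 / c.theta))
    have b2 := mul_le_mul_of_nonneg_right a2
      (by positivity : 0 ≤ γ * Δ * (2 * c.L ^ 2 / η ^ 2))
    rw [driftWeight]
    linarith
  rw [noiseLevel]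
  linarith

namespace Setting

lemma measurable_merit (H : Setting P pb c ν C ξ ζ X₀) : Measurable (merit pb.obj c.mu) := by
  have hf : Measurable pb.obj := by
    have : Differentiable ℝ pb.obj := by
      unfold Problem.obj
      exact (Differentiable.fun_sum fun i _ => (H.smooth i).1).const_mul _
    exact this.continuous.measurable
  have hh : Measurable fun X => meritCorrection pb.obj X := by
    simp only [meritCorrection_eq]
    exact ((measurable_gradient pb.obj).inner continuous_penaltyGrad.measurable).const_mul _
  exact (hf.sub hh).add (measurable_penalty.const_mul _)

lemma integral_lyapunov_nonneg (H : Setting P pb c ν C ξ ζ X₀) {η : ℝ} (hη0 : 0 < η) (k : ℕ) :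
    0 ≤ ∫ ω, lyapunov pb c (c.stepSize η) η (traj pb c C ξ ζ X₀ (c.stepSize η) η k ω) ∂P := by
  refine integral_nonneg fun ω => ?_
  have hγpos := stepSize_pos H.valid hη0
  have h1 := meritInf_le H.smoothOn_merit (H.X_mem hγpos.le (stepSize_le c η).1 η k ω)
  have := theta_pos H.valid
  have := beta_pos H.valid
  have h2 := compErr_nonneg (traj pb c C ξ ζ X₀ (c.stepSize η) η k ω)
  have h3 := localMomErr_nonneg pb (traj pb c C ξ ζ X₀ (c.stepSize η) η k ω)
  have h4 := momErr_nonneg pb (traj pb c C ξ ζ X₀ (c.stepSize η) η k ω)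
  have h5 := sub_nonneg.2 h1
  simp only [lyapunov, Pi.zero_apply]
  positivity

variable [IsProbabilityMeasure P]

lemma integrable_merit (H : Setting P pb c ν C ξ ζ X₀) (hγ0 : 0 ≤ γ) (hγ : γ ≤ c.gammaSafe)
    (η : ℝ) (k : ℕ) :
    Integrable (fun ω => merit pb.obj c.mu (traj pb c C ξ ζ X₀ γ η k ω).X) P := by
  obtain ⟨M, hM⟩ := isCompact_safeRegion.exists_bound_of_continuousOn
    H.smoothOn_merit.continuousOn
  exact Integrable.of_bound (H.measurable_merit.comp
    (H.measurable_X γ η k)).aestronglyMeasurable M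
    (ae_of_all _ fun ω => hM _ (H.X_mem hγ0 hγ η k ω))

lemma integrable_penalty (H : Setting P pb c ν C ξ ζ X₀) (hγ0 : 0 ≤ γ) (hγ : γ ≤ c.gammaSafe)
    (η : ℝ) (k : ℕ) :
    Integrable (fun ω => penalty (traj pb c C ξ ζ X₀ γ η k ω).X) P := by
  refine Integrable.of_bound (measurable_penalty.comp
    (H.measurable_X γ η k)).aestronglyMeasurable (1 / 4 * c.eps ^ 2) (ae_of_all _ fun ω => ?_)
  rw [Real.norm_of_nonneg (penalty_nonneg _), penalty]
  gcongr
  exact H.X_mem hγ0 hγ η k ω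

lemma integrable_riemGrad (H : Setting P pb c ν C ξ ζ X₀) (hγ0 : 0 ≤ γ) (hγ : γ ≤ c.gammaSafe)
    (η : ℝ) (k : ℕ) :
    Integrable (fun ω => ‖riemGrad pb.obj (traj pb c C ξ ζ X₀ γ η k ω).X‖ ^ 2) P := by
  have hm := measurable_riemGrad pb.obj
  have hm' : Measurable fun ω => ‖riemGrad pb.obj (traj pb c C ξ ζ X₀ γ η k ω).X‖ ^ 2 :=
    (hm.comp (H.measurable_X γ η k)).norm.pow_const 2
  refine Integrable.of_bound hm'.aestronglyMeasurable ((1 + c.eps) ^ 2 * c.Lgrad ^ 2)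
    (ae_of_all _ fun ω => ?_)
  rw [Real.norm_of_nonneg (by positivity)]
  have hX := H.X_mem hγ0 hγ η k ω
  refine (norm_skewGrad_le hX (gradient pb.obj _)).trans ?_
  exact mul_le_mul_of_nonneg_left
    (pow_le_pow_left₀ (norm_nonneg _) (H.norm_gradient_obj_le hX) 2) (sq_nonneg _)

lemma integrable_step (H : Setting P pb c ν C ξ ζ X₀) (hγ0 : 0 ≤ γ) (hγ : γ ≤ c.gammaSafe)
    (η : ℝ) (k : ℕ) :
    Integrable (fun ω => ‖(traj pb c C ξ ζ X₀ γ η (k + 1) ω).X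
      - (traj pb c C ξ ζ X₀ γ η k ω).X‖ ^ 2) P :=
  integrable_norm_sq ((H.memLp_X hγ0 hγ η (k + 1)).sub (H.memLp_X hγ0 hγ η k))

lemma integrable_compErr_node (H : Setting P pb c ν C ξ ζ X₀) (hγ0 : 0 ≤ γ)
    (hγ : γ ≤ c.gammaSafe) (η : ℝ) (k : ℕ) (i : Fin N) :
    Integrable (fun ω => ‖(traj pb c C ξ ζ X₀ γ η k ω).g i
      - (traj pb c C ξ ζ X₀ γ η k ω).v i‖ ^ 2) P :=
  integrable_norm_sq ((H.memLp_v_g hγ0 hγ η k i).2.sub (H.memLp_v_g hγ0 hγ η k i).1)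

lemma integrable_momErr_node (H : Setting P pb c ν C ξ ζ X₀) (hγ0 : 0 ≤ γ)
    (hγ : γ ≤ c.gammaSafe) (η : ℝ) (k : ℕ) (i : Fin N) :
    Integrable (fun ω => ‖(traj pb c C ξ ζ X₀ γ η k ω).v i
      - gradient (pb.local i) (traj pb c C ξ ζ X₀ γ η k ω).X‖ ^ 2) P :=
  integrable_norm_sq ((H.memLp_v_g hγ0 hγ η k i).1.sub (H.memLp_gradient_local hγ0 hγ η k i))

lemma integrable_compErr (H : Setting P pb c ν C ξ ζ X₀) (hγ0 : 0 ≤ γ)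
    (hγ : γ ≤ c.gammaSafe) (η : ℝ) (k : ℕ) :
    Integrable (fun ω => (traj pb c C ξ ζ X₀ γ η k ω).compErr) P :=
  (integrable_finsetSum _ fun i _ => H.integrable_compErr_node hγ0 hγ η k i).const_mul _

lemma integrable_localMomErr (H : Setting P pb c ν C ξ ζ X₀) (hγ0 : 0 ≤ γ)
    (hγ : γ ≤ c.gammaSafe) (η : ℝ) (k : ℕ) :
    Integrable (fun ω => (traj pb c C ξ ζ X₀ γ η k ω).localMomErr pb) P :=
  (integrable_finsetSum _ fun i _ => H.integrable_momErr_node hγ0 hγ η k i).const_mul _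

lemma integrable_momErr (H : Setting P pb c ν C ξ ζ X₀) (hγ0 : 0 ≤ γ)
    (hγ : γ ≤ c.gammaSafe) (η : ℝ) (k : ℕ) :
    Integrable (fun ω => (traj pb c C ξ ζ X₀ γ η k ω).momErr pb) P :=
  integrable_norm_sq ((H.memLp_average hγ0 hγ η k).sub (H.memLp_gradient_obj hγ0 hγ η k))

lemma compErr_step (H : Setting P pb c ν C ξ ζ X₀) (hγ0 : 0 ≤ γ) (hγ : γ ≤ c.gammaSafe)
    (η : ℝ) (k : ℕ) :
    ∫ ω, (traj pb c C ξ ζ X₀ γ η (k + 1) ω).compErr ∂P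
      ≤ (1 - c.theta) * ∫ ω, (traj pb c C ξ ζ X₀ γ η k ω).compErr ∂P
        + 2 * c.beta * η ^ 2 * ∫ ω, (traj pb c C ξ ζ X₀ γ η k ω).localMomErr pb ∂P
        + 2 * c.beta * η ^ 2 * (∫ ω, ‖(traj pb c C ξ ζ X₀ γ η (k + 1) ω).X
          - (traj pb c C ξ ζ X₀ γ η k ω).X‖ ^ 2 ∂P) * c.Ltil ^ 2
        + (1 - c.alpha) * η ^ 2 * c.sigma ^ 2 := by
  simp only [State.compErr, State.localMomErr]
  rw [integral_const_mul, integral_const_mul, integral_const_mul,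
    integral_finsetSum _ fun i _ => H.integrable_compErr_node hγ0 hγ η (k + 1) i,
    integral_finsetSum _ fun i _ => H.integrable_compErr_node hγ0 hγ η k i,
    integral_finsetSum _ fun i _ => H.integrable_momErr_node hγ0 hγ η k i, Ltil_sq]
  refine average_le H.nodes_pos fun i => ?_
  have := H.compression_step hγ0 hγ η k i
  linarith

lemma localMomErr_step (H : Setting P pb c ν C ξ ζ X₀) (hγ0 : 0 ≤ γ) (hγ : γ ≤ c.gammaSafe)
    {η : ℝ} (hη0 : 0 < η) (hη1 : η ≤ 1) (k : ℕ) :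
    ∫ ω, (traj pb c C ξ ζ X₀ γ η (k + 1) ω).localMomErr pb ∂P
      ≤ (1 - η) * ∫ ω, (traj pb c C ξ ζ X₀ γ η k ω).localMomErr pb ∂P
        + (1 - η) ^ 2 / η * (∫ ω, ‖(traj pb c C ξ ζ X₀ γ η (k + 1) ω).X
          - (traj pb c C ξ ζ X₀ γ η k ω).X‖ ^ 2 ∂P) * c.Ltil ^ 2
        + η ^ 2 * c.sigma ^ 2 := by
  simp only [State.localMomErr]
  rw [integral_const_mul, integral_const_mul,
    integral_finsetSum _ fun i _ => H.integrable_momErr_node hγ0 hγ η (k + 1) i,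
    integral_finsetSum _ fun i _ => H.integrable_momErr_node hγ0 hγ η k i, Ltil_sq]
  have h := average_le (N := N) H.nodes_pos (x := fun i =>
    ∫ ω, ‖(traj pb c C ξ ζ X₀ γ η (k + 1) ω).v i
        - gradient (pb.local i) (traj pb c C ξ ζ X₀ γ η (k + 1) ω).X‖ ^ 2 ∂P)
    (y := fun i => ∫ ω, ‖(traj pb c C ξ ζ X₀ γ η k ω).v i
          - gradient (pb.local i) (traj pb c C ξ ζ X₀ γ η k ω).X‖ ^ 2 ∂P)
    (z := fun _ => 0) (a := 1 - η) (b := 0) (w := fun i => c.Lnode i ^ 2)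
    (d := (1 - η) ^ 2 / η * (∫ ω, ‖(traj pb c C ξ ζ X₀ γ η (k + 1) ω).X
          - (traj pb c C ξ ζ X₀ γ η k ω).X‖ ^ 2 ∂P)) (e := η ^ 2 * c.sigma ^ 2)
    (fun i => by have := H.momentum_node_step hγ0 hγ hη0 hη1 k i; linarith)
  simpa using h

lemma integral_merit_add_errors (H : Setting P pb c ν C ξ ζ X₀) (hγ0 : 0 ≤ γ)
    (hγ : γ ≤ c.gammaSafe) (η : ℝ) (k : ℕ) (a b d : ℝ) :
    ∫ ω, (merit pb.obj c.mu (traj pb c C ξ ζ X₀ γ η k ω).X - meritInf pb.obj c.mu c.eps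
        + a * (traj pb c C ξ ζ X₀ γ η k ω).compErr
        + b * (traj pb c C ξ ζ X₀ γ η k ω).localMomErr pb
        + d * (traj pb c C ξ ζ X₀ γ η k ω).momErr pb) ∂P
      = ∫ ω, merit pb.obj c.mu (traj pb c C ξ ζ X₀ γ η k ω).X ∂P - meritInf pb.obj c.mu c.eps
        + a * ∫ ω, (traj pb c C ξ ζ X₀ γ η k ω).compErr ∂P
        + b * ∫ ω, (traj pb c C ξ ζ X₀ γ η k ω).localMomErr pb ∂P
        + d * ∫ ω, (traj pb c C ξ ζ X₀ γ η k ω).momErr pb ∂P := by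
  have h1 := H.integrable_merit hγ0 hγ η k
  have h2 := (H.integrable_compErr hγ0 hγ η k).const_mul a
  have h3 := (H.integrable_localMomErr hγ0 hγ η k).const_mul b
  have h4 := (H.integrable_momErr hγ0 hγ η k).const_mul d
  have h0 := h1.sub (integrable_const (meritInf pb.obj c.mu c.eps))
  refine (integral_add ((h0.add h2).add h3) h4).trans ?_
  rw [integral_const_mul]
  congr 1
  refine (integral_add (h0.add h2) h3).trans ?_
  rw [integral_const_mul]
  congr 1
  refine (integral_add h0 h2).trans ?_
  rw [integral_const_mul]
  congr 1
  refine (integral_sub h1 (integrable_const _)).trans ?_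
  simp

lemma integral_lyapunov (H : Setting P pb c ν C ξ ζ X₀) (hγ0 : 0 ≤ γ)
    (hγ : γ ≤ c.gammaSafe) (η : ℝ) (k : ℕ) (γ' : ℝ) :
    ∫ ω, lyapunov pb c γ' η (traj pb c C ξ ζ X₀ γ η k ω) ∂P
      = ∫ ω, merit pb.obj c.mu (traj pb c C ξ ζ X₀ γ η k ω).X ∂P - meritInf pb.obj c.mu c.eps
        + 2 * γ' / c.theta * ∫ ω, (traj pb c C ξ ζ X₀ γ η k ω).compErr ∂P
        + 2 * 2 * γ' * η * c.beta / c.theta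
          * ∫ ω, (traj pb c C ξ ζ X₀ γ η k ω).localMomErr pb ∂P
        + 2 * γ' / η * ∫ ω, (traj pb c C ξ ζ X₀ γ η k ω).momErr pb ∂P :=
  H.integral_merit_add_errors hγ0 hγ η k _ _ _

/-- Expected decrease of the Lyapunov function in one iteration. -/
lemma lyapunov_step (H : Setting P pb c ν C ξ ζ X₀) {η : ℝ} (hη0 : 0 < η) (hη1 : η ≤ 1) (k : ℕ) :
    ∫ ω, lyapunov pb c (c.stepSize η) η (traj pb c C ξ ζ X₀ (c.stepSize η) η (k + 1) ω) ∂P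
      + c.stepSize η *
        (1 / 4 * ∫ ω, ‖riemGrad pb.obj (traj pb c C ξ ζ X₀ (c.stepSize η) η k ω).X‖ ^ 2 ∂P
        + c.lam * c.mu / 2 * ∫ ω, penalty (traj pb c C ξ ζ X₀ (c.stepSize η) η k ω).X ∂P)
      ≤ ∫ ω, lyapunov pb c (c.stepSize η) η (traj pb c C ξ ζ X₀ (c.stepSize η) η k ω) ∂P
        + c.stepSize η * noiseLevel c η := by
  have hc := H.valid
  have hγpos := stepSize_pos hc hη0
  have hγ := (stepSize_le c η).1
  have hd := H.merit_descent hη0 k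
  rw [H.integral_lyapunov hγpos.le hγ, H.integral_lyapunov hγpos.le hγ]
  have hG := H.compErr_step hγpos.le hγ η k
  have hPt := H.localMomErr_step hγpos.le hγ hη0 hη1 k
  have hP := H.momentum_average_step hγpos.le hγ hη0 hη1 k
  have i1 := H.integrable_merit hγpos.le hγ η (k + 1)
  have i2 := (H.integrable_riemGrad hγpos.le hγ η k).const_mul (1 / 4)
  have i3 := (H.integrable_penalty hγpos.le hγ η k).const_mul (c.lam * c.mu / 2)
  have i23 := (i2.add i3).const_mul (c.stepSize η)
  have i4 := (H.integrable_step hγpos.le hγ η k).const_mul (c.stepSize η * driftWeight c η)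
  have i5 := H.integrable_merit hγpos.le hγ η k
  have i6 := (H.integrable_compErr hγpos.le hγ η k).const_mul 2
  have i7 := (H.integrable_momErr hγpos.le hγ η k).const_mul 2
  have i67 := (i6.add i7).const_mul (c.stepSize η)
  have hmono := integral_mono ((i1.add i23).add i4) (i5.add i67) hd
  have hΔ : 0 ≤ ∫ ω, ‖(traj pb c C ξ ζ X₀ (c.stepSize η) η (k + 1) ω).X
      - (traj pb c C ξ ζ X₀ (c.stepSize η) η k ω).X‖ ^ 2 ∂P :=
    integral_nonneg fun ω => by positivity
  rw [integral_add' (i1.add i23) i4, integral_add' i1 i23, integral_add' i5 i67,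
    integral_const_mul, integral_const_mul, integral_const_mul, integral_add' i2 i3,
    integral_add' i6 i7, integral_const_mul, integral_const_mul, integral_const_mul,
    integral_const_mul] at hmono
  have := lyapunov_combination hc H.nodes_pos hη0 hη1 hγpos.le hΔ hG hPt hP hmono
  linarith

/-- The averaged stationarity measure after `K` iterations. -/
lemma average_stationarity_le (H : Setting P pb c ν C ξ ζ X₀) {η : ℝ} (hη0 : 0 < η) (hη1 : η ≤ 1)
    {K : ℕ} (hK : 0 < K) :
    1 / 4 * (1 / (K : ℝ) * ∑ k ∈ Finset.range K,
        ∫ ω, ‖riemGrad pb.obj (traj pb c C ξ ζ X₀ (c.stepSize η) η k ω).X‖ ^ 2 ∂P)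
      + c.lam * c.mu / 2 * (1 / (K : ℝ) * ∑ k ∈ Finset.range K,
        ∫ ω, penalty (traj pb c C ξ ζ X₀ (c.stepSize η) η k ω).X ∂P)
      ≤ (∫ ω, lyapunov pb c (c.stepSize η) η (traj pb c C ξ ζ X₀ (c.stepSize η) η 0 ω) ∂P)
        / (c.stepSize η * K) + noiseLevel c η := by
  have hγ := stepSize_pos H.valid hη0
  set Λ : ℕ → ℝ := fun k =>
    ∫ ω, lyapunov pb c (c.stepSize η) η (traj pb c C ξ ζ X₀ (c.stepSize η) η k ω) ∂P with hΛ
  set r : ℕ → ℝ := fun k =>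
    ∫ ω, ‖riemGrad pb.obj (traj pb c C ξ ζ X₀ (c.stepSize η) η k ω).X‖ ^ 2 ∂P with hr
  set q : ℕ → ℝ := fun k =>
    ∫ ω, penalty (traj pb c C ξ ζ X₀ (c.stepSize η) η k ω).X ∂P with hq
  have hstep : ∀ k, Λ (k + 1) + c.stepSize η * (1 / 4 * r k + c.lam * c.mu / 2 * q k)
      ≤ Λ k + c.stepSize η * noiseLevel c η := fun k => H.lyapunov_step hη0 hη1 k
  have hsum : ∀ K : ℕ, Λ K + c.stepSize η * (1 / 4 * ∑ k ∈ Finset.range K, r k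
      + c.lam * c.mu / 2 * ∑ k ∈ Finset.range K, q k)
      ≤ Λ 0 + K * (c.stepSize η * noiseLevel c η) := by
    intro K
    induction K with
    | zero => simp
    | succ K ih =>
      rw [Finset.sum_range_succ, Finset.sum_range_succ]
      push_cast
      linarith [hstep K]
  have hK' : (0 : ℝ) < K := by exact_mod_cast hK
  have h1 := hsum K
  have h2 : 0 ≤ Λ K := H.integral_lyapunov_nonneg hη0 K
  have e : Λ 0 / (c.stepSize η * K) + noiseLevel c η
      = (Λ 0 + K * (c.stepSize η * noiseLevel c η)) / (c.stepSize η * K) := by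
    field_simp
  change _ ≤ Λ 0 / (c.stepSize η * K) + noiseLevel c η
  rw [e, le_div_iff₀ (by positivity)]
  have e' : (1 / 4 * (1 / (K : ℝ) * ∑ k ∈ Finset.range K, r k)
      + c.lam * c.mu / 2 * (1 / (K : ℝ) * ∑ k ∈ Finset.range K, q k)) * (c.stepSize η * K)
      = c.stepSize η * (1 / 4 * ∑ k ∈ Finset.range K, r k
        + c.lam * c.mu / 2 * ∑ k ∈ Finset.range K, q k) := by
    field_simp
  rw [e']
  linarith

end Setting

end Expectation

/-! ### The rate and the momentum equation -/

section Rate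

variable {N : ℕ} {c : Constants N}

lemma C1_pos (hc : c.Valid) : 0 < c.C1 := by
  have := hc.eps_pos; have := hc.Lm_pos; have := hc.Ltil_pos
  have := mu_pos hc; have := ell_pos hc; have := gammaSafe_pos hc
  unfold Constants.C1
  positivity

lemma C2_pos (hc : c.Valid) : 0 < c.C2 := by
  have := hc.L_pos
  unfold Constants.C2
  positivity

lemma sqrt_mul_sqrt_inv {a b : ℝ} (ha : 0 ≤ a) (h : a * b = 1) :
    Real.sqrt a * Real.sqrt b = 1 := by
  rw [← Real.sqrt_mul ha, h, Real.sqrt_one]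

/-- Each of the seven reciprocals is a summand of `C₁ + C₂ / η`. -/
lemma one_div_stepSize_le (hc : c.Valid) {η : ℝ} (hη : 0 < η) :
    1 / c.stepSize η ≤ c.C1 + c.C2 / η := by
  have := hc.eps_pos; have := hc.L_pos; have := hc.Lm_pos; have := hc.Ltil_pos
  have := theta_pos hc; have := beta_pos hc; have := mu_pos hc; have := ell_pos hc
  have hγs := gammaSafe_pos hc
  have hw : 0 < c.C1 + c.C2 / η := add_pos (C1_pos hc) (div_pos (C2_pos hc) hη)
  have hC2 : c.C2 / η = 12 * c.L / η
      + 12 * c.L / η * Real.sqrt (2 * c.ell * (1 + c.eps) / c.mu) := by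
    unfold Constants.C2; field_simp
  have a1 : 0 < 1 / c.gammaSafe := by positivity
  have a2 : 0 ≤ 12 * c.Ltil * Real.sqrt (c.beta / c.theta) := by positivity
  have a3 : 0 < 12 * c.L / η := by positivity
  have a4 : 0 < 6 * c.Lm := by positivity
  have a5 : 0 ≤ 12 * c.Ltil * Real.sqrt (2 * c.ell * (1 + c.eps) * c.beta / (c.mu * c.theta)) := by
    positivity
  have a6 : 0 ≤ 12 * c.L / η * Real.sqrt (2 * c.ell * (1 + c.eps) / c.mu) := by positivity
  have a7 : 0 < 12 * c.ell * (1 + c.eps) * c.Lm / c.mu := by positivity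
  have key : ∀ t s : ℝ, 0 ≤ t → t * s = 1 → s ≤ c.C1 + c.C2 / η → 1 / (c.C1 + c.C2 / η) ≤ t := by
    intro t s ht hts hs
    rw [div_le_iff₀ hw, ← hts]
    exact mul_le_mul_of_nonneg_left hs ht
  rw [one_div_le (stepSize_pos hc hη) hw]
  have hC1 : c.C1 = 1 / c.gammaSafe + 6 * c.Lm + 12 * c.ell * (1 + c.eps) * c.Lm / c.mu
    + 12 * c.Ltil * Real.sqrt (c.beta / c.theta)
    + 12 * c.Ltil * Real.sqrt (2 * c.ell * (1 + c.eps) * c.beta / (c.mu * c.theta)) := rfl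
  unfold Constants.stepSize
  rw [sqrt_two_mul_two]
  refine le_min ?_ (le_min ?_ (le_min ?_ (le_min ?_ (le_min ?_ (le_min ?_ ?_)))))
  · exact key _ (1 / c.gammaSafe) hγs.le (by field_simp) (by linarith)
  · refine key _ (12 * c.Ltil * Real.sqrt (c.beta / c.theta)) (by positivity) ?_ (by linarith)
    have h4 : Real.sqrt (c.theta / c.beta) * Real.sqrt (c.beta / c.theta) = 1 :=
      sqrt_mul_sqrt_inv (by positivity) (by field_simp)
    have h5 : Real.sqrt (c.theta / (2 * 2 * c.beta)) = Real.sqrt (c.theta / c.beta) / 2 := by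
      rw [mul_comm (2 * 2 : ℝ), ← div_div, Real.sqrt_div (by positivity), sqrt_two_mul_two]
    rw [h5]
    calc _ = Real.sqrt (c.theta / c.beta) * Real.sqrt (c.beta / c.theta) := by field_simp; norm_num
      _ = 1 := h4
  · exact key _ (12 * c.L / η) (by positivity) (by field_simp; norm_num) (by linarith)
  · exact key _ (6 * c.Lm) (by positivity) (by field_simp) (by linarith)
  · refine key _ _ (by positivity) ?_ (by linarith :
      12 * c.Ltil * Real.sqrt (2 * c.ell * (1 + c.eps) * c.beta / (c.mu * c.theta)) ≤ _)
    calc _ = Real.sqrt (c.mu * c.theta / (2 * c.ell * (1 + c.eps) * c.beta))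
          * Real.sqrt (2 * c.ell * (1 + c.eps) * c.beta / (c.mu * c.theta)) := by field_simp
      _ = 1 := sqrt_mul_sqrt_inv (by positivity) (by field_simp)
  · refine key _ _ (by positivity) ?_ (by linarith :
      12 * c.L / η * Real.sqrt (2 * c.ell * (1 + c.eps) / c.mu) ≤ _)
    calc _ = Real.sqrt (c.mu / (2 * c.ell * (1 + c.eps)))
          * Real.sqrt (2 * c.ell * (1 + c.eps) / c.mu) := by field_simp
      _ = 1 := sqrt_mul_sqrt_inv (by positivity) (by field_simp)
  · exact key _ (12 * c.ell * (1 + c.eps) * c.Lm / c.mu) (by positivity) (by field_simp)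
      (by linarith)

/-- The momentum `(A / a)^s` balances `A / η` and `a ηⁱ`. -/
lemma power_balance {a A s t : ℝ} (ha : 0 < a) (hA : 0 < A) (hst : s + t = 1) (i : ℕ)
    (hi : s * i = t) :
    A / (A / a) ^ s = a ^ s * A ^ t ∧ a * ((A / a) ^ s) ^ i = a ^ s * A ^ t := by
  have hA1 : A = A ^ s * A ^ t := by rw [← Real.rpow_add hA, hst, Real.rpow_one]
  have ha1 : a = a ^ s * a ^ t := by rw [← Real.rpow_add ha, hst, Real.rpow_one]
  have p1 := Real.rpow_pos_of_pos hA s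
  have p2 := Real.rpow_pos_of_pos ha s
  have p3 := Real.rpow_pos_of_pos ha t
  constructor
  · rw [Real.div_rpow hA.le ha.le]
    nth_rewrite 1 [hA1]
    field_simp
  · rw [← Real.rpow_natCast, ← Real.rpow_mul (by positivity), hi, Real.div_rpow hA.le ha.le]
    nth_rewrite 1 [ha1]
    field_simp

/-- With momentum equal to the minimum of the three balancing values, the Lyapunov bound is at most
the rate. -/
lemma le_rate_of_eq_momentum (hN : 0 < N) (hc : c.Valid) {K : ℕ} (hK : 0 < K) {Λ η : ℝ}
    (hΛ : 0 < Λ) (hη : 0 < η) (h : η = c.momentum K Λ) :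
    Λ / (c.stepSize η * K) + noiseLevel c η ≤ c.rate N K Λ := by
  have hN' : (0 : ℝ) < N := by exact_mod_cast hN
  have hK' : (0 : ℝ) < K := by exact_mod_cast hK
  have hσ := hc.sigma_pos
  have hθ := theta_pos hc
  have hβ := beta_pos hc
  have hα : 0 < 1 - c.alpha := by linarith [hc.alpha_lt]
  have hC2 := C2_pos hc
  set A := c.C2 * Λ / K with hA
  have hApos : 0 < A := by positivity
  set a1 := 2 * c.sigma ^ 2 / N with ha1
  set a2 := 2 * c.sigma ^ 2 * (1 - c.alpha) / c.theta with ha2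
  set a3 := 4 * c.beta * c.sigma ^ 2 / c.theta with ha3
  obtain ⟨b1, d1⟩ := power_balance (a := a1) (s := 1 / 2) (t := 1 / 2) (by positivity) hApos
    (by norm_num) 1 (by norm_num)
  obtain ⟨b2, d2⟩ := power_balance (a := a2) (s := 1 / 3) (t := 2 / 3) (by positivity) hApos
    (by norm_num) 2 (by norm_num)
  obtain ⟨b3, d3⟩ := power_balance (a := a3) (s := 1 / 4) (t := 3 / 4) (by positivity) hApos
    (by norm_num) 3 (by norm_num)
  have hmom : c.momentum K Λ = min ((A / a1) ^ (1 / 2 : ℝ))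
      (min ((A / a2) ^ (1 / 3 : ℝ)) ((A / a3) ^ (1 / 4 : ℝ))) := by
    unfold Constants.momentum
    congr 2
    · rw [hA, ha1]; field_simp
    · congr 1; rw [hA, ha2]; field_simp
    · congr 1; rw [hA, ha3]; field_simp
  have hrate : c.rate N K Λ = c.C1 * Λ / K + 4 * (a1 ^ (1 / 2 : ℝ) * A ^ (1 / 2 : ℝ))
      + 4 * (a2 ^ (1 / 3 : ℝ) * A ^ (2 / 3 : ℝ)) + 4 * (a3 ^ (1 / 4 : ℝ) * A ^ (3 / 4 : ℝ)) := by
    unfold Constants.rate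
    rw [← Real.mul_rpow (by positivity) hApos.le,
      show 2 * c.sigma ^ 2 * c.C2 * Λ / (N * K) = a1 * A by rw [hA, ha1]; field_simp]
    ring
  rw [hmom] at h
  have T1 : 0 < a1 ^ (1 / 2 : ℝ) * A ^ (1 / 2 : ℝ) := by positivity
  have T2 : 0 < a2 ^ (1 / 3 : ℝ) * A ^ (2 / 3 : ℝ) := by positivity
  have T3 : 0 < a3 ^ (1 / 4 : ℝ) * A ^ (3 / 4 : ℝ) := by positivity
  have h1 : η ≤ (A / a1) ^ (1 / 2 : ℝ) := h.trans_le (min_le_left _ _)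
  have h2 : η ≤ (A / a2) ^ (1 / 3 : ℝ) := h.trans_le ((min_le_right _ _).trans (min_le_left _ _))
  have h3 : η ≤ (A / a3) ^ (1 / 4 : ℝ) := h.trans_le ((min_le_right _ _).trans (min_le_right _ _))
  have n1 : a1 * η ^ 1 ≤ a1 ^ (1 / 2 : ℝ) * A ^ (1 / 2 : ℝ) := by
    rw [← d1]; gcongr
  have n2 : a2 * η ^ 2 ≤ a2 ^ (1 / 3 : ℝ) * A ^ (2 / 3 : ℝ) := by
    rw [← d2]; gcongr
  have n3 : a3 * η ^ 3 ≤ a3 ^ (1 / 4 : ℝ) * A ^ (3 / 4 : ℝ) := by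
    rw [← d3]; gcongr
  have hnoise : noiseLevel c η = a1 * η ^ 1 + a2 * η ^ 2 + a3 * η ^ 3 := by
    rw [noiseLevel, ha1, ha2, ha3]; ring
  have hAη : A / η ≤ a1 ^ (1 / 2 : ℝ) * A ^ (1 / 2 : ℝ) + a2 ^ (1 / 3 : ℝ) * A ^ (2 / 3 : ℝ)
      + a3 ^ (1 / 4 : ℝ) * A ^ (3 / 4 : ℝ) := by
    rcases min_choice ((A / a1) ^ (1 / 2 : ℝ))
      (min ((A / a2) ^ (1 / 3 : ℝ)) ((A / a3) ^ (1 / 4 : ℝ))) with e | e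
    · rw [h, e, b1]; linarith
    · rcases min_choice ((A / a2) ^ (1 / 3 : ℝ)) ((A / a3) ^ (1 / 4 : ℝ)) with e' | e'
      · rw [h, e, e', b2]; linarith
      · rw [h, e, e', b3]; linarith
  have hmain : Λ / (c.stepSize η * K) ≤ c.C1 * Λ / K + A / η := by
    have := mul_le_mul_of_nonneg_left (one_div_stepSize_le hc hη)
      (by positivity : 0 ≤ Λ / K)
    have hγ := stepSize_pos hc hη
    calc Λ / (c.stepSize η * K) = Λ / K * (1 / c.stepSize η) := by field_simp
      _ ≤ Λ / K * (c.C1 + c.C2 / η) := this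
      _ = c.C1 * Λ / K + A / η := by rw [hA]; field_simp
  rw [hrate, hnoise]
  linarith

/-- For `K ≥ N³` every term of the rate is at most of order `(N K)^{-1/2}`. -/
lemma rate_le_of_cube_le (hN : 0 < N) (hc : c.Valid) {K : ℕ} (hK : N ^ 3 ≤ K) {Λ Λ' : ℝ}
    (hΛ : 0 ≤ Λ) (hΛ' : Λ ≤ Λ') : c.rate N K Λ ≤ c.rate 1 1 Λ' / Real.sqrt (N * K) := by
  have hN' : (1 : ℝ) ≤ N := by exact_mod_cast hN
  have hKN : (N : ℝ) ^ 3 ≤ K := by exact_mod_cast hK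
  have hK1 : (1 : ℝ) ≤ K := (one_le_pow₀ hN').trans hKN
  have hK0 : (0 : ℝ) < K := by linarith
  have hN0 : (0 : ℝ) < N := by linarith
  have hσ := hc.sigma_pos
  have hθ := theta_pos hc
  have hβ := beta_pos hc
  have hα : 0 < 1 - c.alpha := by linarith [hc.alpha_lt]
  have hC1 := C1_pos hc
  have hC2 := C2_pos hc
  have hs : 0 < Real.sqrt (N * K) := Real.sqrt_pos.2 (by positivity)
  have hΛ0 : 0 ≤ Λ' := hΛ.trans hΛ'
  have r23 : Real.sqrt (N * K) ≤ (K : ℝ) ^ (2 / 3 : ℝ) := by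
    refine Real.sqrt_le_iff.2 ⟨by positivity, ?_⟩
    have h1 : (N : ℝ) ≤ (K : ℝ) ^ (1 / 3 : ℝ) := by
      calc (N : ℝ) = ((N : ℝ) ^ 3) ^ (1 / 3 : ℝ) := by
            rw [← Real.rpow_natCast, ← Real.rpow_mul hN0.le]; norm_num
        _ ≤ (K : ℝ) ^ (1 / 3 : ℝ) := by gcongr
    calc (N : ℝ) * K ≤ (K : ℝ) ^ (1 / 3 : ℝ) * (K : ℝ) ^ (1 : ℝ) := by
          rw [Real.rpow_one]; gcongr
      _ = ((K : ℝ) ^ (2 / 3 : ℝ)) ^ 2 := by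
          rw [← Real.rpow_add hK0, ← Real.rpow_natCast, ← Real.rpow_mul hK0.le]; norm_num
  have r34 : Real.sqrt (N * K) ≤ (K : ℝ) ^ (3 / 4 : ℝ) :=
    r23.trans (Real.rpow_le_rpow_of_exponent_le hK1 (by norm_num))
  have r1 : Real.sqrt (N * K) ≤ K := by
    refine r23.trans ?_
    nth_rewrite 2 [← Real.rpow_one (K : ℝ)]
    exact Real.rpow_le_rpow_of_exponent_le hK1 (by norm_num)
  unfold Constants.rate
  simp only [div_one, mul_one, add_div]
  refine add_le_add (add_le_add (add_le_add ?_ ?_) ?_) ?_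
  · gcongr
  · rw [Real.div_rpow (by positivity) (by positivity), ← Real.sqrt_eq_rpow (N * K : ℝ),
      ← mul_div_assoc]
    gcongr
  · rw [Real.div_rpow (by positivity) hK0.le, ← mul_div_assoc]
    gcongr
  · rw [Real.div_rpow (by positivity) hK0.le, ← mul_div_assoc]
    gcongr

lemma momentum_mono (hc : c.Valid) (K : ℕ) {Λ Λ' : ℝ} (hΛ : 0 ≤ Λ) (h : Λ ≤ Λ') :
    c.momentum K Λ ≤ c.momentum K Λ' := by
  have hθ := theta_pos hc
  have hβ := beta_pos hc
  have hα : 0 < 1 - c.alpha := by linarith [hc.alpha_lt]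
  have hC2 := C2_pos hc
  unfold Constants.momentum
  gcongr

lemma momentum_pos (hN : 0 < N) (hc : c.Valid) {K : ℕ} (hK : 0 < K) {Λ : ℝ} (hΛ : 0 < Λ) :
    0 < c.momentum K Λ := by
  have hN' : (0 : ℝ) < N := by exact_mod_cast hN
  have hK' : (0 : ℝ) < K := by exact_mod_cast hK
  have hσ := hc.sigma_pos
  have hθ := theta_pos hc
  have hβ := beta_pos hc
  have hα : 0 < 1 - c.alpha := by linarith [hc.alpha_lt]
  have hC2 := C2_pos hc
  unfold Constants.momentum
  refine lt_min ?_ (lt_min ?_ ?_) <;> positivity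

lemma continuous_momentum (c : Constants N) (K : ℕ) : Continuous (c.momentum K) := by
  have h := fun (q : ℝ) (hq : 0 ≤ q) => Real.continuous_rpow_const hq
  unfold Constants.momentum
  refine Continuous.min ((h _ (by norm_num)).comp (by fun_prop))
    (Continuous.min ((h _ (by norm_num)).comp (by fun_prop)) ((h _ (by norm_num)).comp
      (by fun_prop)))

lemma eventually_momentum_lt (c : Constants N) (Λ : ℝ) {δ : ℝ} (hδ : 0 < δ) :
    ∀ᶠ K : ℕ in Filter.atTop, c.momentum K Λ < δ := by
  have h1 : Filter.Tendsto (fun K : ℕ => c.C2 * N * Λ / (2 * c.sigma ^ 2) / (K : ℝ))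
      Filter.atTop (nhds 0) := tendsto_const_div_atTop_nhds_zero_nat _
  have h2 := ((Real.continuous_rpow_const (q := 1 / 2) (by norm_num)).tendsto 0).comp h1
  rw [Real.zero_rpow (by norm_num)] at h2
  filter_upwards [h2.eventually (gt_mem_nhds hδ)] with K hK
  refine (min_le_left _ _).trans_lt ?_
  rw [← div_div]
  exact hK

lemma continuous_stepSize (c : Constants N) : Continuous c.stepSize := by
  unfold Constants.stepSize
  fun_prop

/-- Solvability of the momentum equation, by the intermediate value theorem: if the initial Lyapunov
value is a continuous function of `η` with positive lower and upper bounds `δ` and `Λ'`, then for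
large `K` the difference of the two sides changes sign between `c.momentum K δ` and `1/2`. -/
lemma eventually_exists_momentum (hN : 0 < N) (hc : c.Valid) {Λ : ℝ → ℝ} {δ Λ' : ℝ} (hδ : 0 < δ)
    (hcont : ContinuousOn Λ (Set.Ioi 0)) (hlow : ∀ η, 0 < η → η ≤ 1 → δ ≤ Λ η)
    (hup : ∀ η, 0 < η → η ≤ 1 → Λ η ≤ Λ') :
    ∀ᶠ K : ℕ in Filter.atTop, ∃ η : ℝ, 0 < η ∧ η < 1 ∧ η = c.momentum K (Λ η) := by
  filter_upwards [eventually_momentum_lt c Λ' (by norm_num : (0 : ℝ) < 1 / 2),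
    Filter.eventually_gt_atTop 0] with K hK hK0
  have hδΛ : δ ≤ Λ' := (hlow 1 one_pos le_rfl).trans (hup 1 one_pos le_rfl)
  set a := c.momentum K δ with ha
  have ha0 : 0 < a := momentum_pos hN hc hK0 hδ
  have ha1 : a < 1 / 2 := (momentum_mono hc K hδ.le hδΛ).trans_lt hK
  have hf : ContinuousOn (fun η => c.momentum K (Λ η) - η) (Set.Icc a (1 / 2)) :=
    ((continuous_momentum c K).comp_continuousOn
      (hcont.mono fun x hx => ha0.trans_le hx.1)).sub continuousOn_id
  have hfa : 0 ≤ c.momentum K (Λ a) - a :=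
    sub_nonneg.2 (momentum_mono hc K hδ.le (hlow a ha0 (by linarith)))
  have hfb : c.momentum K (Λ (1 / 2)) - 1 / 2 ≤ 0 := by
    have := momentum_mono hc K (hδ.le.trans (hlow (1 / 2) (by norm_num) (by norm_num)))
      (hup (1 / 2) (by norm_num) (by norm_num))
    linarith
  obtain ⟨η, hη, he⟩ := intermediate_value_Icc' ha1.le hf ⟨hfb, hfa⟩
  exact ⟨η, ha0.trans_le hη.1, hη.2.trans_lt (by norm_num), (sub_eq_zero.1 he).symm⟩

end Rate

/-! ### The initial Lyapunov value -/

section Initial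

variable {N n p : ℕ} {Ξ S Ω : Type*} [MeasurableSpace Ξ] [MeasurableSpace S] [MeasurableSpace Ω]
  {P : Measure Ω} [IsProbabilityMeasure P] {pb : Problem N n p Ξ} {c : Constants N}
  {ν : Measure S} {C : S → Mat n p → Mat n p} {ξ : ℕ → Ω → Fin N → Ξ}
  {ζ : ℕ → Ω → Fin N → S} {X₀ : Mat n p}

namespace Setting

/-- The initial Lyapunov value in terms of three nonnegative moments that depend neither on the
momentum nor on the number of iterations. -/
lemma exists_initial_moments (H : Setting P pb c ν C ξ ζ X₀) :
    ∃ G Q R : ℝ, 0 ≤ G ∧ 0 ≤ Q ∧ 0 ≤ R ∧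
      (∀ γ η, ∫ ω, lyapunov pb c γ η (init pb.sgrad C X₀ (ξ 0 ω) (ζ 0 ω)) ∂P
        = merit pb.obj c.mu X₀ - meritInf pb.obj c.mu c.eps + 2 * γ / c.theta * G
          + 2 * 2 * γ * η * c.beta / c.theta * Q + 2 * γ / η * R) ∧
      ∫ ω, lyapunovBound pb c (init pb.sgrad C X₀ (ξ 0 ω) (ζ 0 ω)) ∂P
        = merit pb.obj c.mu X₀ - meritInf pb.obj c.mu c.eps + 2 * c.gammaSafe / c.theta * G
          + 4 * c.gammaSafe * c.beta / c.theta * Q + 1 / (6 * c.L) * R := by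
  have hform := fun a b d => H.integral_merit_add_errors le_rfl (gammaSafe_pos H.valid).le 0 0 a b d
  have hm : ∫ ω, merit pb.obj c.mu (traj pb c C ξ ζ X₀ 0 0 0 ω).X ∂P = merit pb.obj c.mu X₀ :=
    (integral_const (merit pb.obj c.mu X₀)).trans (by simp)
  rw [hm] at hform
  exact ⟨_, _, _, integral_nonneg fun ω => compErr_nonneg _,
    integral_nonneg fun ω => localMomErr_nonneg pb _, integral_nonneg fun ω => momErr_nonneg pb _,
    fun γ η => hform _ _ _, hform _ _ _⟩

lemma initial_lyapunov_le (H : Setting P pb c ν C ξ ζ X₀) {η : ℝ} (hη0 : 0 < η) (hη1 : η ≤ 1) :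
    ∫ ω, lyapunov pb c (c.stepSize η) η (init pb.sgrad C X₀ (ξ 0 ω) (ζ 0 ω)) ∂P
      ≤ ∫ ω, lyapunovBound pb c (init pb.sgrad C X₀ (ξ 0 ω) (ζ 0 ω)) ∂P := by
  obtain ⟨G, Q, R, hG, hQ, hR, h1, h2⟩ := H.exists_initial_moments
  have hc := H.valid
  have hθ := theta_pos hc
  have hβ := beta_pos hc
  have hL := hc.L_pos
  have hγ := stepSize_pos hc hη0
  have hγs := (stepSize_le c η).1
  have hγL := (stepSize_le c η).2.2.1
  rw [h1, h2]
  have e1 : 2 * c.stepSize η / c.theta * G ≤ 2 * c.gammaSafe / c.theta * G := by gcongr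
  have e2 : 2 * 2 * c.stepSize η * η * c.beta / c.theta * Q
      ≤ 4 * c.gammaSafe * c.beta / c.theta * Q := by
    have : c.stepSize η * η ≤ c.gammaSafe * 1 := by gcongr; exact hγ.le.trans hγs
    have h3 : 2 * 2 * c.stepSize η * η ≤ 4 * c.gammaSafe := by linarith
    gcongr
  have e3 : 2 * c.stepSize η / η * R ≤ 1 / (6 * c.L) * R := by
    refine mul_le_mul_of_nonneg_right ?_ hR
    rw [div_le_iff₀ hη0]
    calc 2 * c.stepSize η ≤ 2 * (η / (12 * c.L)) := by gcongr
      _ = 1 / (6 * c.L) * η := by field_simp; norm_num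
  linarith

lemma le_initial_lyapunov (H : Setting P pb c ν C ξ ζ X₀) {η : ℝ} (hη0 : 0 < η) :
    merit pb.obj c.mu X₀ - meritInf pb.obj c.mu c.eps
      ≤ ∫ ω, lyapunov pb c (c.stepSize η) η (init pb.sgrad C X₀ (ξ 0 ω) (ζ 0 ω)) ∂P := by
  obtain ⟨G, Q, R, hG, hQ, hR, h1, -⟩ := H.exists_initial_moments
  have hθ := theta_pos H.valid
  have hβ := beta_pos H.valid
  have hγ := stepSize_pos H.valid hη0
  rw [h1]
  have : 0 ≤ 2 * c.stepSize η / c.theta * G + 2 * 2 * c.stepSize η * η * c.beta / c.theta * Q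
      + 2 * c.stepSize η / η * R := by positivity
  linarith

lemma continuousOn_initial_lyapunov (H : Setting P pb c ν C ξ ζ X₀) :
    ContinuousOn (fun η =>
      ∫ ω, lyapunov pb c (c.stepSize η) η (init pb.sgrad C X₀ (ξ 0 ω) (ζ 0 ω)) ∂P)
      (Set.Ioi 0) := by
  obtain ⟨G, Q, R, -, -, -, h1, -⟩ := H.exists_initial_moments
  simp only [h1]
  have hs := (continuous_stepSize c).continuousOn (s := Set.Ioi 0)
  have hdiv : ContinuousOn (fun η => 2 * c.stepSize η / η) (Set.Ioi 0) :=
    (hs.const_smul (2 : ℝ)).div continuousOn_id fun η hη => ne_of_gt hη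
  fun_prop

end Setting

end Initial

end EFLanding

end

open MeasureTheory ProbabilityTheory EFLanding in
theorem theorem3 {N n p : ℕ} (hN : 0 < N) {Ξ S Ω : Type*} [MeasurableSpace Ξ] [MeasurableSpace S]
    [MeasurableSpace Ω] (P : Measure Ω) [IsProbabilityMeasure P]
    (pb : Problem N n p Ξ) (c : Constants N) (hc : c.Valid)
    (hwp : pb.WellPosed c.eps)
    (hgrad : pb.GradientBound c.eps c.Lgrad)
    (hsmooth : pb.Smooth c.eps c.Lnode)
    (hL : SmoothOn pb.obj c.L (safeRegion n p c.eps))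
    (hLm : SmoothOn (merit pb.obj c.mu) c.Lm (safeRegion n p c.eps))
    (hlow : pb.LowerBounded c.eps)
    (hvar : pb.BoundedVariance c.eps c.sigma)
    (ν : Measure S) [IsProbabilityMeasure ν]
    (C : S → Mat n p → Mat n p) (hC : Contractive C ν c.alpha)
    (ξ : ℕ → Ω → Fin N → Ξ) (ζ : ℕ → Ω → Fin N → S) (hsamp : SamplingModel P pb.D ν ξ ζ)
    (X₀ : Mat n p) (hX₀ : X₀ ∈ safeRegion n p c.eps)
    (L₀ : ℝ → ℝ)
    (hL₀ : ∀ η, L₀ η =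
      ∫ ω, lyapunov pb c (c.stepSize η) η (init pb.sgrad C X₀ (ξ 0 ω) (ζ 0 ω)) ∂P)
    (X : ℝ → ℕ → Ω → Mat n p)
    (hX : ∀ η k ω, X η k ω =
      (run pb.sgrad C c.Lgrad c.lam (c.stepSize η) η X₀
        (fun l => ξ l ω) (fun l => ζ l ω) k).X) :
    (∀ K : ℕ, 0 < K → ∀ η : ℝ, 0 < η → η ≤ 1 → η = c.momentum K (L₀ η) →
      (∀ k, Integrable (fun ω => ‖riemGrad pb.obj (X η k ω)‖ ^ 2) P) ∧
      (∀ k, Integrable (fun ω => penalty (X η k ω)) P) ∧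
      1 / (K : ℝ) * ∑ k ∈ Finset.range K, ∫ ω, ‖riemGrad pb.obj (X η k ω)‖ ^ 2 ∂P
        ≤ 4 * c.rate N K (L₀ η) ∧
      1 / (K : ℝ) * ∑ k ∈ Finset.range K, ∫ ω, penalty (X η k ω) ∂P
        ≤ 2 / (c.lam * c.mu) * c.rate N K (L₀ η) ∧
      (N ^ 3 ≤ K → c.rate N K (L₀ η) ≤
        c.rate 1 1 (∫ ω, lyapunovBound pb c (init pb.sgrad C X₀ (ξ 0 ω) (ζ 0 ω)) ∂P)
          / Real.sqrt (N * K))) ∧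
    (meritInf pb.obj c.mu c.eps < merit pb.obj c.mu X₀ →
      ∀ᶠ K : ℕ in Filter.atTop, ∃ η : ℝ, 0 < η ∧ η < 1 ∧ η = c.momentum K (L₀ η)) := by
  have H : Setting P pb c ν C ξ ζ X₀ :=
    ⟨hN, hc, hwp, hgrad, hsmooth, hL, hLm, hvar, hC, hsamp, hX₀⟩
  obtain rfl : L₀ = fun η =>
      ∫ ω, lyapunov pb c (c.stepSize η) η (init pb.sgrad C X₀ (ξ 0 ω) (ζ 0 ω)) ∂P := funext hL₀
  obtain rfl : X = fun η k ω => (traj pb c C ξ ζ X₀ (c.stepSize η) η k ω).X := by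
    funext η k ω; exact hX η k ω
  clear hL₀ hX
  have hstart := sub_nonneg.2 (meritInf_le hLm hX₀)
  refine ⟨fun K hK η hη0 hη1 hη => ?_, fun hlt => ?_⟩
  · beta_reduce at hη ⊢
    have hγ := stepSize_pos hc hη0
    have hγs := (stepSize_le c η).1
    have hΛ0 := hstart.trans (H.le_initial_lyapunov hη0)
    have hΛ : 0 < ∫ ω, lyapunov pb c (c.stepSize η) η
        (init pb.sgrad C X₀ (ξ 0 ω) (ζ 0 ω)) ∂P := by
      refine lt_of_le_of_ne hΛ0 fun h0 => hη0.ne' ?_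
      -- a vanishing initial Lyapunov value would force the momentum to vanish
      rw [← h0] at hη
      have h1 := hη.le.trans (min_le_left _ _)
      simp only [mul_zero, zero_div] at h1
      rw [Real.zero_rpow (by norm_num)] at h1
      exact le_antisymm h1 hη0.le
    have hav := (H.average_stationarity_le hη0 hη1 hK).trans
      (le_rate_of_eq_momentum hN hc hK hΛ hη0 hη)
    change _ ≤ c.rate N K
      (∫ ω, lyapunov pb c (c.stepSize η) η (init pb.sgrad C X₀ (ξ 0 ω) (ζ 0 ω)) ∂P) at hav
    have hr : 0 ≤ 1 / (K : ℝ) * ∑ k ∈ Finset.range K,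
        ∫ ω, ‖riemGrad pb.obj (traj pb c C ξ ζ X₀ (c.stepSize η) η k ω).X‖ ^ 2 ∂P :=
      mul_nonneg (by positivity) (Finset.sum_nonneg fun k _ =>
        integral_nonneg fun ω => by positivity)
    have hq : 0 ≤ 1 / (K : ℝ) * ∑ k ∈ Finset.range K,
        ∫ ω, penalty (traj pb c C ξ ζ X₀ (c.stepSize η) η k ω).X ∂P :=
      mul_nonneg (by positivity) (Finset.sum_nonneg fun k _ =>
        integral_nonneg fun ω => penalty_nonneg _)
    have hlm : 0 < c.lam * c.mu := mul_pos hc.lam_pos (mu_pos hc)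
    refine ⟨H.integrable_riemGrad hγ.le hγs η, H.integrable_penalty hγ.le hγs η, ?_, ?_,
      fun hNK => rate_le_of_cube_le hN hc hNK hΛ.le (H.initial_lyapunov_le hη0 hη1)⟩
    · have := mul_nonneg hlm.le hq
      linarith
    · rw [div_mul_eq_mul_div 2]
      refine (le_div_iff₀ hlm).2 ?_
      linarith
  · exact eventually_exists_momentum hN hc (sub_pos.2 hlt) H.continuousOn_initial_lyapunov
      (fun η h0 _ => H.le_initial_lyapunov h0) (fun η h0 h1 => H.initial_lyapunov_le h0 h1)
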